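/- \textbf{Proposition (Forwarding control).} Fix $T>0$, $\omega=2\pi/T$ and dimensions $n,m,q,r$. \emph{Notation.} $\ell^2(\mathbb C^d)$ is the space of square summable sequences $(X_k)_{k\in\mathbb Z}$ in $\mathbb C^d$. For a signal $x$, $\mathcal F_T(x)(t)$ is the sequence of phasors $\frac1T\int_{t-T}^t x(\tau)e^{-j\omega k\tau}d\tau$, $k\in\mathbb Z$. For a $T$-periodic matrix function $A$ with Fourier coefficients $A_k=\frac1T\int_0^TA(\tau)e^{-j\omega k\tau}d\tau$, $\mathcal T_T(A)=(A_{k-l})_{k,l\in\mathbb Z}$ is its infinite block Toeplitz matrix; likewise a vector sequence $X$ defines $\mathcal X=(X_{k-l})_{k,l}$. $\mathcal N=\mathrm{diag}(j\omega k\,\mathrm{Id},\ k\in\mathbb Z)$, and $^*$ is the conjugate transpose. A function $X$ with values in $\ell^2(\mathbb C^d)$, defined on an interval $[0,b)$, $0<b\le\infty$, belongs to $H$ if each $X_k$ is locally absolutely continuous and $\dot X_k(t)=\dot X_0(t)e^{-j\omega kt}$ for almost every $t$ (that is, if $X=\mathcal F_T(x)$ for some $x\in L^2_{loc}$). \emph{System.}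 Let $A_{ind},A_{dep}\in\mathbb C^{n\times n}$, $B_{ind},B_{dep}\in\mathbb C^{n\times m}$ be constant matrices, let $w:\mathbb R\to\mathbb C^m$ be $T$-periodic and of class $L^2$ on a period, and put $W=\mathcal F_T(w)$, $\mathcal W=(W_{k-l})_{k,l}$. For a scalar sequence $S\in\ell^2(\mathbb C)$ with Toeplitz matrix $\mathcal S$, put $\mathcal A(S)=\mathcal T_T(A_{ind})+\mathcal S\otimes A_{dep}$ and $\mathcal B(S)=\mathcal T_T(B_{ind})+\mathcal S\otimes B_{dep}$. Let $X^e\in\ell^2(\mathbb C^n)$, $S^e\in\ell^2(\mathbb C)$ be a harmonic equilibrium: $0=(\mathcal A(S^e)-\mathcal N)X^e+\mathcal B(S^e)W$. Put $\mathcal A=\mathcal A(S^e)$ and $\mathcal G(X)=\mathcal T_T(A_{dep})\mathcal X+\mathcal T_T(B_{dep})\mathcal W$. Let $\mathcal O=\mathcal T_T(O)$ with $O$ $T$-periodic, $q\times q$, of class $L^2$ on a period, and $\mathcal O^*=-\mathcal O$; let $\mathcal L=\mathcal T_T(L)$, $\mathcal C=\mathcal T_T(C)$ with $L$ ($q\times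 r$) and $C$ ($r\times n$) $T$-periodic of class $L^\infty$. Consider the augmented harmonic system, whose first equation is the harmonic bilinear affine model $\dot X=(\mathcal A(S)-\mathcal N)X+\mathcal B(S)W$ written around the equilibrium: $$\dot X=(\mathcal A-\mathcal N)(X-X^e)+\mathcal G(X)(S-S^e),\qquad \dot Z=(\mathcal O-\mathcal N)Z+\mathcal L\mathcal C(X-X^e).$$ \emph{Feedback.} Let $Q$ be a $T$-periodic $L^\infty$ function with Hermitian positive definite values almost everywhere and $\mathcal Q=\mathcal T_T(Q)$. Let $\mathcal P=\mathcal T_T(P)$, with $P$ $T$-periodic and $L^2$ on a period, be a Hermitian positive definite solution ($Y^*\mathcal PY>0$ for $0\ne Y\in\ell^2(\mathbb C^n)$) of the harmonic Lyapunov equation $$(\mathcal A-\mathcal N)^*\mathcal P+\mathcal P(\mathcal A-\mathcal N)+\mathcal Q=0,$$ and let $\mathcal M=\mathcal T_T(M)$, with $M$ $T$-periodic and $L^2$ on a period, satisfy the harmonic Sylvester equation $$(\mathcal O-\mathcal N)\mathcal M-\mathcal M(\mathcal A-\mathcal N)+\mathcal L\mathcal C=0.$$ For $\eta>0$ close the loop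 with $$S(t)=S^e-\eta\,\mathcal G(X(t))^*\big[\mathcal P(X(t)-X^e)-\mathcal M^*\big(Z(t)-\mathcal M(X(t)-X^e)\big)\big].$$ A solution on $[0,b)$ is a triple $(X,Z,S)$ with $X,Z\in H$ and $S(t)\in\ell^2(\mathbb C)$ that satisfies this law for all $t$ and, phasor by phasor, the two differential equations for almost every $t$. \emph{Conclusion.} The feedback globally asymptotically stabilizes the equilibrium $X^e$: \begin{enumerate} \item for all $x_0\in\mathbb C^n$, $z_0\in\mathbb C^q$ there is a solution on $[0,\infty)$ with $X=\mathcal F_T(x)$, $Z=\mathcal F_T(z)$ for continuous $x,z$ on $[-T,\infty)$ with $x(-T)=x_0$, $z(-T)=z_0$; and every solution on some $[0,b)$, $0<b<\infty$, extends to a solution on $[0,\infty)$; \item for every $\varepsilon>0$ there is $\delta>0$ such that every solution on $[0,\infty)$ with $\|X(0)-X^e\|_{\ell^2}<\delta$ and $\|Z(0)\|_{\ell^2}<\delta$ satisfies $\|X(t)-X^e\|_{\ell^2}<\varepsilon$ and $\|Z(t)\|_{\ell^2}<\varepsilon$ for all $t\ge0$; \item for every solution on $[0,\infty)$, $X(t)\to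 X^e$ in $\ell^2$ as $t\to\infty$, and $Z$ is bounded in $\ell^2$. \end{enumerate} -/

import Mathlib

open MeasureTheory Set Filter Topology
open scoped Matrix ENNReal ComplexOrder

noncomputable section

namespace Harmonic

/-! ### Sequences, infinite block matrices -/

/-- The Hilbert space `ℓ²(ℂⁿ)` of square summable two-sided sequences in `ℂⁿ`. -/
abbrev Ell2 (n : ℕ) : Type := lp (fun _ : ℤ => EuclideanSpace ℂ (Fin n)) 2

/-- Infinite block matrices with blocks of size `a × b`, indexed by `ℤ × ℤ`. -/
abbrev HMat (a b : ℕ) : Type := ℤ → ℤ → Matrix (Fin a) (Fin b) ℂ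

/-- Product of infinite block matrices. -/
def HMat.mul {a b c : ℕ} (A : HMat a b) (B : HMat b c) : HMat a c :=
  fun k l => ∑' m : ℤ, A k m * B m l

/-- Conjugate transpose of an infinite block matrix. -/
def HMat.adj {a b : ℕ} (A : HMat a b) : HMat b a :=
  fun k l => (A l k)ᴴ

/-- Action of an infinite block matrix on a sequence of vectors. -/
def HMat.act {a b : ℕ} (A : HMat a b) (X : ℤ → EuclideanSpace ℂ (Fin b)) :
    ℤ → EuclideanSpace ℂ (Fin a) :=
  fun k => ∑' l : ℤ, Matrix.toEuclideanLin (A k l) (X l)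

/-- Block diagonal matrix. With constant blocks `D`, this is the block Toeplitz matrix of the
constant matrix function `D`. -/
def HMat.diag {a b : ℕ} (D : ℤ → Matrix (Fin a) (Fin b) ℂ) : HMat a b :=
  fun k l => if k = l then D k else 0

/-- Hermitian positive definite infinite matrix: `𝒫^* = 𝒫` and `X^* 𝒫 X > 0` for every
nonzero `X ∈ ℓ²`. -/
def HMat.IsPosDef {n : ℕ} (P : HMat n n) : Prop :=
  P.adj = P ∧
    ∀ X : Ell2 n, X ≠ 0 → 0 < (∑' k : ℤ, inner ℂ (X k) (P.act X k)).re

/-- The matrix `𝒩 = diag (j ω k Idₙ, k ∈ ℤ)`, with `ω = 2π / T`. -/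
def matN (T : ℝ) (n : ℕ) : HMat n n :=
  HMat.diag fun k => (Complex.I * ((2 * Real.pi / T * (k : ℝ) : ℝ) : ℂ)) • 1

/-! ### Sliding Fourier decomposition -/

/-- The character `e^{-j ω k τ}`, `ω = 2π / T`. -/
def expo (T : ℝ) (k : ℤ) (τ : ℝ) : ℂ :=
  Complex.exp (-(Complex.I * ((2 * Real.pi / T * (k : ℝ) * τ : ℝ) : ℂ)))

/-- The `k`-th phasor at time `t` of a vector signal over the window `[t - T, t]`. -/
def phasor {n : ℕ} (T : ℝ) (x : ℝ → EuclideanSpace ℂ (Fin n)) (t : ℝ) (k : ℤ) :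
    EuclideanSpace ℂ (Fin n) :=
  ((1 / T : ℝ) : ℂ) • ∫ τ in (t - T)..t, expo T k τ • x τ

/-- The `k`-th phasor at time `t` of a matrix function, computed entrywise. -/
def phasorMat {a b : ℕ} (T : ℝ) (A : ℝ → Matrix (Fin a) (Fin b) ℂ) (t : ℝ) (k : ℤ) :
    Matrix (Fin a) (Fin b) ℂ :=
  Matrix.of fun i j => ((1 / T : ℝ) : ℂ) * ∫ τ in (t - T)..t, expo T k τ * A τ i j

/-- The block Toeplitz matrix `𝒯_T(A)` of a `T`-periodic matrix function `A`. For such an `A`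
the phasors do not depend on the time at which the window ends; they are taken at `0`. -/
def toeplitz {a b : ℕ} (T : ℝ) (A : ℝ → Matrix (Fin a) (Fin b) ℂ) : HMat a b :=
  fun k l => phasorMat T A 0 (k - l)

/-- `A` is `T`-periodic and of class `L^p` on one period. -/
def PeriodicLp {a b : ℕ} (T : ℝ) (p : ℝ≥0∞) (A : ℝ → Matrix (Fin a) (Fin b) ℂ) : Prop :=
  Function.Periodic A T ∧
    ∀ i j, MemLp (fun t => A t i j) p (volume.restrict (Ioc 0 T))

/-- The block Toeplitz matrix built from a sequence of vectors (seen as columns). When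
`X = ℱ_T(x)(t)` this is `𝒯_T(x)(t)`. -/
def seqToeplitz {n : ℕ} (X : ℤ → EuclideanSpace ℂ (Fin n)) : HMat n 1 :=
  fun k l => Matrix.of fun i _ => X (k - l) i

/-- The class `H` on a time interval `I ∋ 0`: phasors are locally absolutely continuous and
satisfy the coincidence condition `Ẋ_k(t) = Ẋ_0(t) e^{-jωkt}` almost everywhere. -/
def InH {n : ℕ} (T : ℝ) (I : Set ℝ) (X : ℝ → Ell2 n) : Prop :=
  (∀ k : ℤ, ∀ c ∈ I, AbsolutelyContinuousOnInterval (fun t => X t k) 0 c) ∧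
    ∀ k : ℤ, ∀ᵐ t ∂(volume.restrict I),
      deriv (fun r => X r k) t = expo T k t • deriv (fun r => X r 0) t

/-! ### The bilinear affine harmonic model -/

/-- `D_ind + S ⊗ D_dep`, where `S` stands for the scalar Toeplitz matrix of the sequence. -/
def affineMat {a b : ℕ} (Dind Ddep : Matrix (Fin a) (Fin b) ℂ)
    (S : ℤ → EuclideanSpace ℂ (Fin 1)) : HMat a b :=
  HMat.diag (fun _ => Dind) + fun k l => (S (k - l) 0) • Ddep

/-- `(X^e, S^e, W)` is a harmonic equilibrium:
`0 = (𝒜(S^e) - 𝒩) X^e + ℬ(S^e) W`. -/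
def IsEquilibrium {n m : ℕ} (T : ℝ) (Aind Adep : Matrix (Fin n) (Fin n) ℂ)
    (Bind Bdep : Matrix (Fin n) (Fin m) ℂ) (Xe : Ell2 n) (Se : Ell2 1)
    (W : ℤ → EuclideanSpace ℂ (Fin m)) : Prop :=
  (affineMat Aind Adep Se - matN T n).act Xe + (affineMat Bind Bdep Se).act W = 0

/-- `𝒢(X) = 𝒜_dep 𝒳 + ℬ_dep 𝒲`. -/
def matG {n m : ℕ} (Adep : Matrix (Fin n) (Fin n) ℂ) (Bdep : Matrix (Fin n) (Fin m) ℂ)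
    (W : ℤ → EuclideanSpace ℂ (Fin m)) (X : ℤ → EuclideanSpace ℂ (Fin n)) : HMat n 1 :=
  (HMat.diag fun _ => Adep).mul (seqToeplitz X) + (HMat.diag fun _ => Bdep).mul (seqToeplitz W)

/-- `(X, Z, S)` is, on the interval `I`, a solution in `H` (in the sense of Carathéodory) of
`Ẋ = (𝒜 - 𝒩)(X - X^e) + 𝒢(X)(S - S^e)`,
`Ż = (𝒪 - 𝒩) Z + ℒ𝒞 (X - X^e)`. -/
def IsAugmentedSolution {n q : ℕ} (T : ℝ) (A : HMat n n) (O : HMat q q) (LC : HMat q n)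
    (G : (ℤ → EuclideanSpace ℂ (Fin n)) → HMat n 1) (Xe : Ell2 n) (Se : Ell2 1)
    (I : Set ℝ) (X : ℝ → Ell2 n) (Z : ℝ → Ell2 q) (S : ℝ → Ell2 1) : Prop :=
  InH T I X ∧ InH T I Z ∧
    (∀ k : ℤ, ∀ᵐ t ∂(volume.restrict I), HasDerivAt (fun r => X r k)
      ((A - matN T n).act (X t - Xe) k + (G (X t)).act (S t - Se) k) t) ∧
    (∀ k : ℤ, ∀ᵐ t ∂(volume.restrict I), HasDerivAt (fun r => Z r k)
      ((O - matN T q).act (Z t) k + LC.act (X t - Xe) k) t)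

/-- The forwarding feedback law, on the interval `I`:
`S = S^e - η 𝒢(X)^* [𝒫 (X - X^e) - ℳ^* (Z - ℳ (X - X^e))]`. -/
def IsForwardingFeedback {n q : ℕ} (η : ℝ) (P : HMat n n) (M : HMat q n)
    (G : (ℤ → EuclideanSpace ℂ (Fin n)) → HMat n 1) (Xe : Ell2 n) (Se : Ell2 1)
    (I : Set ℝ) (X : ℝ → Ell2 n) (Z : ℝ → Ell2 q) (S : ℝ → Ell2 1) : Prop :=
  ∀ t ∈ I, ∀ k : ℤ, S t k = Se k - (η : ℂ) •
    (G (X t)).adj.act (P.act (X t - Xe) - M.adj.act (⇑(Z t) - M.act (X t - Xe))) k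

/-- Global asymptotic stability of `X = X^e` for a closed loop with state `(X, Z)`, given through
its set of solutions `(X, Z, S)` on intervals `[0, b)` and `[0, ∞)`. -/
structure GloballyAsymptoticallyStable {n q : ℕ} (T : ℝ) (Xe : Ell2 n)
    (Sol : Set ℝ → (ℝ → Ell2 n) → (ℝ → Ell2 q) → (ℝ → Ell2 1) → Prop) : Prop where
  /-- From every initial value there is a solution on `[0, ∞)`. A harmonic state at time `0` is
  the Fourier decomposition of signals on the window `[-T, 0]`, which start at `-T`. -/
  exists_solution : ∀ (x₀ : EuclideanSpace ℂ (Fin n)) (z₀ : EuclideanSpace ℂ (Fin q)),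
    ∃ X Z S, Sol (Ici 0) X Z S ∧ ∃ x z, ContinuousOn x (Ici (-T)) ∧ ContinuousOn z (Ici (-T)) ∧
      x (-T) = x₀ ∧ z (-T) = z₀ ∧
      ∀ t, 0 ≤ t → ∀ k : ℤ, X t k = phasor T x t k ∧ Z t k = phasor T z t k
  /-- There is no finite escape time. -/
  extends_solution : ∀ b : ℝ, 0 < b → ∀ X Z S, Sol (Ico 0 b) X Z S →
    ∃ X' Z' S', Sol (Ici 0) X' Z' S' ∧
      ∀ t ∈ Ico 0 b, X' t = X t ∧ Z' t = Z t ∧ S' t = S t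
  /-- Lyapunov stability. -/
  stable : ∀ ε : ℝ, 0 < ε → ∃ δ : ℝ, 0 < δ ∧ ∀ X Z S, Sol (Ici 0) X Z S →
    ‖X 0 - Xe‖ < δ → ‖Z 0‖ < δ → ∀ t, 0 ≤ t → ‖X t - Xe‖ < ε ∧ ‖Z t‖ < ε
  /-- Global attractivity of `X^e`, whatever the initial values of `X` and `Z`. -/
  attractive : ∀ X Z S, Sol (Ici 0) X Z S → Tendsto X atTop (𝓝 Xe)
  /-- The additional state stays bounded. -/
  bounded : ∀ X Z S, Sol (Ici 0) X Z S → ∃ K : ℝ, ∀ t, 0 ≤ t → ‖Z t‖ ≤ K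

end Harmonic

end

open Harmonic

open Harmonic

namespace Harmonic

/-! ### Absolutely continuous functions -/

section AbsolutelyContinuous

variable {a b : ℝ}

/-! The harmonic closed loop is an ordinary time-periodic closed loop seen through a sliding Fourier
transform, and the stability argument is a Lyapunov argument for that ordinary system.

Dictionary. By Riesz-Fischer an element of ℓ² is the phasor sequence of an L² signal on a window.
The convolution formula `hasSum_fc_mul` makes a block Toeplitz matrix act as multiplication by its
symbol (`toepAt_act`, `toepAt_mul`). Integration by parts (`fc_of_eq_primitive`) makes 𝒩 act as
d/dt, up to the jump of the signal between the two ends of the window. For periodic signals there is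
no jump. Hence the equilibrium is a continuous periodic signal xe, and P and M have continuous
periodic representatives with P' = -(a*P + Pa + Q) and M' = oM - Ma + c
(`exists_equilibrium_signal`, `exists_lyapunov_primitive`, `exists_sylvester_primitive`). With e = x
- xe, the loop in time is e' = a e + u g(e), z' = o z + c e, where g(e) = Adep (e + xe) + Bdep w, ρ
= P e - M*(z - M e) and u = -η ⟨g(e), ρ⟩.

Lyapunov function. Put V = ⟨e, P e⟩ + ‖z - M e‖². The two matrix equations and the skewness of o
give V' = -⟨e, Q e⟩ - 2η |⟨g(e), ρ⟩|² almost everywhere (`Loop.deriv_algebra`,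
`Loop.V_add_integral_le`). Positivity of the Toeplitz matrix gives P(t) ≥ 0 pointwise, and the decay
of V along the uncontrolled loop upgrades this to P(t) > 0 (`Loop.P_pos`). By compactness of a
period, V is then uniformly equivalent to ‖e‖² + ‖z‖². This a priori bound yields global solutions
of an equation that is only locally Lipschitz (`Loop.exists_isSol`).

Equivalence of the two loops. Phasors of a time solution solve the harmonic loop
(`Plant.exists_sol_of_isSol`). Conversely (`Plant.exists_isSol_of_sol`), at almost every t the
differential equations identify the signal behind (X(t), Z(t)) as a primitive of the closed-loop
vector field, and the coincidence condition forces the signals at nearby times to agree on the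
overlap of their windows. Carathéodory uniqueness glues them into one trajectory starting at -T.

Conclusion. ‖X(t) - Xe‖² is the mean square of e over the window ending at t, and likewise for Z.
Monotonicity of V compares this window with the first one, which gives stability and boundedness
(`Loop.IsSol.integral_norm_sq_le`). The integral of ⟨e, Q e⟩ over a window is at most the drop of V
across it, which tends to 0. Since Q is positive only almost everywhere, without a uniform lower
bound, the set where Q < 1/n is handled by its small measure and the boundedness of e
(`Loop.IsSol.tendsto_integral_norm_sq`). -/

theorem absCont_of_dist_le {X Y Z : Type*} [PseudoMetricSpace X] [PseudoMetricSpace Y]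
    [PseudoMetricSpace Z] {h : ℝ → X} {f : ℝ → Y} {g : ℝ → Z}
    (hf : AbsolutelyContinuousOnInterval f a b) (hg : AbsolutelyContinuousOnInterval g a b)
    (K₁ K₂ : ℝ)
    (hle : ∀ x ∈ uIcc a b, ∀ y ∈ uIcc a b,
      dist (h x) (h y) ≤ K₁ * dist (f x) (f y) + K₂ * dist (g x) (g y)) :
    AbsolutelyContinuousOnInterval h a b := by
  have hlim := (Tendsto.const_mul K₁ hf).add (Tendsto.const_mul K₂ hg)
  simp only [mul_zero, add_zero] at hlim
  refine squeeze_zero' (Eventually.of_forall fun E => Finset.sum_nonneg fun i _ => dist_nonneg) ?_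
    hlim
  refine eventually_inf_principal.2 (Eventually.of_forall fun E hE => ?_)
  rw [Finset.mul_sum, Finset.mul_sum, ← Finset.sum_add_distrib]
  exact Finset.sum_le_sum fun i hi => hle _ (hE.1 i hi).1 _ (hE.1 i hi).2

theorem absCont_comp_clm {E F : Type*} [NormedAddCommGroup E] [NormedSpace ℝ E]
    [NormedAddCommGroup F] [NormedSpace ℝ F] (L : E →L[ℝ] F) {f : ℝ → E}
    (hf : AbsolutelyContinuousOnInterval f a b) :
    AbsolutelyContinuousOnInterval (fun t => L (f t)) a b := by
  refine absCont_of_dist_le hf hf ‖L‖ 0 fun x _ y _ => ?_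
  rw [zero_mul, add_zero]
  exact L.dist_le_opNorm _ _

theorem absCont_bilin {E F G : Type*} [NormedAddCommGroup E] [NormedSpace ℝ E]
    [NormedAddCommGroup F] [NormedSpace ℝ F] [NormedAddCommGroup G] [NormedSpace ℝ G]
    (B : E →L[ℝ] F →L[ℝ] G) {f : ℝ → E} {g : ℝ → F}
    (hf : AbsolutelyContinuousOnInterval f a b) (hg : AbsolutelyContinuousOnInterval g a b) :
    AbsolutelyContinuousOnInterval (fun t => B (f t) (g t)) a b := by
  obtain ⟨C, hC⟩ := hf.exists_bound
  obtain ⟨D, hD⟩ := hg.exists_bound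
  refine absCont_of_dist_le hf hg (‖B‖ * D) (‖B‖ * C) fun x hx y hy => ?_
  have h : B (f x) (g x) - B (f y) (g y) = B (f x - f y) (g x) + B (f y) (g x - g y) := by
    simp
  rw [dist_eq_norm, dist_eq_norm, dist_eq_norm, h]
  refine (norm_add_le _ _).trans (add_le_add ?_ ?_)
  · calc ‖B (f x - f y) (g x)‖ ≤ ‖B‖ * ‖f x - f y‖ * ‖g x‖ := B.le_opNorm₂ _ _
      _ ≤ ‖B‖ * ‖f x - f y‖ * D := by gcongr; exact hD x hx
      _ = _ := by ring
  · calc ‖B (f y) (g x - g y)‖ ≤ ‖B‖ * ‖f y‖ * ‖g x - g y‖ := B.le_opNorm₂ _ _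
      _ ≤ ‖B‖ * C * ‖g x - g y‖ := by gcongr; exact hC y hy

/-- Increments of the primitive of `h` are dominated by those of the primitive of `‖h‖`, which
reduces the vector-valued case to the real one. -/
theorem absCont_primitive {E : Type*} [NormedAddCommGroup E] [NormedSpace ℝ E]
    {h : ℝ → E} (hh : IntervalIntegrable h volume a b) :
    AbsolutelyContinuousOnInterval (fun t => ∫ s in a..t, h s) a b := by
  have hn := hh.norm.absolutelyContinuousOnInterval_intervalIntegral (c := a) left_mem_uIcc
  refine absCont_of_dist_le hn hn 1 0 fun x hx y hy => ?_
  have hsub : ∀ x ∈ uIcc a b, IntervalIntegrable h volume a x := fun x hx =>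
    hh.mono_set (uIcc_subset_uIcc_left hx)
  rw [zero_mul, add_zero, one_mul, dist_eq_norm, dist_eq_norm,
    intervalIntegral.integral_interval_sub_left (hsub x hx) (hsub y hy),
    intervalIntegral.integral_interval_sub_left (hsub x hx).norm (hsub y hy).norm]
  exact intervalIntegral.norm_integral_le_abs_integral_norm

theorem absCont_of_eq_primitive {E : Type*} [NormedAddCommGroup E] [NormedSpace ℝ E]
    {f h : ℝ → E} (hab : a ≤ b) (hh : IntervalIntegrable h volume a b)
    (hf : ∀ t ∈ Icc a b, f t = f a + ∫ s in a..t, h s) :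
    AbsolutelyContinuousOnInterval f a b := by
  refine absCont_of_dist_le (absCont_primitive hh) (absCont_primitive hh) 1 0
    fun x hx y hy => ?_
  rw [uIcc_of_le hab] at hx hy
  rw [hf x hx, hf y hy]
  simp

theorem ae_hasDerivAt_of_eq_primitive {E : Type*} [NormedAddCommGroup E] [NormedSpace ℝ E]
    [CompleteSpace E] {f h : ℝ → E} (hab : a ≤ b) (hh : IntervalIntegrable h volume a b)
    (hf : ∀ t ∈ Icc a b, f t = f a + ∫ s in a..t, h s) :
    ∀ᵐ t, t ∈ Ioo a b → HasDerivAt f (h t) t := by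
  filter_upwards [hh.ae_hasDerivAt_integral] with t ht hmem
  have h1 := (ht (by rw [uIcc_of_le hab]; exact Ioo_subset_Icc_self hmem) a
    left_mem_uIcc).const_add (f a)
  refine h1.congr_of_eventuallyEq ?_
  filter_upwards [isOpen_Ioo.mem_nhds hmem] with s hs
  exact hf s (Ioo_subset_Icc_self hs)

/-- The fundamental theorem of calculus in the form used throughout: the derivative need only be
identified almost everywhere, and its integrability is part of the conclusion. -/
theorem integrable_deriv_of_absCont_real {f f' : ℝ → ℝ} (hab : a ≤ b)
    (hf : AbsolutelyContinuousOnInterval f a b)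
    (hd : ∀ᵐ t, t ∈ Ioo a b → HasDerivAt f (f' t) t) :
    IntervalIntegrable f' volume a b ∧ ∫ t in a..b, f' t = f b - f a := by
  have hae : deriv f =ᵐ[volume.restrict (uIoc a b)] f' := by
    rw [uIoc_of_le hab, ← restrict_Ioo_eq_restrict_Ioc]
    refine (ae_restrict_iff' measurableSet_Ioo).2 ?_
    filter_upwards [hd] with t ht hm using (ht hm).deriv
  refine ⟨hf.intervalIntegrable_deriv.congr_ae hae, ?_⟩
  rw [← hf.integral_deriv_eq_sub]
  exact intervalIntegral.integral_congr_ae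
    ((ae_restrict_iff' measurableSet_uIoc).1 (hae.mono fun t ht => ht.symm))

theorem integrable_deriv_of_absCont {f f' : ℝ → ℂ} (hab : a ≤ b)
    (hf : AbsolutelyContinuousOnInterval f a b)
    (hd : ∀ᵐ t, t ∈ Ioo a b → HasDerivAt f (f' t) t) :
    IntervalIntegrable f' volume a b ∧ ∫ t in a..b, f' t = f b - f a := by
  have hre := integrable_deriv_of_absCont_real hab (absCont_comp_clm Complex.reCLM hf)
    (f' := fun t => (f' t).re)
    (by filter_upwards [hd] with t ht hm using
      Complex.reCLM.hasFDerivAt.comp_hasDerivAt t (ht hm))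
  have him := integrable_deriv_of_absCont_real hab (absCont_comp_clm Complex.imCLM hf)
    (f' := fun t => (f' t).im)
    (by filter_upwards [hd] with t ht hm using
      Complex.imCLM.hasFDerivAt.comp_hasDerivAt t (ht hm))
  have hint : IntervalIntegrable f' volume a b := by
    have h1 : IntervalIntegrable (fun t => ((f' t).re : ℂ)) volume a b :=
      ⟨hre.1.1.ofReal, hre.1.2.ofReal⟩
    have h2 : IntervalIntegrable (fun t => ((f' t).im : ℂ)) volume a b :=
      ⟨him.1.1.ofReal, him.1.2.ofReal⟩
    have := h1.add (h2.mul_const Complex.I)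
    simpa [Complex.re_add_im] using this
  refine ⟨hint, ?_⟩
  apply Complex.ext
  · have := Complex.reCLM.intervalIntegral_comp_comm hint
    simp only [Complex.reCLM_apply] at this hre
    rw [← this, hre.2, Complex.sub_re]
  · have := Complex.imCLM.intervalIntegral_comp_comm hint
    simp only [Complex.imCLM_apply] at this him
    rw [← this, him.2, Complex.sub_im]

end AbsolutelyContinuous

/-! ### The characters -/

theorem expo_zero (T τ : ℝ) : expo T 0 τ = 1 := by simp [expo]

theorem expo_add (T : ℝ) (k l : ℤ) (τ : ℝ) : expo T (k + l) τ = expo T k τ * expo T l τ := by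
  rw [expo, expo, expo, ← Complex.exp_add]
  congr 1; push_cast; ring

theorem norm_expo (T : ℝ) (k : ℤ) (τ : ℝ) : ‖expo T k τ‖ = 1 := by
  rw [expo, mul_comm, ← neg_mul, ← Complex.ofReal_neg]
  exact Complex.norm_exp_ofReal_mul_I _

theorem conj_expo (T : ℝ) (k : ℤ) (τ : ℝ) : (starRingEnd ℂ) (expo T k τ) = expo T (-k) τ := by
  rw [expo, expo, ← Complex.exp_conj]
  congr 1; simp only [map_neg, map_mul, Complex.conj_I, Complex.conj_ofReal]; push_cast; ring

theorem expo_periodic {T : ℝ} (hT : 0 < T) (k : ℤ) : Function.Periodic (expo T k) T := by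
  intro τ
  rw [expo, expo, Complex.exp_eq_exp_iff_exists_int]
  refine ⟨-k, ?_⟩
  have : (T : ℂ) ≠ 0 := by exact_mod_cast hT.ne'
  push_cast; field_simp; ring

theorem hasDerivAt_expo (T : ℝ) (k : ℤ) (τ : ℝ) :
    HasDerivAt (expo T k)
      (-(Complex.I * ((2 * Real.pi / T * (k : ℝ) : ℝ) : ℂ)) * expo T k τ) τ := by
  have h1 : HasDerivAt (fun τ : ℝ => -(Complex.I * ((2 * Real.pi / T * (k : ℝ) * τ : ℝ) : ℂ)))
      (-(Complex.I * ((2 * Real.pi / T * (k : ℝ) : ℝ) : ℂ))) τ := by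
    have := (((hasDerivAt_id τ).const_mul (2 * Real.pi / T * (k : ℝ))).ofReal_comp.const_mul
      Complex.I).fun_neg
    simpa using this
  have := h1.cexp
  rw [mul_comm]
  exact this

theorem continuous_expo (T : ℝ) (k : ℤ) : Continuous (expo T k) :=
  continuous_iff_continuousAt.2 fun τ => (hasDerivAt_expo T k τ).continuousAt

theorem contDiff_expo (T : ℝ) (k : ℤ) : ContDiff ℝ 1 (expo T k) := by
  rw [contDiff_one_iff_deriv]
  refine ⟨fun τ => (hasDerivAt_expo T k τ).differentiableAt, ?_⟩
  rw [show deriv (expo T k) = fun τ => -(Complex.I * ((2 * Real.pi / T * (k : ℝ) : ℝ) : ℂ)) *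
    expo T k τ from funext fun τ => (hasDerivAt_expo T k τ).deriv]
  exact continuous_const.mul (continuous_expo T k)

/-! ### Fourier coefficients of scalar signals over a window -/

section ScalarFourier

variable {T t : ℝ}

/-- Lebesgue measure on the window `(t - T, t]`. -/
noncomputable abbrev win (T t : ℝ) : Measure ℝ := volume.restrict (Ioc (t - T) t)

/-- The `k`-th Fourier coefficient of a scalar signal over the window `[t - T, t]`. -/
noncomputable def fc (T : ℝ) (f : ℝ → ℂ) (t : ℝ) (k : ℤ) : ℂ :=
  ((1 / T : ℝ) : ℂ) * ∫ τ in (t - T)..t, expo T k τ * f τ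

theorem intervalIntegrable_win (hT : 0 < T) {E : Type*} [NormedAddCommGroup E] {f : ℝ → E} :
    IntervalIntegrable f volume (t - T) t ↔ Integrable f (win T t) := by
  rw [intervalIntegrable_iff_integrableOn_Ioc_of_le (by linarith)]; rfl

theorem integral_win (hT : 0 < T) {E : Type*} [NormedAddCommGroup E] [NormedSpace ℝ E]
    (f : ℝ → E) : ∫ τ in (t - T)..t, f τ = ∫ τ, f τ ∂(win T t) :=
  intervalIntegral.integral_of_le (by linarith)

theorem integrable_expo_mul (k : ℤ) {f : ℝ → ℂ} {μ : Measure ℝ} (hf : Integrable f μ) :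
    Integrable (fun τ => expo T k τ * f τ) μ :=
  hf.bdd_mul (continuous_expo T k).aestronglyMeasurable
    (Eventually.of_forall fun τ => (norm_expo T k τ).le)

theorem memLp_expo_mul (k : ℤ) {f : ℝ → ℂ} {μ : Measure ℝ} {p : ℝ≥0∞} (hf : MemLp f p μ) :
    MemLp (fun τ => expo T k τ * f τ) p μ :=
  hf.of_le ((continuous_expo T k).aestronglyMeasurable.mul hf.1)
    (Eventually.of_forall fun τ => by rw [norm_mul, norm_expo, one_mul])

theorem fc_congr (hT : 0 < T) {f g : ℝ → ℂ} (h : f =ᵐ[win T t] g) (k : ℤ) :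
    fc T f t k = fc T g t k := by
  rw [fc, fc, integral_win hT, integral_win hT]
  congr 1
  exact integral_congr_ae (h.mono fun τ hτ => by simp only [hτ])

theorem fc_add (hT : 0 < T) {f g : ℝ → ℂ} (hf : Integrable f (win T t))
    (hg : Integrable g (win T t)) (k : ℤ) :
    fc T (fun τ => f τ + g τ) t k = fc T f t k + fc T g t k := by
  rw [fc, fc, fc, integral_win hT, integral_win hT, integral_win hT, ← mul_add,
    ← integral_add (integrable_expo_mul k hf) (integrable_expo_mul k hg)]
  simp only [mul_add]

theorem fc_const_mul (c : ℂ) (f : ℝ → ℂ) (k : ℤ) :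
    fc T (fun τ => c * f τ) t k = c * fc T f t k := by
  simp only [fc, mul_left_comm _ c, intervalIntegral.integral_const_mul]

theorem fc_sub (hT : 0 < T) {f g : ℝ → ℂ} (hf : Integrable f (win T t))
    (hg : Integrable g (win T t)) (k : ℤ) :
    fc T (fun τ => f τ - g τ) t k = fc T f t k - fc T g t k := by
  have h := fc_add hT hf (hg.const_mul (-1)) k
  rw [fc_const_mul] at h
  simpa [sub_eq_add_neg] using h

theorem fc_sum (hT : 0 < T) {ι : Type*} (s : Finset ι) {f : ι → ℝ → ℂ}
    (hf : ∀ i ∈ s, Integrable (f i) (win T t)) (k : ℤ) :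
    fc T (fun τ => ∑ i ∈ s, f i τ) t k = ∑ i ∈ s, fc T (f i) t k := by
  simp only [fc, integral_win hT, Finset.mul_sum]
  rw [integral_finsetSum _ fun i hi => integrable_expo_mul k (hf i hi), Finset.mul_sum]

theorem conj_fc (f : ℝ → ℂ) (k : ℤ) :
    (starRingEnd ℂ) (fc T f t k) = fc T (fun τ => (starRingEnd ℂ) (f τ)) t (-k) := by
  simp only [fc, map_mul, Complex.conj_ofReal, intervalIntegral, map_sub, ← integral_conj,
    conj_expo]

theorem fc_expo_mul (f : ℝ → ℂ) (k l : ℤ) :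
    fc T (fun τ => expo T l τ * f τ) t k = fc T f t (k + l) := by
  simp only [fc, expo_add, mul_assoc]

theorem fc_periodic (hT : 0 < T) {f : ℝ → ℂ} (hf : Function.Periodic f T) (s : ℝ) (k : ℤ) :
    fc T f t k = fc T f s k := by
  have h : Function.Periodic (fun τ => expo T k τ * f τ) T := fun τ => by
    simp only [expo_periodic hT k τ, hf τ]
  have := h.intervalIntegral_add_eq (t - T) (s - T)
  rw [sub_add_cancel, sub_add_cancel] at this
  rw [fc, fc, this]

/-! #### Transfer to the circle -/

theorem fourier_coe_eq_expo (k : ℤ) (x : ℝ) :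
    fourier (-k) (x : AddCircle T) = expo T k x := by
  rw [fourier_coe_apply, expo]
  congr 1; push_cast; ring

theorem fc_eq_fourierCoeff_of_circle [hT : Fact (0 < T)] (F : AddCircle T → ℂ) (k : ℤ) :
    fc T (fun τ => F τ) t k = fourierCoeff F k := by
  rw [fourierCoeff_eq_intervalIntegral F k (t - T), sub_add_cancel, fc]
  simp only [fourier_coe_eq_expo, smul_eq_mul, Complex.real_smul]

theorem liftIoc_ae [hT : Fact (0 < T)] {E : Type*} (f : ℝ → E) :
    ∀ᵐ τ : ℝ ∂(win T t), AddCircle.liftIoc T (t - T) f (τ : AddCircle T) = f τ :=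
  (ae_restrict_iff' measurableSet_Ioc).2 (Eventually.of_forall fun τ hτ =>
    AddCircle.liftIoc_coe_apply (by rwa [sub_add_cancel]))

theorem fc_eq_fourierCoeff [hT : Fact (0 < T)] (f : ℝ → ℂ) (k : ℤ) :
    fc T f t k = fourierCoeff (AddCircle.liftIoc T (t - T) f) k := by
  rw [← fc_eq_fourierCoeff_of_circle (t := t)]
  exact fc_congr hT.out ((liftIoc_ae f).mono fun τ h => h.symm) k

/-- **Parseval's identity**, polarized. -/
theorem hasSum_conj_fc_mul_fc (hT : 0 < T) {f g : ℝ → ℂ} (hf : MemLp f 2 (win T t))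
    (hg : MemLp g 2 (win T t)) :
    HasSum (fun l => (starRingEnd ℂ) (fc T f t l) * fc T g t l)
      (((1 / T : ℝ) : ℂ) * ∫ τ in (t - T)..t, (starRingEnd ℂ) (f τ) * g τ) := by
  have : Fact (0 < T) := ⟨hT⟩
  have lift : ∀ {f : ℝ → ℂ}, MemLp f 2 (win T t) →
      MemLp (AddCircle.liftIoc T (t - T) f) 2 (AddCircle.haarAddCircle (T := T)) := by
    intro f hf
    refine memLp_haarAddCircle_iff.2 (MemLp.memLp_liftIoc ?_)
    rwa [sub_add_cancel]
  have hF := lift hf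
  have hG := lift hg
  have key := (fourierBasis (T := T)).hasSum_inner_mul_inner hF.toLp hG.toLp
  have e1 : ∀ l, inner ℂ (hF.toLp) (fourierBasis (T := T) l) * inner ℂ (fourierBasis (T := T) l)
      (hG.toLp) = (starRingEnd ℂ) (fc T f t l) * fc T g t l := by
    intro l
    rw [← inner_conj_symm, ← HilbertBasis.repr_apply_apply, ← HilbertBasis.repr_apply_apply,
      fourierBasis_repr, fourierBasis_repr, fourierCoeff_congr_ae hF.coeFn_toLp,
      fourierCoeff_congr_ae hG.coeFn_toLp, fc_eq_fourierCoeff f, fc_eq_fourierCoeff g]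
  simp only [e1] at key
  rw [L2.inner_def] at key
  have e2 : ∫ a, inner ℂ ((hF.toLp _ : AddCircle T → ℂ) a) ((hG.toLp _ : AddCircle T → ℂ) a)
      ∂(AddCircle.haarAddCircle (T := T)) =
      ∫ a, AddCircle.liftIoc T (t - T) (fun τ => (starRingEnd ℂ) (f τ) * g τ) a
        ∂(AddCircle.haarAddCircle (T := T)) := by
    refine integral_congr_ae ?_
    filter_upwards [hF.coeFn_toLp, hG.coeFn_toLp] with x h1 h2
    rw [h1, h2, RCLike.inner_apply']
    rfl
  rw [e2, AddCircle.integral_haarAddCircle, AddCircle.integral_liftIoc_eq_intervalIntegral,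
    sub_add_cancel, Complex.real_smul, ← one_div] at key
  exact key

/-- Fourier coefficients of a product of square integrable signals. -/
theorem hasSum_fc_mul (hT : 0 < T) {f g : ℝ → ℂ} (hf : MemLp f 2 (win T t))
    (hg : MemLp g 2 (win T t)) (k : ℤ) :
    HasSum (fun l => fc T f t (k - l) * fc T g t l) (fc T (fun τ => f τ * g τ) t k) := by
  -- Parseval applied to the conjugate of `expo T k * f` and to `g`: undoing the conjugation turns
  -- the l-th coefficient of the first factor into the coefficient of `f` at k - l, so the pairing
  -- becomes a convolution.
  have hf' : MemLp (fun τ => (starRingEnd ℂ) (expo T k τ * f τ)) 2 (win T t) :=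
    (memLp_expo_mul k hf).star
  convert hasSum_conj_fc_mul_fc hT hf' hg using 1
  · ext l
    rw [conj_fc]
    simp only [Complex.conj_conj]
    rw [fc_expo_mul, neg_add_eq_sub]
  · simp only [Complex.conj_conj, fc, mul_assoc]

theorem hasSum_norm_sq_fc (hT : 0 < T) {f : ℝ → ℂ} (hf : MemLp f 2 (win T t)) :
    HasSum (fun l => ‖fc T f t l‖ ^ 2) (1 / T * ∫ τ in (t - T)..t, ‖f τ‖ ^ 2) := by
  have h := hasSum_conj_fc_mul_fc hT hf hf
  have e : ∀ z : ℂ, (starRingEnd ℂ) z * z = ((‖z‖ ^ 2 : ℝ) : ℂ) := fun z => by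
    rw [Complex.conj_mul']; push_cast; rfl
  simp only [e] at h
  rw [intervalIntegral.integral_ofReal, ← Complex.ofReal_mul] at h
  exact_mod_cast h

theorem integrable_of_memLp_win {E : Type*} [NormedAddCommGroup E] {f : ℝ → E}
    (hf : MemLp f 2 (win T t)) : Integrable f (win T t) :=
  hf.integrable (by norm_num)

theorem integrable_norm_sq {E : Type*} [NormedAddCommGroup E] {f : ℝ → E} {μ : Measure ℝ}
    (hf : MemLp f 2 μ) : Integrable (fun τ => ‖f τ‖ ^ 2) μ := hf.integrable_norm_pow (by norm_num)

/-- Parseval for f - g: all its coefficients vanish, hence so does its L² norm on the window. -/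
theorem ae_eq_of_fc_eq (hT : 0 < T) {f g : ℝ → ℂ} (hf : MemLp f 2 (win T t))
    (hg : MemLp g 2 (win T t)) (h : ∀ k, fc T f t k = fc T g t k) : f =ᵐ[win T t] g := by
  have hfg : MemLp (fun τ => f τ - g τ) 2 (win T t) := hf.sub hg
  have hz := hasSum_norm_sq_fc hT hfg
  simp only [fc_sub hT (integrable_of_memLp_win hf) (integrable_of_memLp_win hg), h, sub_self,
    norm_zero, ne_eq, OfNat.ofNat_ne_zero, not_false_eq_true, zero_pow] at hz
  have hz' := hz.unique hasSum_zero
  have h0 : ∫ τ, ‖f τ - g τ‖ ^ 2 ∂(win T t) = 0 := by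
    rw [← integral_win hT]
    exact (mul_eq_zero.1 hz').resolve_left (one_div_ne_zero hT.ne')
  rw [integral_eq_zero_iff_of_nonneg (fun τ => by positivity) (integrable_norm_sq hfg)] at h0
  filter_upwards [h0] with τ hτ
  have : ‖f τ - g τ‖ = 0 := by simpa using hτ
  exact sub_eq_zero.1 (norm_eq_zero.1 this)

/-- **Riesz-Fischer**: square summable sequences are the Fourier coefficients of periodic square
integrable functions. -/
theorem exists_periodic_of_memℓp (hT : 0 < T) {X : ℤ → ℂ} (hX : Memℓp X 2) :
    ∃ f : ℝ → ℂ, Function.Periodic f T ∧ (∀ t, MemLp f 2 (win T t)) ∧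
      ∀ t k, fc T f t k = X k := by
  have : Fact (0 < T) := ⟨hT⟩
  set F := (fourierBasis (T := T)).repr.symm ⟨X, hX⟩ with hF
  refine ⟨fun τ => F (τ : AddCircle T), fun τ => ?_, fun t => ?_, fun t k => ?_⟩
  · simp only [AddCircle.coe_add_period]
  · have h1 : MemLp F 2 (volume : Measure (AddCircle T)) :=
      memLp_haarAddCircle_iff.1 (Lp.memLp F)
    have := h1.comp_measurePreserving (AddCircle.measurePreserving_mk T (t - T))
    rwa [sub_add_cancel] at this
  · rw [fc_eq_fourierCoeff_of_circle, ← fourierBasis_repr, hF, LinearIsometryEquiv.apply_symm_apply]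

/-! #### Primitives -/

/-- Integration by parts over a window. -/
theorem fc_of_eq_primitive (hT : 0 < T) {f h : ℝ → ℂ} (hh : Integrable h (win T t))
    (hf : ∀ τ ∈ Icc (t - T) t, f τ = f (t - T) + ∫ s in (t - T)..τ, h s) (k : ℤ) :
    fc T h t k = Complex.I * ((2 * Real.pi / T * (k : ℝ) : ℝ) : ℂ) * fc T f t k +
      expo T k t * (((1 / T : ℝ) : ℂ) * (f t - f (t - T))) := by
  have hle : t - T ≤ t := by linarith
  have hh' : IntervalIntegrable h volume (t - T) t := (intervalIntegrable_win hT).2 hh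
  have hac := absCont_of_eq_primitive hle hh' hf
  have hexp : AbsolutelyContinuousOnInterval (expo T k) (t - T) t :=
    (contDiff_expo T k).contDiffOn.absolutelyContinuousOnInterval
  have hprod := hexp.smul hac
  have hd := integrable_deriv_of_absCont hle hprod
    (f' := fun τ => expo T k τ * h τ +
      -(Complex.I * ((2 * Real.pi / T * (k : ℝ) : ℝ) : ℂ)) * (expo T k τ * f τ)) (by
      filter_upwards [ae_hasDerivAt_of_eq_primitive hle hh' hf] with τ hτ hm
      have := (hasDerivAt_expo T k τ).smul (hτ hm)
      refine this.congr_deriv ?_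
      simp only [smul_eq_mul]
      ring)
  have hcont : ContinuousOn f (uIcc (t - T) t) := hac.continuousOn
  have i1 : IntervalIntegrable (fun τ => expo T k τ * h τ) volume (t - T) t :=
    (intervalIntegrable_win hT).2 (integrable_expo_mul k hh)
  have i2 : IntervalIntegrable (fun τ => expo T k τ * f τ) volume (t - T) t :=
    ((continuous_expo T k).continuousOn.mul hcont).intervalIntegrable
  have h2 := hd.2
  rw [intervalIntegral.integral_add i1 (i2.const_mul _), intervalIntegral.integral_const_mul] at h2
  have hper : expo T k (t - T) = expo T k t := by
    have := expo_periodic hT k (t - T); rwa [sub_add_cancel, eq_comm] at this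
  simp only [Pi.smul_apply', smul_eq_mul, hper] at h2
  simp only [fc]
  linear_combination ((1 / T : ℝ) : ℂ) * h2

theorem fc_const (hT : 0 < T) (c : ℂ) (k : ℤ) :
    fc T (fun _ => c) t k = if k = 0 then c else 0 := by
  have hT' : (T : ℂ) ≠ 0 := by exact_mod_cast hT.ne'
  split_ifs with hk
  · subst hk
    simp only [fc, expo_zero, one_mul, intervalIntegral.integral_const, sub_sub_cancel,
      Complex.real_smul]
    push_cast; field_simp
  -- A constant is a primitive of 0 without jump, so jωk times its coefficient is 0.
  · have h := fc_of_eq_primitive (t := t) (f := fun _ => c) (h := fun _ => 0) hT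
      (integrable_zero _ _ _) (fun τ _ => by simp) k
    have h0 : fc T (fun _ => (0 : ℂ)) t k = 0 := by simp [fc]
    rw [h0, sub_self, mul_zero, mul_zero, add_zero, eq_comm, mul_eq_zero] at h
    refine h.resolve_left ?_
    simp [Real.pi_ne_zero, hT.ne', hk]

/-- A signal whose Fourier coefficients over a window are those of a primitive of `h`, up to a jump
at the end of the window, is a primitive of `h`. -/
theorem ae_eq_primitive_of_fc (hT : 0 < T) {f h : ℝ → ℂ} (hf : MemLp f 2 (win T t))
    (hh : Integrable h (win T t)) (c : ℂ)
    (hk : ∀ k : ℤ, Complex.I * ((2 * Real.pi / T * (k : ℝ) : ℝ) : ℂ) * fc T f t k +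
      expo T k t * c = fc T h t k) :
    ∃ v, f =ᵐ[win T t] fun τ => v + ∫ s in (t - T)..τ, h s := by
  have hle : t - T ≤ t := by linarith
  have hh' : IntervalIntegrable h volume (t - T) t := (intervalIntegrable_win hT).2 hh
  obtain ⟨H, hH⟩ : ∃ H : ℝ → ℂ, H = fun τ => ∫ s in (t - T)..τ, h s := ⟨_, rfl⟩
  have hibp := fc_of_eq_primitive (f := H) hT hh (fun τ _ => by simp [hH])
  have hHc : ContinuousOn H (Icc (t - T) t) := by
    rw [← uIcc_of_le hle, hH]; exact (absCont_primitive hh').continuousOn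
  have hHm : MemLp H 2 (win T t) := by
    obtain ⟨C, hC⟩ := isCompact_Icc.exists_bound_of_continuousOn hHc
    refine MemLp.of_bound ((hHc.mono Ioc_subset_Icc_self).aestronglyMeasurable measurableSet_Ioc) C
      ((ae_restrict_iff' measurableSet_Ioc).2 (Eventually.of_forall fun τ hτ =>
        hC τ (Ioc_subset_Icc_self hτ)))
  -- The equation for k = 0 forces `c` to be the jump of `H` divided by T. The jump terms then
  -- cancel for every k, and dividing by jωk leaves only the mean of f undetermined; the free
  -- constant v accounts for it.
  have hne : ∀ k : ℤ, k ≠ 0 → fc T f t k = fc T H t k := by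
    intro k hk0
    have h0 := hk 0
    have h1 := hk k
    rw [hibp] at h0 h1
    simp only [Int.cast_zero, mul_zero, Complex.ofReal_zero, zero_mul, expo_zero, one_mul,
      zero_add] at h0
    rw [h0] at h1
    have h2 := add_right_cancel h1
    refine mul_left_cancel₀ ?_ h2
    simp [Real.pi_ne_zero, hT.ne', hk0]
  suffices h : f =ᵐ[win T t] fun τ => (fc T f t 0 - fc T H t 0) + H τ by
    rw [hH] at h; exact ⟨_, h⟩
  refine ae_eq_of_fc_eq hT hf (MemLp.add (memLp_const _) hHm) fun k => ?_
  rw [fc_add hT (integrable_const _) (integrable_of_memLp_win hHm), fc_const hT]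
  split_ifs with hk0
  · subst hk0; ring
  · rw [hne k hk0, zero_add]

/-- Uniqueness of Fourier coefficients in L¹, needed because products of two L² signals are only
integrable. It is deduced from the L² case: the zero signal has the coefficients of a jump-free
primitive of h, so v plus a primitive of h vanishes identically, and differentiating gives h = 0. -/
theorem ae_eq_zero_of_fc_eq_zero (hT : 0 < T) {h : ℝ → ℂ} (hh : Integrable h (win T t))
    (hk : ∀ k, fc T h t k = 0) : h =ᵐ[win T t] 0 := by
  have hle : t - T ≤ t := by linarith
  have hh' : IntervalIntegrable h volume (t - T) t := (intervalIntegrable_win hT).2 hh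
  obtain ⟨v, hv⟩ := ae_eq_primitive_of_fc hT (f := fun _ => 0) (memLp_const 0) hh 0
    (fun k => by rw [hk, fc_const hT]; simp)
  have hHc : ContinuousOn (fun τ => v + ∫ s in (t - T)..τ, h s) (Icc (t - T) t) := by
    rw [← uIcc_of_le hle]; exact continuousOn_const.add (absCont_primitive hh').continuousOn
  have hv' : EqOn (fun _ => (0 : ℂ)) (fun τ => v + ∫ s in (t - T)..τ, h s) (Ioo (t - T) t) := by
    refine Measure.eqOn_open_of_ae_eq (μ := volume) ?_ isOpen_Ioo continuousOn_const
      (hHc.mono Ioo_subset_Icc_self)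
    exact ae_restrict_of_ae_restrict_of_subset Ioo_subset_Ioc_self hv
  have hd := ae_hasDerivAt_of_eq_primitive (f := fun τ => v + ∫ s in (t - T)..τ, h s) hle hh'
    (fun τ _ => by simp)
  rw [win, ← restrict_Ioo_eq_restrict_Ioc]
  refine (ae_restrict_iff' measurableSet_Ioo).2 ?_
  filter_upwards [hd] with τ hτ hm
  have h1 := (hτ hm).congr_of_eventuallyEq (f₁ := fun _ => (0 : ℂ)) (by
    filter_upwards [isOpen_Ioo.mem_nhds hm] with s hs using hv' hs)
  exact h1.unique (hasDerivAt_const τ 0)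

theorem ae_eq_of_integrable_of_fc_eq (hT : 0 < T) {f g : ℝ → ℂ} (hf : Integrable f (win T t))
    (hg : Integrable g (win T t)) (h : ∀ k, fc T f t k = fc T g t k) : f =ᵐ[win T t] g := by
  have := ae_eq_zero_of_fc_eq_zero hT (hf.sub hg) (fun k => by
    have := fc_sub hT hf hg k
    rw [h k, sub_self] at this
    exact this)
  filter_upwards [this] with τ hτ
  exact sub_eq_zero.1 hτ

end ScalarFourier

/-! ### Carathéodory differential equations -/

section Caratheodory

variable {ℓ : ℝ → ℝ} {t₀ : ℝ}

theorem continuous_primitive_of_intervalIntegrable {E : Type*} [NormedAddCommGroup E]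
    [NormedSpace ℝ E] {h : ℝ → E} (hh : ∀ a b, IntervalIntegrable h volume a b) (a : ℝ) :
    Continuous fun t => ∫ s in a..t, h s :=
  intervalIntegral.continuous_primitive hh a

/-- The integrand is half the derivative of exp(2Λ), with Λ the primitive of ℓ; the term -1/2 coming
from t₀ is dropped. The factor 2 in the exponent is what produces the contraction constant 1/2
below. -/
theorem integral_mul_exp_primitive_le (hℓ : ∀ a b, IntervalIntegrable ℓ volume a b) {t : ℝ}
    (ht : t₀ ≤ t) :
    ∫ s in t₀..t, ℓ s * Real.exp (2 * ∫ r in t₀..s, ℓ r) ≤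
      Real.exp (2 * ∫ r in t₀..t, ℓ r) / 2 := by
  have hac := absCont_primitive (hℓ t₀ t)
  obtain ⟨C, hC⟩ := hac.exists_bound
  -- The exponential is only locally Lipschitz, so absolute continuity of the composition uses a
  -- bound on the primitive over [t₀, t].
  have hlip : ∃ K, LipschitzOnWith K (fun x : ℝ => Real.exp (2 * x)) (Icc (-C) C) := by
    refine ContDiffOn.exists_lipschitzOnWith (n := 1) (ContDiff.contDiffOn (by fun_prop)) (by simp)
      (convex_Icc _ _) isCompact_Icc
  obtain ⟨K, hK⟩ := hlip
  have hexp : AbsolutelyContinuousOnInterval (fun s => Real.exp (2 * ∫ r in t₀..s, ℓ r)) t₀ t := by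
    refine absCont_of_dist_le hac hac K 0 fun x hx y hy => ?_
    rw [zero_mul, add_zero]
    exact hK.dist_le_mul _ (abs_le.1 (hC x hx)) _ (abs_le.1 (hC y hy))
  have hd := integrable_deriv_of_absCont_real ht hexp
    (f' := fun s => Real.exp (2 * ∫ r in t₀..s, ℓ r) * (2 * ℓ s)) (by
      filter_upwards [ae_hasDerivAt_of_eq_primitive (f := fun s => ∫ r in t₀..s, ℓ r) ht (hℓ t₀ t)
        (fun s _ => by simp)] with s hs hm
      exact ((hs hm).const_mul 2).exp)
  have h2 : ∫ s in t₀..t, Real.exp (2 * ∫ r in t₀..s, ℓ r) * (2 * ℓ s) =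
      2 * ∫ s in t₀..t, ℓ s * Real.exp (2 * ∫ r in t₀..s, ℓ r) := by
    rw [← intervalIntegral.integral_const_mul]
    congr 1; ext s; ring
  have h3 := hd.2
  rw [h2, intervalIntegral.integral_same, mul_zero, Real.exp_zero] at h3
  linarith

/-- **Grönwall's inequality** with an integrable kernel and zero initial value. -/
theorem eqOn_zero_of_le_integral (hℓ : ∀ a b, IntervalIntegrable ℓ volume a b) (hℓ0 : ∀ s, 0 ≤ ℓ s)
    {t₁ : ℝ} {φ : ℝ → ℝ} (hφ : ContinuousOn φ (Icc t₀ t₁)) (hφ0 : ∀ t ∈ Icc t₀ t₁, 0 ≤ φ t)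
    (hle : ∀ t ∈ Icc t₀ t₁, φ t ≤ ∫ s in t₀..t, ℓ s * φ s) :
    ∀ t ∈ Icc t₀ t₁, φ t = 0 := by
  intro t ht
  have h01 : t₀ ≤ t₁ := ht.1.trans ht.2
  set Λ : ℝ → ℝ := fun t => ∫ s in t₀..t, ℓ s with hΛ
  have hΛc : Continuous Λ := continuous_primitive_of_intervalIntegrable hℓ t₀
  have hψ : ContinuousOn (fun t => φ t * Real.exp (-(2 * Λ t))) (Icc t₀ t₁) :=
    hφ.mul (by fun_prop)
  -- At a maximum m of φ exp(-2Λ), the integral inequality gives m ≤ m / 2, hence m = 0.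
  obtain ⟨s, hs, hmax⟩ := isCompact_Icc.exists_isMaxOn ⟨t₀, left_mem_Icc.2 h01⟩ hψ
  set m := φ s * Real.exp (-(2 * Λ s)) with hm
  have hbound : ∀ r ∈ Icc t₀ t₁, φ r ≤ m * Real.exp (2 * Λ r) := by
    intro r hr
    have h1 : φ r * Real.exp (-(2 * Λ r)) ≤ m := hmax hr
    calc φ r = φ r * Real.exp (-(2 * Λ r)) * Real.exp (2 * Λ r) := by
          rw [mul_assoc, ← Real.exp_add]; simp
      _ ≤ _ := by gcongr
  have hm0 : 0 ≤ m := mul_nonneg (hφ0 s hs) (Real.exp_pos _).le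
  have hsub : uIcc t₀ s ⊆ Icc t₀ t₁ := by
    rw [uIcc_of_le hs.1]; exact Icc_subset_Icc_right hs.2
  have h1 : φ s ≤ m * (Real.exp (2 * Λ s) / 2) := by
    calc φ s ≤ ∫ r in t₀..s, ℓ r * φ r := hle s hs
      _ ≤ ∫ r in t₀..s, m * (ℓ r * Real.exp (2 * Λ r)) := by
          refine intervalIntegral.integral_mono_on hs.1
            ((hℓ t₀ s).mul_continuousOn (hφ.mono hsub))
            (((hℓ t₀ s).mul_continuousOn (by fun_prop)).const_mul m) fun r hr => ?_
          have := hbound r ⟨hr.1, hr.2.trans hs.2⟩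
          calc ℓ r * φ r ≤ ℓ r * (m * Real.exp (2 * Λ r)) :=
                mul_le_mul_of_nonneg_left this (hℓ0 r)
            _ = _ := by ring
      _ = m * ∫ r in t₀..s, ℓ r * Real.exp (2 * Λ r) :=
          intervalIntegral.integral_const_mul _ _
      _ ≤ _ := mul_le_mul_of_nonneg_left (integral_mul_exp_primitive_le hℓ hs.1) hm0
  have h2 : m ≤ m / 2 := by
    calc m = φ s * Real.exp (-(2 * Λ s)) := hm
      _ ≤ m * (Real.exp (2 * Λ s) / 2) * Real.exp (-(2 * Λ s)) := by gcongr
      _ = m / 2 * (Real.exp (2 * Λ s) * Real.exp (-(2 * Λ s))) := by ring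
      _ = m / 2 := by rw [← Real.exp_add]; simp
  have hmz : m = 0 := by linarith
  have := hbound t ht
  rw [hmz, zero_mul] at this
  exact le_antisymm this (hφ0 t ht)

variable {Y : Type*} [NormedAddCommGroup Y] [NormedSpace ℝ Y]

/-- Uniqueness for Carathéodory equations. -/
theorem caratheodory_unique (hℓ : ∀ a b, IntervalIntegrable ℓ volume a b) (hℓ0 : ∀ s, 0 ≤ ℓ s)
    {f : ℝ → Y → Y} {t₁ : ℝ} {y y' : ℝ → Y} (hy : ContinuousOn y (Icc t₀ t₁))
    (hy' : ContinuousOn y' (Icc t₀ t₁))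
    (hi : IntervalIntegrable (fun s => f s (y s)) volume t₀ t₁)
    (hi' : IntervalIntegrable (fun s => f s (y' s)) volume t₀ t₁)
    (heq : ∀ t ∈ Icc t₀ t₁, y t = y t₀ + ∫ s in t₀..t, f s (y s))
    (heq' : ∀ t ∈ Icc t₀ t₁, y' t = y' t₀ + ∫ s in t₀..t, f s (y' s))
    (hlip : ∀ s ∈ Icc t₀ t₁, ‖f s (y s) - f s (y' s)‖ ≤ ℓ s * ‖y s - y' s‖)
    (h0 : y t₀ = y' t₀) : ∀ t ∈ Icc t₀ t₁, y t = y' t := by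
  have hc : ContinuousOn (fun t => ‖y t - y' t‖) (Icc t₀ t₁) := (hy.sub hy').norm
  have key := eqOn_zero_of_le_integral hℓ hℓ0 (φ := fun t => ‖y t - y' t‖) hc
    (fun t _ => norm_nonneg _) (fun t ht => ?_)
  · intro t ht
    exact sub_eq_zero.1 (norm_eq_zero.1 (key t ht))
  · have hsub : uIcc t₀ t ⊆ uIcc t₀ t₁ := by
      rw [uIcc_of_le ht.1, uIcc_of_le (ht.1.trans ht.2)]; exact Icc_subset_Icc_right ht.2
    have i1 := hi.mono_set hsub
    have i2 := hi'.mono_set hsub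
    have e : y t - y' t = ∫ s in t₀..t, (f s (y s) - f s (y' s)) := by
      rw [intervalIntegral.integral_sub i1 i2, heq t ht, heq' t ht, h0]; abel
    simp only [e]
    refine intervalIntegral.norm_integral_le_of_norm_le ht.1 ?_ ?_
    · refine Eventually.of_forall fun s hs => ?_
      exact hlip s ⟨hs.1.le, hs.2.trans ht.2⟩
    · refine (hℓ t₀ t).mul_continuousOn (hc.mono ?_)
      rw [uIcc_of_le ht.1]; exact Icc_subset_Icc_right ht.2

/-- Global existence for Carathéodory equations with a globally Lipschitz right-hand side. -/
theorem caratheodory_exists [CompleteSpace Y] (hℓ : ∀ a b, IntervalIntegrable ℓ volume a b)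
    {f : ℝ → Y → Y} (hlip : ∀ s y y', ‖f s y - f s y'‖ ≤ ℓ s * ‖y - y'‖)
    (hf0 : ∀ s, ‖f s 0‖ ≤ ℓ s)
    (hmeas : ∀ y : ℝ → Y, Continuous y → AEStronglyMeasurable (fun s => f s (y s)) volume)
    (t₀ : ℝ) (y₀ : Y) :
    ∃ y : ℝ → Y, Continuous y ∧ ∀ t, t₀ ≤ t → y t = y₀ + ∫ s in t₀..t, f s (y s) := by
  -- Weighted sup norm: the primitive of ℓ W is at most W / 2, so in the unknown u = y / W, a
  -- bounded continuous function, the Picard operator is a contraction of ratio 1/2 on the whole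
  -- half-line at once.
  set W : ℝ → ℝ := fun t => Real.exp (2 * ∫ s in t₀..t, ℓ s) with hW
  have hℓ0 : ∀ s, 0 ≤ ℓ s := fun s => (norm_nonneg _).trans (hf0 s)
  have hWc : Continuous W := by
    have := continuous_primitive_of_intervalIntegrable hℓ t₀
    fun_prop
  have hWpos : ∀ t, 0 < W t := fun t => Real.exp_pos _
  have hW1 : ∀ t, t₀ ≤ t → 1 ≤ W t := fun t ht => by
    refine Real.one_le_exp (mul_nonneg zero_le_two ?_)
    exact intervalIntegral.integral_nonneg ht fun s _ => hℓ0 s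
  have hWint : ∀ t, t₀ ≤ t → ∫ s in t₀..t, ℓ s * W s ≤ W t / 2 := fun t ht =>
    integral_mul_exp_primitive_le hℓ ht
  have hint : ∀ y : ℝ → Y, Continuous y → ∀ a b,
      IntervalIntegrable (fun s => f s (y s)) volume a b := by
    intro y hy a b
    have : IntervalIntegrable (fun s => ℓ s * (1 + ‖y s‖)) volume a b :=
      (hℓ a b).mul_continuousOn (by fun_prop)
    refine this.mono_fun (hmeas y hy).restrict (Eventually.of_forall fun s => ?_)
    have h1 := hlip s (y s) 0
    rw [sub_zero] at h1
    calc ‖f s (y s)‖ ≤ ‖f s (y s) - f s 0‖ + ‖f s 0‖ := by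
          simpa using norm_add_le (f s (y s) - f s 0) (f s 0)
      _ ≤ ℓ s * ‖y s‖ + ℓ s := add_le_add h1 (hf0 s)
      _ = ℓ s * (1 + ‖y s‖) := by ring
      _ ≤ _ := le_abs_self _
  have hWy : ∀ u : BoundedContinuousFunction ℝ Y, Continuous fun s => W s • u s := fun u =>
    hWc.smul u.continuous
  set J : BoundedContinuousFunction ℝ Y → ℝ → Y :=
    fun u t => ∫ s in t₀..t, f s (W s • u s) with hJ
  have hJc : ∀ u, Continuous (J u) := fun u =>
    continuous_primitive_of_intervalIntegrable (hint _ (hWy u)) t₀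
  have hWi : ∀ a b, IntervalIntegrable (fun s => ℓ s * W s) volume a b := fun a b =>
    (hℓ a b).mul_continuousOn hWc.continuousOn
  have hJb : ∀ u t, t₀ ≤ t → ‖J u t‖ ≤ (1 + ‖u‖) * (W t / 2) := by
    intro u t ht
    refine (intervalIntegral.norm_integral_le_of_norm_le (g := fun s => (1 + ‖u‖) * (ℓ s * W s))
      ht (Eventually.of_forall fun s hs => ?_) ((hWi _ _).const_mul _)).trans ?_
    · have h1 := hlip s (W s • u s) 0
      rw [sub_zero, norm_smul, Real.norm_of_nonneg (hWpos s).le] at h1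
      calc ‖f s (W s • u s)‖ ≤ ‖f s (W s • u s) - f s 0‖ + ‖f s 0‖ := by
            simpa using norm_add_le (f s (W s • u s) - f s 0) (f s 0)
        _ ≤ ℓ s * (W s * ‖u s‖) + ℓ s * 1 := by
            rw [mul_one]; exact add_le_add h1 (hf0 s)
        _ ≤ ℓ s * (W s * ‖u‖) + ℓ s * W s := by
            have := hℓ0 s
            have := (hWpos s).le
            have := hW1 s hs.1.le
            gcongr
            exact u.norm_coe_le_norm s
        _ = _ := by ring
    · rw [intervalIntegral.integral_const_mul]
      exact mul_le_mul_of_nonneg_left (hWint t ht) (by positivity)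
  have hJd : ∀ u v t, t₀ ≤ t → ‖J u t - J v t‖ ≤ ‖u - v‖ * (W t / 2) := by
    intro u v t ht
    rw [hJ]
    simp only
    rw [← intervalIntegral.integral_sub (hint _ (hWy u) _ _) (hint _ (hWy v) _ _)]
    refine (intervalIntegral.norm_integral_le_of_norm_le (g := fun s => ‖u - v‖ * (ℓ s * W s))
      ht (Eventually.of_forall fun s hs => ?_) ((hWi _ _).const_mul _)).trans ?_
    · refine (hlip _ _ _).trans ?_
      rw [← smul_sub, norm_smul, Real.norm_of_nonneg (hWpos s).le]
      have h1 : ‖u s - v s‖ ≤ ‖u - v‖ := (u - v).norm_coe_le_norm s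
      have := hℓ0 s
      have := (hWpos s).le
      calc ℓ s * (W s * ‖u s - v s‖) ≤ ℓ s * (W s * ‖u - v‖) := by gcongr
        _ = _ := by ring
    · rw [intervalIntegral.integral_const_mul]
      exact mul_le_mul_of_nonneg_left (hWint t ht) (by positivity)
  -- The estimates hold only for t ≥ t₀; replacing t by max t t₀ lets the operator act on bounded
  -- functions on all of ℝ.
  have hmax : ∀ t, t₀ ≤ max t t₀ := fun t => le_max_right _ _
  have hmc : Continuous fun t : ℝ => max t t₀ := by fun_prop
  set Φ : BoundedContinuousFunction ℝ Y → BoundedContinuousFunction ℝ Y := fun u =>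
    BoundedContinuousFunction.ofNormedAddCommGroup
      (fun t => (W (max t t₀))⁻¹ • (y₀ + J u (max t t₀)))
      (((hWc.comp hmc).inv₀ fun t => (hWpos _).ne').smul
        (continuous_const.add ((hJc u).comp hmc)))
      (‖y₀‖ + (1 + ‖u‖) / 2) (fun t => by
        have h1 := hW1 _ (hmax t)
        have h0 := hWpos (max t t₀)
        rw [norm_smul, norm_inv, Real.norm_of_nonneg h0.le, inv_mul_le_iff₀ h0]
        calc ‖y₀ + J u (max t t₀)‖ ≤ ‖y₀‖ + (1 + ‖u‖) * (W (max t t₀) / 2) :=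
              (norm_add_le _ _).trans (add_le_add le_rfl (hJb u _ (hmax t)))
          _ ≤ W (max t t₀) * ‖y₀‖ + (1 + ‖u‖) * (W (max t t₀) / 2) := by
              gcongr
              exact le_mul_of_one_le_left (norm_nonneg _) h1
          _ = _ := by ring) with hΦ
  have hcontr : ContractingWith (1 / 2) Φ := by
    refine ⟨by rw [← NNReal.coe_lt_coe]; norm_num, LipschitzWith.of_dist_le_mul fun u v => ?_⟩
    rw [BoundedContinuousFunction.dist_le (by positivity)]
    intro t
    have h0 := hWpos (max t t₀)
    change dist ((W (max t t₀))⁻¹ • (y₀ + J u (max t t₀)))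
      ((W (max t t₀))⁻¹ • (y₀ + J v (max t t₀))) ≤ _
    rw [dist_eq_norm, ← smul_sub, add_sub_add_left_eq_sub, norm_smul, norm_inv,
      Real.norm_of_nonneg h0.le, inv_mul_le_iff₀ h0]
    refine (hJd u v _ (hmax t)).trans (le_of_eq ?_)
    rw [dist_eq_norm]
    push_cast
    ring
  obtain ⟨u, hu, -⟩ := hcontr.exists_fixedPoint 0 (edist_ne_top _ _)
  refine ⟨fun s => W s • u s, hWy u, fun t ht => ?_⟩
  have h1 : u t = (W (max t t₀))⁻¹ • (y₀ + J u (max t t₀)) := by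
    conv_lhs => rw [← hu.eq]
    rfl
  rw [max_eq_left ht] at h1
  simp only [h1]
  rw [smul_inv_smul₀ (hWpos t).ne']

end Caratheodory

/-! ### The closed loop in the time domain -/

section Evaluation

variable {E F : Type*} [NormedAddCommGroup E] [InnerProductSpace ℂ E]
  [NormedAddCommGroup F] [InnerProductSpace ℂ F]

theorem intervalIntegrable_of_locallyIntegrable {G : Type*} [NormedAddCommGroup G] {f : ℝ → G}
    (hf : LocallyIntegrable f volume) (s t : ℝ) : IntervalIntegrable f volume s t :=
  intervalIntegrable_iff.2 ((hf.integrableOn_isCompact isCompact_uIcc).mono_set uIoc_subset_uIcc)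

/-- Evaluation of operator valued functions, as a real bilinear map. -/
noncomputable abbrev evalL (E F : Type*) [NormedAddCommGroup E] [InnerProductSpace ℂ E]
    [NormedAddCommGroup F] [InnerProductSpace ℂ F] :
    (E →L[ℂ] F) →L[ℝ] E →L[ℝ] F :=
  ContinuousLinearMap.restrictScalarsL ℂ E F ℝ ℝ

theorem aestronglyMeasurable_eval {A : ℝ → E →L[ℂ] F} {v : ℝ → E} {μ : Measure ℝ}
    (hA : AEStronglyMeasurable A μ) (hv : AEStronglyMeasurable v μ) :
    AEStronglyMeasurable (fun τ => A τ (v τ)) μ :=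
  (evalL E F).aestronglyMeasurable_comp₂ hA hv

theorem hasDerivAt_eval {A : ℝ → E →L[ℂ] F} {A' : E →L[ℂ] F} {v : ℝ → E} {v' : E} {t : ℝ}
    (hA : HasDerivAt A A' t) (hv : HasDerivAt v v' t) :
    HasDerivAt (fun τ => A τ (v τ)) (A' (v t) + A t v') t :=
  ((evalL E F).hasFDerivAt.comp_hasDerivAt t hA).clm_apply hv

theorem intervalIntegrable_eval {A : ℝ → E →L[ℂ] F} {v : ℝ → E} {s t : ℝ}
    (hA : IntervalIntegrable A volume s t) (hv : ContinuousOn v (uIcc s t)) :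
    IntervalIntegrable (fun τ => A τ (v τ)) volume s t := by
  refine (hA.norm.mul_continuousOn hv.norm).mono_fun ?_ (Eventually.of_forall fun τ => ?_)
  · exact aestronglyMeasurable_eval hA.def'.1
      ((hv.mono uIoc_subset_uIcc).aestronglyMeasurable measurableSet_uIoc)
  · simp only [norm_mul, norm_norm]
    exact (A τ).le_opNorm _

theorem absCont_re_inner {v w : ℝ → E} {s t : ℝ} (hv : AbsolutelyContinuousOnInterval v s t)
    (hw : AbsolutelyContinuousOnInterval w s t) :
    AbsolutelyContinuousOnInterval (fun τ => (inner ℂ (v τ) (w τ)).re) s t :=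
  absCont_comp_clm Complex.reCLM
    (absCont_bilin (isBoundedBilinearMap_inner (𝕜 := ℂ) (E := E)).toContinuousLinearMap hv hw)

end Evaluation

/-! ### The error system and its Lyapunov function -/

section TimeDomain

variable {E F : Type*} [NormedAddCommGroup E] [InnerProductSpace ℂ E] [CompleteSpace E]
  [NormedAddCommGroup F] [InnerProductSpace ℂ F] [CompleteSpace F]

/-- The coefficients of the closed loop in the time domain, around the equilibrium. -/
structure Loop (E F : Type*) [NormedAddCommGroup E] [InnerProductSpace ℂ E] [CompleteSpace E]
    [NormedAddCommGroup F] [InnerProductSpace ℂ F] [CompleteSpace F] where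
  T : ℝ
  T_pos : 0 < T
  η : ℝ
  η_pos : 0 < η
  a : ℝ → E →L[ℂ] E
  o : ℝ → F →L[ℂ] F
  c : ℝ → E →L[ℂ] F
  D : E →L[ℂ] E
  g₀ : ℝ → E
  P : ℝ → E →L[ℂ] E
  M : ℝ → E →L[ℂ] F
  Q : ℝ → E →L[ℂ] E
  a_int : LocallyIntegrable a volume
  o_int : LocallyIntegrable o volume
  c_int : LocallyIntegrable c volume
  Q_int : LocallyIntegrable Q volume
  g₀_mem : ∀ s t, MemLp g₀ 2 (volume.restrict (Ioc s t))
  P_per : Function.Periodic P T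
  M_per : Function.Periodic M T
  Q_per : Function.Periodic Q T
  P_cont : Continuous P
  M_cont : Continuous M
  P_eq : ∀ s t, P t = P s + ∫ τ in s..t,
    -(ContinuousLinearMap.adjoint (a τ) ∘L P τ + P τ ∘L a τ + Q τ)
  M_eq : ∀ s t, M t = M s + ∫ τ in s..t, (o τ ∘L M τ - M τ ∘L a τ + c τ)
  P_symm : ∀ t v w, inner ℂ (P t v) w = inner ℂ v (P t w)
  P_nonneg : ∀ t v, 0 ≤ (inner ℂ v (P t v)).re
  o_skew : ∀ᵐ t, ∀ v, (inner ℂ v (o t v)).re = 0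
  Q_pos : ∀ᵐ t, ∀ v, v ≠ 0 → 0 < (inner ℂ v (Q t v)).re

namespace Loop

variable (S : Loop E F)

/-- The input vector field. -/
noncomputable def g (t : ℝ) (e : E) : E := S.D e + S.g₀ t

/-- The covector `P e - M^* (z - M e)`. -/
noncomputable def ρ (t : ℝ) (y : E × F) : E :=
  S.P t y.1 - ContinuousLinearMap.adjoint (S.M t) (y.2 - S.M t y.1)

/-- The feedback. -/
noncomputable def u (t : ℝ) (y : E × F) : ℂ :=
  -((S.η : ℂ) * inner ℂ (S.g t y.1) (S.ρ t y))

/-- The vector field of the loop, with the feedback multiplied by `κ`. -/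
noncomputable def rhs (κ : ℝ) (t : ℝ) (y : E × F) : E × F :=
  (S.a t y.1 + κ • (S.u t y • S.g t y.1), S.o t y.2 + S.c t y.1)

/-- The Lyapunov function. -/
noncomputable def V (t : ℝ) (y : E × F) : ℝ :=
  (inner ℂ y.1 (S.P t y.1)).re + ‖y.2 - S.M t y.1‖ ^ 2

/-- The derivatives of P and M are replaced by the right-hand sides of their equations. The terms in
a cancel against P'. With w = u g, the derivative of ζ = z - M e reduces to o ζ - κ M w, and the
o-part drops out by skewness. What is left besides -⟨e, Q e⟩ is 2κ Re⟨ρ, w⟩, and u was chosen to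
make Re⟨ρ, w⟩ = -η |⟨g, ρ⟩|². -/
theorem deriv_algebra {κ : ℝ} (t : ℝ) (y : E × F) (ho : ∀ v, (inner ℂ v (S.o t v)).re = 0) :
    (inner ℂ (S.rhs κ t y).1 (S.P t y.1)).re +
      (inner ℂ y.1 ((-(ContinuousLinearMap.adjoint (S.a t) ∘L S.P t + S.P t ∘L S.a t + S.Q t)) y.1
        + S.P t (S.rhs κ t y).1)).re +
      2 * (inner ℂ (y.2 - S.M t y.1) ((S.rhs κ t y).2 -
        ((S.o t ∘L S.M t - S.M t ∘L S.a t + S.c t) y.1 + S.M t (S.rhs κ t y).1))).re =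
    -(inner ℂ y.1 (S.Q t y.1)).re - 2 * κ * S.η * ‖inner ℂ (S.g t y.1) (S.ρ t y)‖ ^ 2 := by
  obtain ⟨e, z⟩ := y
  have hζ := ho (z - S.M t e)
  set w : E := S.u t (e, z) • S.g t e with hw
  have h2 : (S.rhs κ t (e, z)).2 -
        ((S.o t ∘L S.M t - S.M t ∘L S.a t + S.c t) e + S.M t (S.rhs κ t (e, z)).1) =
      S.o t (z - S.M t e) - (κ : ℂ) • S.M t w := by
    simp only [rhs, ← hw, map_add, map_sub, _root_.add_apply,
      _root_.sub_apply, ContinuousLinearMap.comp_apply, ← Complex.coe_smul, map_smul]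
    abel
  have h1 : (S.rhs κ t (e, z)).1 = S.a t e + (κ : ℂ) • w := by
    simp only [rhs, ← hw, Complex.coe_smul]
  simp only at h1 h2 ⊢
  rw [h2, h1]
  have e1 : inner ℂ (S.a t e) (S.P t e) =
      inner ℂ e (ContinuousLinearMap.adjoint (S.a t) (S.P t e)) :=
    (ContinuousLinearMap.adjoint_inner_right _ _ _).symm
  have e2 : inner ℂ e (S.P t w) = inner ℂ (S.P t e) w := (S.P_symm t e w).symm
  have e3 : (inner ℂ w (S.P t e)).re = (inner ℂ (S.P t e) w).re := by
    rw [← inner_conj_symm, Complex.conj_re]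
  have e4 : inner ℂ (z - S.M t e) (S.M t w) =
      inner ℂ (ContinuousLinearMap.adjoint (S.M t) (z - S.M t e)) w :=
    (ContinuousLinearMap.adjoint_inner_left _ _ _).symm
  have e5 : (inner ℂ (S.ρ t (e, z)) w).re = -(S.η * ‖inner ℂ (S.g t e) (S.ρ t (e, z))‖ ^ 2) := by
    rw [hw, inner_smul_right, u, ← inner_conj_symm (S.ρ t (e, z)) (S.g t e), neg_mul, mul_assoc,
      Complex.mul_conj', Complex.neg_re, Complex.re_ofReal_mul]
    norm_cast
  have e6 : inner ℂ (S.ρ t (e, z)) w = inner ℂ (S.P t e) w -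
      inner ℂ (ContinuousLinearMap.adjoint (S.M t) (z - S.M t e)) w := by
    rw [ρ, inner_sub_left]
  rw [e6, Complex.sub_re] at e5
  simp only [inner_add_left, inner_add_right, inner_sub_right, inner_smul_left, inner_smul_right,
    inner_neg_right, _root_.neg_apply, _root_.add_apply,
    ContinuousLinearMap.comp_apply, map_add, map_smul, Complex.add_re, Complex.sub_re,
    Complex.neg_re, Complex.conj_ofReal, Complex.re_ofReal_mul, hζ, e1, e2, e3, e4]
  linear_combination (2 * κ) * e5

theorem V_absCont {y h : ℝ → E × F} {s t : ℝ} (hst : s ≤ t)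
    (hi : IntervalIntegrable h volume s t)
    (heq : ∀ τ ∈ Icc s t, y τ = y s + ∫ r in s..τ, h r)
    (hP : AbsolutelyContinuousOnInterval S.P s t) (hM : AbsolutelyContinuousOnInterval S.M s t) :
    AbsolutelyContinuousOnInterval (fun τ => S.V τ (y τ)) s t := by
  have hy := absCont_of_eq_primitive hst hi heq
  have he := absCont_comp_clm (ContinuousLinearMap.fst ℝ E F) hy
  have hz := absCont_comp_clm (ContinuousLinearMap.snd ℝ E F) hy
  have h1 := absCont_re_inner he (absCont_bilin (evalL E E) hP he)
  have hζ := hz.sub (absCont_bilin (evalL E F) hM he)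
  have h3 := h1.add (absCont_re_inner hζ hζ)
  have e : (fun τ => S.V τ (y τ)) = fun τ => (inner ℂ (y τ).1 (S.P τ (y τ).1)).re +
      (inner ℂ ((y τ).2 - S.M τ (y τ).1) ((y τ).2 - S.M τ (y τ).1)).re := by
    funext τ
    rw [V, ← inner_self_eq_norm_sq (𝕜 := ℂ)]
    rfl
  rw [e]
  exact h3

theorem intervalIntegrable_inner_Q {e : ℝ → E} {s t : ℝ} (he : ContinuousOn e (uIcc s t)) :
    IntervalIntegrable (fun τ => (inner ℂ (e τ) (S.Q τ (e τ))).re) volume s t := by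
  have h1 := intervalIntegrable_eval (intervalIntegrable_of_locallyIntegrable S.Q_int s t) he
  refine (h1.norm.continuousOn_mul he.norm).mono_fun ?_ (Eventually.of_forall fun τ => ?_)
  · have hm : AEStronglyMeasurable e (volume.restrict (uIoc s t)) :=
      (he.mono uIoc_subset_uIcc).aestronglyMeasurable measurableSet_uIoc
    exact Complex.continuous_re.comp_aestronglyMeasurable (hm.inner h1.def'.1)
  · simp only [norm_mul, norm_norm]
    exact (Complex.abs_re_le_norm _).trans (norm_inner_le_norm _ _)

theorem dP_int (s t : ℝ) : IntervalIntegrable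
    (fun τ => -(ContinuousLinearMap.adjoint (S.a τ) ∘L S.P τ + S.P τ ∘L S.a τ + S.Q τ))
    volume s t := by
  have ha := intervalIntegrable_of_locallyIntegrable S.a_int s t
  have ha' : IntervalIntegrable (fun τ => ContinuousLinearMap.adjoint (S.a τ)) volume s t := by
    refine ha.norm.mono_fun ?_ (Eventually.of_forall fun τ => ?_)
    · exact (ContinuousLinearMap.adjoint (𝕜 := ℂ) (E := E)
        (F := E)).continuous.comp_aestronglyMeasurable ha.def'.1
    · simp only [norm_norm]; exact (LinearIsometryEquiv.norm_map _ _).le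
  have h1 := ha'.mul_continuousOn (A := E →L[ℂ] E) S.P_cont.continuousOn
  have h2 := ha.continuousOn_mul (A := E →L[ℂ] E) S.P_cont.continuousOn
  exact ((h1.add h2).add (intervalIntegrable_of_locallyIntegrable S.Q_int s t)).neg

theorem dM_int (s t : ℝ) : IntervalIntegrable
    (fun τ => S.o τ ∘L S.M τ - S.M τ ∘L S.a τ + S.c τ) volume s t := by
  have ha := intervalIntegrable_of_locallyIntegrable S.a_int s t
  have ho := intervalIntegrable_of_locallyIntegrable S.o_int s t
  have hMm := S.M_cont.aestronglyMeasurable (μ := volume.restrict (uIoc s t))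
  have h1 : IntervalIntegrable (fun τ => S.o τ ∘L S.M τ) volume s t := by
    refine (ho.norm.mul_continuousOn S.M_cont.norm.continuousOn).mono_fun ?_
      (Eventually.of_forall fun τ => ?_)
    · exact (ContinuousLinearMap.compL ℂ E F F).aestronglyMeasurable_comp₂ ho.def'.1 hMm
    · simp only [norm_mul, norm_norm]; exact ContinuousLinearMap.opNorm_comp_le _ _
  have h2 : IntervalIntegrable (fun τ => S.M τ ∘L S.a τ) volume s t := by
    refine (ha.norm.continuousOn_mul S.M_cont.norm.continuousOn).mono_fun ?_
      (Eventually.of_forall fun τ => ?_)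
    · exact (ContinuousLinearMap.compL ℂ E E F).aestronglyMeasurable_comp₂ hMm ha.def'.1
    · simp only [norm_mul, norm_norm]; exact ContinuousLinearMap.opNorm_comp_le _ _
  exact (h1.sub h2).add (intervalIntegrable_of_locallyIntegrable S.c_int s t)

/-- The Lyapunov inequality along the solutions of the loop. -/
theorem V_add_integral_le {y : ℝ → E × F} {κ : ℝ → ℝ} (hκ : ∀ s, 0 ≤ κ s) {s t : ℝ} (hst : s ≤ t)
    (hi : IntervalIntegrable (fun r => S.rhs (κ r) r (y r)) volume s t)
    (heq : ∀ τ ∈ Icc s t, y τ = y s + ∫ r in s..τ, S.rhs (κ r) r (y r)) :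
    S.V t (y t) + ∫ τ in s..t, (inner ℂ (y τ).1 (S.Q τ (y τ).1)).re ≤ S.V s (y s) := by
  have hPd := ae_hasDerivAt_of_eq_primitive hst (S.dP_int s t) (fun τ _ => S.P_eq s τ)
  have hMd := ae_hasDerivAt_of_eq_primitive hst (S.dM_int s t) (fun τ _ => S.M_eq s τ)
  have hyd := ae_hasDerivAt_of_eq_primitive hst hi heq
  have hac := S.V_absCont hst hi heq
    (absCont_of_eq_primitive hst (S.dP_int s t) (fun τ _ => S.P_eq s τ))
    (absCont_of_eq_primitive hst (S.dM_int s t) (fun τ _ => S.M_eq s τ))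
  have hyc : ContinuousOn y (uIcc s t) := (absCont_of_eq_primitive hst hi heq).continuousOn
  have hQi := S.intervalIntegrable_inner_Q (e := fun τ => (y τ).1) hyc.fst
  have hd := integrable_deriv_of_absCont_real hst hac
    (f' := fun τ => -(inner ℂ (y τ).1 (S.Q τ (y τ).1)).re -
      2 * κ τ * S.η * ‖inner ℂ (S.g τ (y τ).1) (S.ρ τ (y τ))‖ ^ 2) (by
    filter_upwards [hPd, hMd, hyd, S.o_skew] with τ h1 h2 h3 h4 hm
    have he := (ContinuousLinearMap.fst ℝ E F).hasFDerivAt.comp_hasDerivAt τ (h3 hm)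
    have hz := (ContinuousLinearMap.snd ℝ E F).hasFDerivAt.comp_hasDerivAt τ (h3 hm)
    have hV1 := Complex.reCLM.hasFDerivAt.comp_hasDerivAt τ
      (he.inner ℂ (hasDerivAt_eval (h1 hm) he))
    have hζ := hz.sub (hasDerivAt_eval (h2 hm) he)
    have hV2 := Complex.reCLM.hasFDerivAt.comp_hasDerivAt τ (hζ.inner ℂ hζ)
    have e : (fun τ => S.V τ (y τ)) = fun τ => (inner ℂ (y τ).1 (S.P τ (y τ).1)).re +
        (inner ℂ ((y τ).2 - S.M τ (y τ).1) ((y τ).2 - S.M τ (y τ).1)).re := by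
      funext τ
      rw [V, ← inner_self_eq_norm_sq (𝕜 := ℂ)]
      rfl
    rw [e]
    refine (hV1.add hV2).congr_deriv ?_
    rw [← S.deriv_algebra τ (y τ) h4]
    have hsymm : ∀ p q : F, (inner ℂ p q).re = (inner ℂ q p).re := fun p q => by
      rw [← inner_conj_symm, Complex.conj_re]
    simp only [Complex.reCLM_apply, Complex.add_re, Function.comp_apply,
      ContinuousLinearMap.coe_fst', ContinuousLinearMap.coe_snd', Pi.sub_apply]
    rw [hsymm (_ - _ : F) ((y τ).2 - S.M τ (y τ).1)]
    ring)
  -- The feedback contributes a nonpositive term for every gain κ ≥ 0. The inequality therefore also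
  -- covers the uncontrolled loop and the loop with a state-dependent cutoff.
  have hmono : ∫ τ in s..t, (-(inner ℂ (y τ).1 (S.Q τ (y τ).1)).re -
      2 * κ τ * S.η * ‖inner ℂ (S.g τ (y τ).1) (S.ρ τ (y τ))‖ ^ 2) ≤
      ∫ τ in s..t, -(inner ℂ (y τ).1 (S.Q τ (y τ).1)).re := by
    refine intervalIntegral.integral_mono_on hst hd.1 hQi.neg fun τ _ => ?_
    have := hκ τ
    have := S.η_pos
    have : 0 ≤ 2 * κ τ * S.η * ‖inner ℂ (S.g τ (y τ).1) (S.ρ τ (y τ))‖ ^ 2 := by positivity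
    linarith
  rw [hd.2, intervalIntegral.integral_neg] at hmono
  linarith

theorem exists_norm_bound : ∃ K, 0 ≤ K ∧ ∀ t, ‖S.P t‖ ≤ K ∧ ‖S.M t‖ ≤ K := by
  obtain ⟨K₁, h₁⟩ := isCompact_Icc.exists_bound_of_continuousOn
    (S.P_cont.continuousOn (s := Icc 0 S.T))
  obtain ⟨K₂, h₂⟩ := isCompact_Icc.exists_bound_of_continuousOn
    (S.M_cont.continuousOn (s := Icc 0 S.T))
  have h0 : (0 : ℝ) ∈ Icc 0 S.T := left_mem_Icc.2 S.T_pos.le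
  refine ⟨max K₁ K₂, (norm_nonneg _).trans ((h₁ 0 h0).trans (le_max_left _ _)), fun t => ?_⟩
  obtain ⟨s, hs, hPs⟩ := S.P_per.exists_mem_Ico₀ S.T_pos t
  obtain ⟨r, hr, hMr⟩ := S.M_per.exists_mem_Ico₀ S.T_pos t
  exact ⟨hPs ▸ (h₁ s (Ico_subset_Icc_self hs)).trans (le_max_left _ _),
    hMr ▸ (h₂ r (Ico_subset_Icc_self hr)).trans (le_max_right _ _)⟩

theorem norm_ρ_le {K : ℝ} (hK : ∀ t, ‖S.P t‖ ≤ K ∧ ‖S.M t‖ ≤ K) (t : ℝ) (y : E × F) :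
    ‖S.ρ t y‖ ≤ (K + K * (1 + K)) * ‖y‖ := by
  have hK0 : 0 ≤ K := (norm_nonneg _).trans (hK 0).1
  have h1 : ‖S.P t y.1‖ ≤ K * ‖y‖ := (S.P t).le_of_opNorm_le_of_le (hK t).1 (norm_fst_le y)
  have h2 : ‖S.M t y.1‖ ≤ K * ‖y‖ := (S.M t).le_of_opNorm_le_of_le (hK t).2 (norm_fst_le y)
  have h3 : ‖y.2 - S.M t y.1‖ ≤ (1 + K) * ‖y‖ := by
    have := norm_sub_le y.2 (S.M t y.1)
    have := norm_snd_le y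
    linarith
  have h4 : ‖ContinuousLinearMap.adjoint (S.M t) (y.2 - S.M t y.1)‖ ≤ K * ((1 + K) * ‖y‖) :=
    ContinuousLinearMap.le_of_opNorm_le_of_le _
      ((LinearIsometryEquiv.norm_map _ _).trans_le (hK t).2) h3
  calc ‖S.ρ t y‖ ≤ K * ‖y‖ + K * ((1 + K) * ‖y‖) := (norm_sub_le _ _).trans (add_le_add h1 h4)
    _ = _ := by ring

theorem ρ_sub (t : ℝ) (y y' : E × F) : S.ρ t y - S.ρ t y' = S.ρ t (y - y') := by
  simp only [ρ, Prod.fst_sub, Prod.snd_sub, map_sub]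
  abel

/-- Only the uniform bounds on P and M enter, through (a + b)² ≤ 2a² + 2b² for the second term of V.
-/
theorem V_le : ∃ C, 0 < C ∧ ∀ t y, S.V t y ≤ C * (‖y.1‖ ^ 2 + ‖y.2‖ ^ 2) := by
  obtain ⟨K, hK0, hK⟩ := S.exists_norm_bound
  refine ⟨K + 2 + 2 * K ^ 2, by positivity, fun t y => ?_⟩
  have h1 : (inner ℂ y.1 (S.P t y.1)).re ≤ K * ‖y.1‖ ^ 2 := by
    calc (inner ℂ y.1 (S.P t y.1)).re ≤ ‖y.1‖ * ‖S.P t y.1‖ :=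
          (Complex.re_le_norm _).trans (norm_inner_le_norm _ _)
      _ ≤ ‖y.1‖ * (K * ‖y.1‖) := by gcongr; exact (S.P t).le_of_opNorm_le (hK t).1 _
      _ = _ := by ring
  have h2 : ‖y.2 - S.M t y.1‖ ≤ ‖y.2‖ + K * ‖y.1‖ :=
    (norm_sub_le _ _).trans (add_le_add le_rfl ((S.M t).le_of_opNorm_le (hK t).2 _))
  have h3 : ‖y.2 - S.M t y.1‖ ^ 2 ≤ 2 * ‖y.2‖ ^ 2 + 2 * K ^ 2 * ‖y.1‖ ^ 2 := by
    calc ‖y.2 - S.M t y.1‖ ^ 2 ≤ (‖y.2‖ + K * ‖y.1‖) ^ 2 := by gcongr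
      _ ≤ _ := by nlinarith [sq_nonneg (‖y.2‖ - K * ‖y.1‖)]
  rw [V]
  nlinarith [sq_nonneg ‖y.2‖, sq_nonneg ‖y.1‖, mul_nonneg hK0 (sq_nonneg ‖y.2‖),
    mul_nonneg (sq_nonneg K) (sq_nonneg ‖y.2‖)]

end Loop
end TimeDomain

/-! ### Lipschitz truncation of the feedback -/

section Cutoff

variable {Y G : Type*} [NormedAddCommGroup Y] [NormedAddCommGroup G] [NormedSpace ℝ G]

/-- A Lipschitz cutoff, equal to `1` on the ball of radius `R` and to `0` off the ball of radius
`R + 1`. -/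
noncomputable def cutoff (R : ℝ) (y : Y) : ℝ := max 0 (min 1 (R + 1 - ‖y‖))

theorem cutoff_nonneg (R : ℝ) (y : Y) : 0 ≤ cutoff R y := le_max_left _ _

theorem cutoff_le_one (R : ℝ) (y : Y) : cutoff R y ≤ 1 :=
  max_le zero_le_one (min_le_left _ _)

theorem cutoff_eq_one {R : ℝ} {y : Y} (h : ‖y‖ ≤ R) : cutoff R y = 1 := by
  rw [cutoff, min_eq_left (by linarith), max_eq_right zero_le_one]

theorem cutoff_eq_zero {R : ℝ} {y : Y} (h : R + 1 < ‖y‖) : cutoff R y = 0 :=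
  max_eq_left ((min_le_right _ _).trans (by linarith))

theorem continuous_cutoff (R : ℝ) : Continuous (cutoff R : Y → ℝ) := by
  unfold cutoff; fun_prop

theorem abs_cutoff_sub_le (R : ℝ) (y y' : Y) : |cutoff R y - cutoff R y'| ≤ ‖y - y'‖ := by
  unfold cutoff
  refine (abs_max_sub_max_le_max _ _ _ _).trans ?_
  refine max_le (by simp) ((abs_min_sub_min_le_max _ _ _ _).trans (max_le (by simp) ?_))
  rw [sub_sub_sub_cancel_left, abs_sub_comm]
  exact abs_norm_sub_norm_le _ _

/-- Bounds for N are needed only where the cutoff is nonzero. Writing the difference as (χ - χ')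
N(y) + χ' (N(y) - N(y')) with y in the ball of radius R + 1 gives B from the cutoff's Lipschitz
constant 1 and K from N. If only y' lies in that ball the roles are exchanged, and if neither does
both terms vanish. -/
theorem norm_cutoff_smul_sub_le {R B K : ℝ} {N : Y → G} (hB0 : 0 ≤ B) (hK0 : 0 ≤ K)
    (hB : ∀ y, ‖y‖ ≤ R + 1 → ‖N y‖ ≤ B)
    (hK : ∀ y y', ‖y‖ ≤ R + 1 → ‖y'‖ ≤ R + 1 → ‖N y - N y'‖ ≤ K * ‖y - y'‖) (y y' : Y) :
    ‖cutoff R y • N y - cutoff R y' • N y'‖ ≤ (K + B) * ‖y - y'‖ := by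
  have main : ∀ y y' : Y, ‖y‖ ≤ R + 1 →
      ‖cutoff R y • N y - cutoff R y' • N y'‖ ≤ (K + B) * ‖y - y'‖ := by
    intro y y' hy
    have h1 : ‖(cutoff R y - cutoff R y') • N y‖ ≤ B * ‖y - y'‖ := by
      rw [norm_smul, mul_comm]
      exact mul_le_mul (hB y hy) (abs_cutoff_sub_le R y y') (norm_nonneg _) hB0
    have h2 : ‖cutoff R y' • (N y - N y')‖ ≤ K * ‖y - y'‖ := by
      rcases le_or_gt ‖y'‖ (R + 1) with hy' | hy'
      · rw [norm_smul, Real.norm_of_nonneg (cutoff_nonneg _ _)]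
        exact (mul_le_of_le_one_left (norm_nonneg _) (cutoff_le_one _ _)).trans (hK y y' hy hy')
      · rw [cutoff_eq_zero hy', zero_smul, norm_zero]; positivity
    calc ‖cutoff R y • N y - cutoff R y' • N y'‖
        = ‖(cutoff R y - cutoff R y') • N y + cutoff R y' • (N y - N y')‖ := by
          congr 1; rw [sub_smul, smul_sub]; abel
      _ ≤ B * ‖y - y'‖ + K * ‖y - y'‖ := (norm_add_le _ _).trans (add_le_add h1 h2)
      _ = _ := by ring
  rcases le_or_gt ‖y‖ (R + 1) with hy | hy
  · exact main y y' hy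
  · rcases le_or_gt ‖y'‖ (R + 1) with hy' | hy'
    · rw [norm_sub_rev, norm_sub_rev y]
      exact main y' y hy'
    · rw [cutoff_eq_zero hy, cutoff_eq_zero hy', zero_smul, zero_smul, sub_zero, norm_zero]
      positivity

end Cutoff

theorem locallyIntegrable_of_Ioc {G : Type*} [NormedAddCommGroup G] {f : ℝ → G}
    (hf : ∀ s t, IntegrableOn f (Ioc s t)) : LocallyIntegrable f volume := fun x =>
  ⟨Ioc (x - 1) (x + 1), Ioc_mem_nhds (by linarith) (by linarith), hf _ _⟩

/-! ### Local Lipschitz bounds, uniqueness and truncated solutions -/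

section TimeDomain

variable {E F : Type*} [NormedAddCommGroup E] [InnerProductSpace ℂ E] [CompleteSpace E]
  [NormedAddCommGroup F] [InnerProductSpace ℂ F] [CompleteSpace F]

namespace Loop

variable (S : Loop E F)

theorem g₀_aestronglyMeasurable : AEStronglyMeasurable S.g₀ volume :=
  (locallyIntegrable_of_Ioc fun s t =>
    (S.g₀_mem s t).integrable (by norm_num)).aestronglyMeasurable

theorem aestronglyMeasurable_u_smul_g {y : ℝ → E × F} {μ : Measure ℝ} (hμ : μ ≪ volume)
    (hy : AEStronglyMeasurable y μ) :
    AEStronglyMeasurable (fun s => S.u s (y s)) μ ∧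
      AEStronglyMeasurable (fun s => S.u s (y s) • S.g s (y s).1) μ := by
  have hg : AEStronglyMeasurable (fun s => S.g s (y s).1) μ :=
    (S.D.continuous.comp_aestronglyMeasurable hy.fst).add (S.g₀_aestronglyMeasurable.mono_ac hμ)
  have hM := S.M_cont.aestronglyMeasurable (μ := μ)
  have hMa : AEStronglyMeasurable (fun s => ContinuousLinearMap.adjoint (S.M s)) μ :=
    (ContinuousLinearMap.adjoint (𝕜 := ℂ) (E := E) (F := F)).continuous.comp_aestronglyMeasurable
      hM
  have hρ : AEStronglyMeasurable (fun s => S.ρ s (y s)) μ :=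
    (aestronglyMeasurable_eval S.P_cont.aestronglyMeasurable hy.fst).sub
      (aestronglyMeasurable_eval hMa (hy.snd.sub (aestronglyMeasurable_eval hM hy.fst)))
  have hu : AEStronglyMeasurable (fun s => S.u s (y s)) μ := ((hg.inner hρ).const_mul _).neg
  exact ⟨hu, hu.smul hg⟩

theorem aestronglyMeasurable_rhs {y : ℝ → E × F} {κ : ℝ → ℝ} {μ : Measure ℝ} (hμ : μ ≪ volume)
    (hy : AEStronglyMeasurable y μ) (hκ : AEStronglyMeasurable κ μ) :
    AEStronglyMeasurable (fun s => S.rhs (κ s) s (y s)) μ := by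
  have ha := S.a_int.aestronglyMeasurable.mono_ac hμ
  have ho := S.o_int.aestronglyMeasurable.mono_ac hμ
  have hc := S.c_int.aestronglyMeasurable.mono_ac hμ
  exact ((aestronglyMeasurable_eval ha hy.fst).add
    (hκ.smul (S.aestronglyMeasurable_u_smul_g hμ hy).2)).prodMk
    ((aestronglyMeasurable_eval ho hy.snd).add (aestronglyMeasurable_eval hc hy.fst))

/-- Local bounds and Lipschitz bounds of the input term. -/
theorem exists_lipschitz_input (R : ℝ) (hR : 0 ≤ R) : ∃ ℓ : ℝ → ℝ, LocallyIntegrable ℓ volume ∧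
    (∀ s, 0 ≤ ℓ s) ∧
    (∀ s (y : E × F), ‖y‖ ≤ R → ‖S.u s y • S.g s y.1‖ ≤ ℓ s) ∧
    ∀ s (y y' : E × F), ‖y‖ ≤ R → ‖y'‖ ≤ R →
      ‖S.u s y • S.g s y.1 - S.u s y' • S.g s y'.1‖ ≤ ℓ s * ‖y - y'‖ := by
  obtain ⟨K', hK0', hK'⟩ := S.exists_norm_bound
  have hρ := S.norm_ρ_le hK'
  set K := K' + K' * (1 + K') with hK
  have hK0 : 0 ≤ K := by positivity
  set d := ‖S.D‖ with hd
  have hd0 : 0 ≤ d := norm_nonneg _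
  have hη := S.η_pos
  set γ : ℝ → ℝ := fun s => d * R + ‖S.g₀ s‖ with hγ
  have hγ0 : ∀ s, 0 ≤ γ s := fun s => by positivity
  have hγm : ∀ s t, MemLp γ 2 (volume.restrict (Ioc s t)) := fun s t =>
    MemLp.add (memLp_const (d * R)) (S.g₀_mem s t).norm
  have hg : ∀ s (y : E × F), ‖y‖ ≤ R → ‖S.g s y.1‖ ≤ γ s := fun s y hy => by
    refine (norm_add_le _ _).trans (add_le_add ?_ le_rfl)
    exact S.D.le_of_opNorm_le_of_le le_rfl ((norm_fst_le y).trans hy)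
  have hgs : ∀ s (y y' : E × F), ‖S.g s y.1 - S.g s y'.1‖ ≤ d * ‖y - y'‖ := fun s y y' => by
    rw [g, g, add_sub_add_right_eq_sub, ← map_sub]
    exact S.D.le_of_opNorm_le_of_le le_rfl (norm_fst_le (y - y'))
  have hρR : ∀ s (y : E × F), ‖y‖ ≤ R → ‖S.ρ s y‖ ≤ K * R := fun s y hy =>
    (hρ s y).trans (by gcongr)
  have hη' : ‖(S.η : ℂ)‖ = S.η := by rw [Complex.norm_real, Real.norm_of_nonneg hη.le]
  -- γ bounds g on the ball and is locally L², so γ² is integrable: this is where w of class L²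
  -- suffices. The summand γ² R bounds the value of the input term and 2dRγ + γ² its Lipschitz
  -- constant; one rate serves both.
  refine ⟨fun s => S.η * K * (γ s ^ 2 * R + 2 * d * R * γ s + γ s ^ 2), ?_, ?_, ?_, ?_⟩
  · refine locallyIntegrable_of_Ioc fun s t => Integrable.const_mul ?_ _
    have h1 : Integrable γ (volume.restrict (Ioc s t)) := (hγm s t).integrable (by norm_num)
    have h2 : Integrable (fun r => γ r ^ 2) (volume.restrict (Ioc s t)) := (hγm s t).integrable_sq
    exact ((h2.mul_const R).add (h1.const_mul _)).add h2
  · intro s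
    have := hγ0 s
    positivity
  · intro s y hy
    have h0 := hγ0 s
    rw [norm_smul, u, norm_neg, norm_mul, hη']
    calc S.η * ‖inner ℂ (S.g s y.1) (S.ρ s y)‖ * ‖S.g s y.1‖
        ≤ S.η * (γ s * (K * R)) * γ s := by
          gcongr
          · exact (norm_inner_le_norm _ _).trans
              (mul_le_mul (hg s y hy) (hρR s y hy) (norm_nonneg _) h0)
          · exact hg s y hy
      _ = S.η * K * (γ s ^ 2 * R) := by ring
      _ ≤ S.η * K * (γ s ^ 2 * R + 2 * d * R * γ s + γ s ^ 2) := by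
          have : 0 ≤ 2 * d * R * γ s := by positivity
          refine mul_le_mul_of_nonneg_left ?_ (by positivity)
          nlinarith [sq_nonneg (γ s)]
  · intro s y y' hy hy'
    have h0 := hγ0 s
    set G := S.g s y.1
    set G' := S.g s y'.1
    set r := S.ρ s y
    set r' := S.ρ s y'
    have hG : ‖G‖ ≤ γ s := hg s y hy
    have hG' : ‖G'‖ ≤ γ s := hg s y' hy'
    have hGG : ‖G - G'‖ ≤ d * ‖y - y'‖ := hgs s y y'
    have hr : ‖r‖ ≤ K * R := hρR s y hy
    have hrr : ‖r - r'‖ ≤ K * ‖y - y'‖ := by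
      simp only [r, r', S.ρ_sub]; exact hρ s _
    -- The input term is cubic, -η ⟨g, ρ⟩ g, so the difference telescopes into three terms, each
    -- changing one factor.
    have e : S.u s y • G - S.u s y' • G' =
        -((S.η : ℂ) • (inner ℂ G r • (G - G') + inner ℂ (G - G') r • G' +
          inner ℂ G' (r - r') • G')) := by
      simp only [u, inner_sub_left, inner_sub_right, smul_sub, sub_smul, smul_add, neg_smul,
        mul_smul, G, G', r, r']
      abel
    rw [e, norm_neg, norm_smul, hη']
    have b1 : ‖inner ℂ G r • (G - G')‖ ≤ γ s * (K * R) * (d * ‖y - y'‖) := by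
      rw [norm_smul]
      exact mul_le_mul ((norm_inner_le_norm _ _).trans
        (mul_le_mul hG hr (norm_nonneg _) h0)) hGG (norm_nonneg _) (by positivity)
    have b2 : ‖inner ℂ (G - G') r • G'‖ ≤ d * ‖y - y'‖ * (K * R) * γ s := by
      rw [norm_smul]
      exact mul_le_mul ((norm_inner_le_norm _ _).trans
        (mul_le_mul hGG hr (norm_nonneg _) (by positivity))) hG' (norm_nonneg _) (by positivity)
    have b3 : ‖inner ℂ G' (r - r') • G'‖ ≤ γ s * (K * ‖y - y'‖) * γ s := by
      rw [norm_smul]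
      exact mul_le_mul ((norm_inner_le_norm _ _).trans
        (mul_le_mul hG' hrr (norm_nonneg _) h0)) hG' (norm_nonneg _) (by positivity)
    calc S.η * ‖inner ℂ G r • (G - G') + inner ℂ (G - G') r • G' + inner ℂ G' (r - r') • G'‖
        ≤ S.η * (γ s * (K * R) * (d * ‖y - y'‖) + d * ‖y - y'‖ * (K * R) * γ s +
            γ s * (K * ‖y - y'‖) * γ s) := by
          gcongr
          exact (norm_add_le _ _).trans (add_le_add ((norm_add_le _ _).trans (add_le_add b1 b2)) b3)
      _ = S.η * K * (2 * d * R * γ s + γ s ^ 2) * ‖y - y'‖ := by ring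
      _ ≤ S.η * K * (γ s ^ 2 * R + 2 * d * R * γ s + γ s ^ 2) * ‖y - y'‖ := by
          have : 0 ≤ γ s ^ 2 * R := by positivity
          gcongr
          linarith

/-- The linear part of the vector field. -/
theorem norm_linear_part_sub_le (s : ℝ) (y y' : E × F) :
    ‖S.a s y.1 - S.a s y'.1‖ ≤ ‖S.a s‖ * ‖y - y'‖ ∧
    ‖(S.o s y.2 + S.c s y.1) - (S.o s y'.2 + S.c s y'.1)‖ ≤ (‖S.o s‖ + ‖S.c s‖) * ‖y - y'‖ := by
  constructor
  · rw [← map_sub]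
    exact (S.a s).le_of_opNorm_le_of_le le_rfl (norm_fst_le (y - y'))
  · have e : (S.o s y.2 + S.c s y.1) - (S.o s y'.2 + S.c s y'.1) =
        S.o s (y - y').2 + S.c s (y - y').1 := by
      simp only [Prod.fst_sub, Prod.snd_sub, map_sub]; abel
    rw [e, add_mul]
    exact (norm_add_le _ _).trans (add_le_add
      ((S.o s).le_of_opNorm_le_of_le le_rfl (norm_snd_le (y - y')))
      ((S.c s).le_of_opNorm_le_of_le le_rfl (norm_fst_le (y - y'))))

/-- The integrable rate of the linear part. -/
noncomputable def linRate (s : ℝ) : ℝ := ‖S.a s‖ + ‖S.o s‖ + ‖S.c s‖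

theorem linRate_nonneg (s : ℝ) : 0 ≤ S.linRate s := by unfold linRate; positivity

theorem linRate_int : LocallyIntegrable S.linRate volume := by
  have ha : LocallyIntegrable (fun s => ‖S.a s‖) volume := fun x => (S.a_int x).norm
  have ho : LocallyIntegrable (fun s => ‖S.o s‖) volume := fun x => (S.o_int x).norm
  have hc : LocallyIntegrable (fun s => ‖S.c s‖) volume := fun x => (S.c_int x).norm
  exact (ha.add ho).add hc

/-- The two gains may differ, as they do when the gain is a cutoff evaluated at the two states. -/
theorem norm_rhs_sub_le_of_input {κ κ' s K : ℝ} {y y' : E × F} (hK0 : 0 ≤ K)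
    (h : ‖κ • (S.u s y • S.g s y.1) - κ' • (S.u s y' • S.g s y'.1)‖ ≤ K * ‖y - y'‖) :
    ‖S.rhs κ s y - S.rhs κ' s y'‖ ≤ (S.linRate s + K) * ‖y - y'‖ := by
  have h1 := S.norm_linear_part_sub_le s y y'
  have ha := norm_nonneg (S.a s)
  have ho := norm_nonneg (S.o s)
  have hc := norm_nonneg (S.c s)
  have hn := norm_nonneg (y - y')
  rw [Prod.norm_def]
  refine max_le ?_ ?_
  · have e : (S.rhs κ s y - S.rhs κ' s y').1 = (S.a s y.1 - S.a s y'.1) +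
        (κ • (S.u s y • S.g s y.1) - κ' • (S.u s y' • S.g s y'.1)) := by
      simp only [rhs, Prod.fst_sub]; abel
    rw [e]
    refine (norm_add_le _ _).trans ((add_le_add h1.1 h).trans ?_)
    rw [← add_mul]
    refine mul_le_mul_of_nonneg_right ?_ hn
    unfold linRate; linarith
  · refine h1.2.trans (mul_le_mul_of_nonneg_right ?_ hn)
    unfold linRate; linarith

/-- ρ is linear in the state, so the feedback vanishes at the origin. Growth bounds then follow from
Lipschitz bounds by comparison with the zero state. -/
theorem norm_rhs_zero_le (κ s : ℝ) : ‖S.rhs κ s 0‖ ≤ 0 := by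
  have : S.ρ s 0 = 0 := by simp [ρ]
  simp [rhs, u, this]

theorem norm_rhs_sub_le {R : ℝ} {ℓ : ℝ → ℝ} (hℓ0 : ∀ s, 0 ≤ ℓ s)
    (hℓ : ∀ s (y y' : E × F), ‖y‖ ≤ R → ‖y'‖ ≤ R →
      ‖S.u s y • S.g s y.1 - S.u s y' • S.g s y'.1‖ ≤ ℓ s * ‖y - y'‖) (s : ℝ) {y y' : E × F}
    (hy : ‖y‖ ≤ R) (hy' : ‖y'‖ ≤ R) :
    ‖S.rhs 1 s y - S.rhs 1 s y'‖ ≤ (S.linRate s + ℓ s) * ‖y - y'‖ :=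
  S.norm_rhs_sub_le_of_input (hℓ0 s) (by rw [one_smul, one_smul]; exact hℓ s y y' hy hy')

theorem intervalIntegrable_rhs {y : ℝ → E × F} {s t : ℝ} (hy : ContinuousOn y (uIcc s t)) :
    IntervalIntegrable (fun r => S.rhs 1 r (y r)) volume s t := by
  obtain ⟨R, hR⟩ := isCompact_uIcc.exists_bound_of_continuousOn hy
  have hR0 : 0 ≤ R := (norm_nonneg _).trans (hR s left_mem_uIcc)
  obtain ⟨ℓ, hℓ, hℓ0, -, hℓl⟩ := S.exists_lipschitz_input R hR0
  have hi := intervalIntegrable_of_locallyIntegrable (S.linRate_int.add hℓ) s t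
  refine (hi.mul_const R).mono_fun ?_ ?_
  · exact S.aestronglyMeasurable_rhs (κ := fun _ => 1) Measure.absolutelyContinuous_restrict
      ((hy.mono uIoc_subset_uIcc).aestronglyMeasurable measurableSet_uIoc)
      aestronglyMeasurable_const
  · refine (ae_restrict_iff' measurableSet_uIoc).2 (Eventually.of_forall fun r hr => ?_)
    have hyr := hR r (uIoc_subset_uIcc hr)
    have h1 := S.norm_rhs_sub_le hℓ0 hℓl r hyr (y' := 0) (by simpa using hR0)
    have h2 := norm_le_zero_iff.1 (S.norm_rhs_zero_le 1 r)
    rw [h2, sub_zero, sub_zero] at h1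
    refine h1.trans (le_trans ?_ (le_abs_self _))
    have := S.linRate_nonneg r
    have := hℓ0 r
    simp only [Pi.add_apply]
    gcongr

/-- Uniqueness of the solutions of the loop. -/
theorem unique {y y' : ℝ → E × F} {t₀ t₁ : ℝ} (hy : ContinuousOn y (Icc t₀ t₁))
    (hy' : ContinuousOn y' (Icc t₀ t₁))
    (heq : ∀ t ∈ Icc t₀ t₁, y t = y t₀ + ∫ s in t₀..t, S.rhs 1 s (y s))
    (heq' : ∀ t ∈ Icc t₀ t₁, y' t = y' t₀ + ∫ s in t₀..t, S.rhs 1 s (y' s))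
    (h0 : y t₀ = y' t₀) : ∀ t ∈ Icc t₀ t₁, y t = y' t := by
  intro t ht
  have h01 := ht.1.trans ht.2
  obtain ⟨R, hR⟩ := isCompact_Icc.exists_bound_of_continuousOn hy
  obtain ⟨R', hR'⟩ := isCompact_Icc.exists_bound_of_continuousOn hy'
  have hR0 : 0 ≤ max R R' := ((norm_nonneg _).trans (hR t ht)).trans (le_max_left _ _)
  obtain ⟨ℓ, hℓ, hℓ0, -, hℓl⟩ := S.exists_lipschitz_input _ hR0
  refine caratheodory_unique (ℓ := fun s => S.linRate s + ℓ s)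
    (fun a b => intervalIntegrable_of_locallyIntegrable (S.linRate_int.add hℓ) a b)
    (fun s => add_nonneg (S.linRate_nonneg s) (hℓ0 s)) (f := S.rhs 1) hy hy'
    (S.intervalIntegrable_rhs (by rwa [uIcc_of_le h01]))
    (S.intervalIntegrable_rhs (by rwa [uIcc_of_le h01])) heq heq' (fun s hs => ?_) h0 t ht
  exact S.norm_rhs_sub_le hℓ0 hℓl s ((hR s hs).trans (le_max_left _ _))
    ((hR' s hs).trans (le_max_right _ _))

/-- Solutions of the loop with a cut off feedback. -/
theorem exists_truncated (R : ℝ) (hR : 0 ≤ R) (κ : ℝ) (hκ : 0 ≤ κ) (hκ1 : κ ≤ 1) (t₀ : ℝ)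
    (y₀ : E × F) :
    ∃ y : ℝ → E × F, Continuous y ∧
      (∀ a b, IntervalIntegrable (fun s => S.rhs (κ * cutoff R (y s)) s (y s)) volume a b) ∧
      ∀ t, t₀ ≤ t → y t = y₀ + ∫ s in t₀..t, S.rhs (κ * cutoff R (y s)) s (y s) := by
  -- The cutoff is supported in the ball of radius R + 1. The rate ℓ is then counted twice below:
  -- once as Lipschitz constant of the input term, once as its bound multiplying the variation of
  -- the cutoff.
  obtain ⟨ℓ, hℓ, hℓ0, hℓb, hℓl⟩ := S.exists_lipschitz_input (R + 1) (by linarith)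
  have hL : LocallyIntegrable (fun s => S.linRate s + (ℓ s + ℓ s)) volume :=
    S.linRate_int.add (hℓ.add hℓ)
  have hlip : ∀ s (y y' : E × F), ‖S.rhs (κ * cutoff R y) s y - S.rhs (κ * cutoff R y') s y'‖ ≤
      (S.linRate s + (ℓ s + ℓ s)) * ‖y - y'‖ := by
    intro s y y'
    refine S.norm_rhs_sub_le_of_input (add_nonneg (hℓ0 s) (hℓ0 s)) ?_
    rw [mul_smul, mul_smul, ← smul_sub, norm_smul, Real.norm_of_nonneg hκ]
    exact (mul_le_of_le_one_left (norm_nonneg _) hκ1).trans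
      (norm_cutoff_smul_sub_le (hℓ0 s) (hℓ0 s) (hℓb s) (hℓl s) y y')
  have hmeas : ∀ y : ℝ → E × F, Continuous y →
      AEStronglyMeasurable (fun s => S.rhs (κ * cutoff R (y s)) s (y s)) volume := fun y hy =>
    S.aestronglyMeasurable_rhs (κ := fun s => κ * cutoff R (y s)) Measure.AbsolutelyContinuous.rfl
      hy.aestronglyMeasurable
      (continuous_const.mul ((continuous_cutoff R).comp hy)).aestronglyMeasurable
  obtain ⟨y, hy, heq⟩ := caratheodory_exists (f := fun s y => S.rhs (κ * cutoff R y) s y)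
    (fun a b => intervalIntegrable_of_locallyIntegrable hL a b) hlip
    (fun s => (S.norm_rhs_zero_le _ s).trans (by
      have := S.linRate_nonneg s; have := hℓ0 s; positivity)) hmeas t₀ y₀
  refine ⟨y, hy, fun a b => ?_, heq⟩
  refine ((intervalIntegrable_of_locallyIntegrable hL a b).mul_continuousOn
    hy.norm.continuousOn).mono_fun (hmeas y hy).restrict (Eventually.of_forall fun s => ?_)
  have h1 := hlip s (y s) 0
  have h2 := norm_le_zero_iff.1 (S.norm_rhs_zero_le (κ * cutoff R (0 : E × F)) s)
  rw [h2, sub_zero, sub_zero] at h1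
  exact h1.trans (le_abs_self _)

end Loop
end TimeDomain

/-- The quadratic form has a positive minimum on the compact set K × unit sphere, and homogeneity
extends the bound to all vectors. If that set is empty, any constant works. -/
theorem exists_coercive_of_pos {E : Type*} [NormedAddCommGroup E] [InnerProductSpace ℂ E]
    [FiniteDimensional ℂ E]
    {ι : Type*} [TopologicalSpace ι] {K : Set ι}
    (hK : IsCompact K) {B : ι → E →L[ℂ] E} (hB : ContinuousOn B K)
    (hpos : ∀ i ∈ K, ∀ v, v ≠ 0 → 0 < (inner ℂ v (B i v)).re) :
    ∃ p, 0 < p ∧ ∀ i ∈ K, ∀ v, p * ‖v‖ ^ 2 ≤ (inner ℂ v (B i v)).re := by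
  have : ProperSpace E := FiniteDimensional.proper ℂ E
  have hcomp : IsCompact (K ×ˢ Metric.sphere (0 : E) 1) := hK.prod (isCompact_sphere 0 1)
  have hcont : ContinuousOn (fun x : ι × E => (inner ℂ x.2 (B x.1 x.2)).re)
      (K ×ˢ Metric.sphere (0 : E) 1) := by
    refine Complex.continuous_re.comp_continuousOn (continuousOn_snd.inner ?_)
    exact (hB.comp continuousOn_fst fun x hx => hx.1).clm_apply continuousOn_snd
  have hp : ∃ p, 0 < p ∧ ∀ x ∈ K ×ˢ Metric.sphere (0 : E) 1, p ≤ (inner ℂ x.2 (B x.1 x.2)).re := by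
    rcases (K ×ˢ Metric.sphere (0 : E) 1).eq_empty_or_nonempty with h | h
    · exact ⟨1, one_pos, fun x hx => by rw [h] at hx; exact hx.elim⟩
    · obtain ⟨x, hx, hmin⟩ := hcomp.exists_isMinOn h hcont
      refine ⟨_, hpos x.1 hx.1 x.2 (ne_zero_of_mem_unit_sphere ⟨x.2, hx.2⟩), fun z hz => hmin hz⟩
  obtain ⟨p, hp0, hp⟩ := hp
  refine ⟨p, hp0, fun i hi v => ?_⟩
  rcases eq_or_ne v 0 with rfl | hv
  · simp
  have hn : ‖v‖ ≠ 0 := norm_ne_zero_iff.2 hv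
  have h1 := hp (i, ((‖v‖⁻¹ : ℝ) : ℂ) • v) ⟨hi, by
    rw [mem_sphere_zero_iff_norm, norm_smul, Complex.norm_real, norm_inv, norm_norm,
      inv_mul_cancel₀ hn]⟩
  simp only [map_smul, inner_smul_left, inner_smul_right, Complex.conj_ofReal,
    Complex.re_ofReal_mul] at h1
  calc p * ‖v‖ ^ 2 ≤ ‖v‖⁻¹ * (‖v‖⁻¹ * (inner ℂ v (B i v)).re) * ‖v‖ ^ 2 := by gcongr
    _ = _ := by field_simp

theorem norm_sq_prod_le {E F : Type*} [NormedAddCommGroup E] [NormedAddCommGroup F]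
    (y : E × F) : ‖y‖ ^ 2 ≤ ‖y.1‖ ^ 2 + ‖y.2‖ ^ 2 := by
  rw [Prod.norm_def]
  rcases max_choice ‖y.1‖ ‖y.2‖ with h | h <;> rw [h] <;>
    nlinarith [sq_nonneg ‖y.1‖, sq_nonneg ‖y.2‖]

/-! ### Definiteness of P, global existence and convergence to the equilibrium -/

section TimeDomain

variable {E F : Type*} [NormedAddCommGroup E] [InnerProductSpace ℂ E] [CompleteSpace E]
  [NormedAddCommGroup F] [InnerProductSpace ℂ F] [CompleteSpace F]

namespace Loop

variable (S : Loop E F)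

/-- If ⟨v, P(t₀) v⟩ = 0, the uncontrolled trajectory from (v, M(t₀) v) starts with V = 0. As V stays
nonnegative, the integral of ⟨e, Q e⟩ cannot be positive; but e ≠ 0 for a short while and Q is
positive almost everywhere. -/
theorem P_pos (t₀ : ℝ) {v : E} (hv : v ≠ 0) : 0 < (inner ℂ v (S.P t₀ v)).re := by
  refine lt_of_le_of_ne (S.P_nonneg t₀ v) fun h0 => ?_
  -- Gain κ = 0 switches the feedback off, and the choice z = M e at t₀ cancels the second term of
  -- V. Coercivity of V, which would give global existence for the true feedback, is not available
  -- yet.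
  obtain ⟨y, hyc, hyi, hy⟩ := S.exists_truncated 0 le_rfl 0 le_rfl zero_le_one t₀ (v, S.M t₀ v)
  have hy0 : y t₀ = (v, S.M t₀ v) := by rw [hy t₀ le_rfl]; simp
  have hne : ∀ᶠ t in 𝓝 t₀, (y t).1 ≠ 0 := by
    refine (continuous_fst.comp hyc).continuousAt.eventually_ne ?_
    simpa [hy0] using hv
  obtain ⟨δ, hδ, hball⟩ := Metric.eventually_nhds_iff.1 hne
  have hlt : t₀ < t₀ + δ / 2 := by linarith
  have hV := S.V_add_integral_le (κ := fun s => 0 * cutoff 0 (y s)) (fun s => by simp) hlt.le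
    (hyi _ _) (fun τ hτ => by rw [hy0]; exact hy τ hτ.1)
  have hV0 : S.V t₀ (y t₀) = 0 := by simp [V, hy0, ← h0]
  have hV1 : 0 ≤ S.V (t₀ + δ / 2) (y (t₀ + δ / 2)) :=
    add_nonneg (S.P_nonneg _ _) (sq_nonneg _)
  have hint : ∫ τ in t₀..(t₀ + δ / 2), (inner ℂ (y τ).1 (S.Q τ (y τ).1)).re ≤ 0 := by linarith
  have hpos : ∀ᵐ τ ∂(volume.restrict (Ioc t₀ (t₀ + δ / 2))),
      0 < (inner ℂ (y τ).1 (S.Q τ (y τ).1)).re := by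
    refine (ae_restrict_iff' measurableSet_Ioc).2 ?_
    filter_upwards [S.Q_pos] with τ hτ hm
    refine hτ _ (hball ?_)
    rw [Real.dist_eq, abs_of_nonneg (by linarith [hm.1])]
    linarith [hm.2]
  have hii := S.intervalIntegrable_inner_Q (e := fun τ => (y τ).1) (s := t₀) (t := t₀ + δ / 2)
    hyc.fst.continuousOn
  rw [intervalIntegrable_iff_integrableOn_Ioc_of_le hlt.le] at hii
  rw [intervalIntegral.integral_of_le hlt.le] at hint
  have hz := (integral_eq_zero_iff_of_nonneg_ae (hpos.mono fun τ h => h.le) hii).1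
    (le_antisymm hint (integral_nonneg_of_ae (hpos.mono fun τ h => h.le)))
  -- The integrand is both positive and zero almost everywhere, so the interval would be a null set.
  have hfalse : ∀ᵐ τ ∂(volume.restrict (Ioc t₀ (t₀ + δ / 2))), False := by
    filter_upwards [hpos, hz] with τ h1 h2
    simp only [Pi.zero_apply] at h2
    exact h1.ne' h2
  rw [ae_restrict_iff' measurableSet_Ioc] at hfalse
  have h3 : volume (Ioc t₀ (t₀ + δ / 2)) = 0 :=
    measure_mono_null (fun τ hτ => by simpa using hτ) (ae_iff.1 hfalse)
  rw [Real.volume_Ioc, ENNReal.ofReal_eq_zero] at h3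
  linarith

/-- P is coercive uniformly over one compact period, hence for all times by periodicity; z is
recovered from z - M e and e. -/
theorem exists_norm_sq_le_V [FiniteDimensional ℂ E] :
    ∃ C, 0 < C ∧ ∀ t y, ‖y.1‖ ^ 2 + ‖y.2‖ ^ 2 ≤ C * S.V t y := by
  obtain ⟨p, hp0, hp⟩ := exists_coercive_of_pos (isCompact_Icc (a := 0) (b := S.T))
    S.P_cont.continuousOn (fun t _ v hv => S.P_pos t hv)
  obtain ⟨K, hK0, hK⟩ := S.exists_norm_bound
  refine ⟨(1 + 2 * K ^ 2) / p + 2, by positivity, fun t y => ?_⟩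
  obtain ⟨s, hs, hPs⟩ := S.P_per.exists_mem_Ico₀ S.T_pos t
  have h1 : p * ‖y.1‖ ^ 2 ≤ (inner ℂ y.1 (S.P t y.1)).re := by
    rw [hPs]; exact hp s (Ico_subset_Icc_self hs) y.1
  have h2 : ‖y.2‖ ≤ ‖y.2 - S.M t y.1‖ + K * ‖y.1‖ := by
    have := norm_add_le (y.2 - S.M t y.1) (S.M t y.1)
    rw [sub_add_cancel] at this
    exact this.trans (add_le_add le_rfl ((S.M t).le_of_opNorm_le (hK t).2 _))
  have h3 : ‖y.2‖ ^ 2 ≤ 2 * ‖y.2 - S.M t y.1‖ ^ 2 + 2 * K ^ 2 * ‖y.1‖ ^ 2 := by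
    calc ‖y.2‖ ^ 2 ≤ (‖y.2 - S.M t y.1‖ + K * ‖y.1‖) ^ 2 := by gcongr
      _ ≤ _ := by nlinarith [sq_nonneg (‖y.2 - S.M t y.1‖ - K * ‖y.1‖)]
  have h4 : (1 + 2 * K ^ 2) * ‖y.1‖ ^ 2 ≤
      (1 + 2 * K ^ 2) / p * (inner ℂ y.1 (S.P t y.1)).re := by
    calc (1 + 2 * K ^ 2) * ‖y.1‖ ^ 2 = (1 + 2 * K ^ 2) / p * (p * ‖y.1‖ ^ 2) := by field_simp
      _ ≤ _ := by gcongr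
  have h5 : 0 ≤ (1 + 2 * K ^ 2) / p * ‖y.2 - S.M t y.1‖ ^ 2 := by positivity
  have h6 := S.P_nonneg t y.1
  rw [V, add_mul, mul_add, mul_add]
  linarith

/-- The solutions of the loop from time `t₀` on. -/
def IsSol (t₀ : ℝ) (y : ℝ → E × F) : Prop :=
  Continuous y ∧ ∀ t, t₀ ≤ t → y t = y t₀ + ∫ s in t₀..t, S.rhs 1 s (y s)

/-- Global existence. -/
theorem exists_isSol [FiniteDimensional ℂ E] (t₀ : ℝ) (y₀ : E × F) :
    ∃ y, S.IsSol t₀ y ∧ y t₀ = y₀ := by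
  obtain ⟨C, hC0, hC⟩ := S.exists_norm_sq_le_V
  -- R is the bound that coercivity and the decay of V impose on any trajectory from y₀. The
  -- truncated loop obeys the same Lyapunov inequality, so its solution stays where the cutoff
  -- equals 1 and solves the true loop.
  set R := Real.sqrt (C * S.V t₀ y₀) with hR
  obtain ⟨y, hyc, hyi, hy⟩ := S.exists_truncated R (Real.sqrt_nonneg _) 1 zero_le_one le_rfl t₀ y₀
  have hy0 : y t₀ = y₀ := by rw [hy t₀ le_rfl]; simp
  have hbd : ∀ t, t₀ ≤ t → ‖y t‖ ≤ R := by
    intro t ht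
    have hV := S.V_add_integral_le (κ := fun s => 1 * cutoff R (y s))
      (fun s => by simpa using cutoff_nonneg R (y s)) ht
      (hyi _ _) (fun τ hτ => by rw [hy0]; exact hy τ hτ.1)
    have hQ : 0 ≤ ∫ τ in t₀..t, (inner ℂ (y τ).1 (S.Q τ (y τ).1)).re := by
      refine intervalIntegral.integral_nonneg_of_ae ht ?_
      filter_upwards [S.Q_pos] with τ hτ
      rcases eq_or_ne (y τ).1 0 with h | h
      · simp [h]
      · exact (hτ _ h).le
    refine Real.le_sqrt_of_sq_le ((norm_sq_prod_le _).trans ((hC t (y t)).trans ?_))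
    rw [hy0] at hV
    exact mul_le_mul_of_nonneg_left (by linarith) hC0.le
  refine ⟨y, ⟨hyc, fun t ht => ?_⟩, hy0⟩
  rw [hy0, hy t ht]
  congr 1
  refine intervalIntegral.integral_congr fun s hs => ?_
  rw [uIcc_of_le ht] at hs
  simp only [cutoff_eq_one (hbd s hs.1), mul_one]

namespace IsSol

variable {S} {t₀ : ℝ} {y : ℝ → E × F}

theorem eq_add (h : S.IsSol t₀ y) {s t : ℝ} (hs : t₀ ≤ s) (hst : s ≤ t) :
    y t = y s + ∫ r in s..t, S.rhs 1 r (y r) := by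
  have hi : ∀ a b, IntervalIntegrable (fun r => S.rhs 1 r (y r)) volume a b := fun a b =>
    S.intervalIntegrable_rhs h.1.continuousOn
  rw [h.2 t (hs.trans hst), h.2 s hs, add_assoc,
    intervalIntegral.integral_add_adjacent_intervals (hi _ _) (hi _ _)]

theorem V_add_le (h : S.IsSol t₀ y) {s t : ℝ} (hs : t₀ ≤ s) (hst : s ≤ t) :
    S.V t (y t) + ∫ τ in s..t, (inner ℂ (y τ).1 (S.Q τ (y τ).1)).re ≤ S.V s (y s) :=
  S.V_add_integral_le (κ := fun _ => 1) (fun _ => zero_le_one) hst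
    (S.intervalIntegrable_rhs h.1.continuousOn) (fun _ hτ => h.eq_add hs hτ.1)

theorem ae_inner_Q_nonneg (y : ℝ → E × F) :
    ∀ᵐ τ, 0 ≤ (inner ℂ (y τ).1 (S.Q τ (y τ).1)).re := by
  filter_upwards [S.Q_pos] with τ hτ
  rcases eq_or_ne (y τ).1 0 with h | h
  · simp [h]
  · exact (hτ _ h).le

theorem V_le (h : S.IsSol t₀ y) {s t : ℝ} (hs : t₀ ≤ s) (hst : s ≤ t) :
    S.V t (y t) ≤ S.V s (y s) := by
  have h1 := h.V_add_le hs hst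
  have h2 := intervalIntegral.integral_nonneg_of_ae hst (ae_inner_Q_nonneg (S := S) y)
  linarith

theorem continuous_V (h : S.IsSol t₀ y) : Continuous fun t => S.V t (y t) := by
  have h1 := h.1.fst
  have h2 := h.1.snd
  exact (Complex.continuous_re.comp (h1.inner (S.P_cont.clm_apply h1))).add
    ((h2.sub (S.M_cont.clm_apply h1)).norm.pow 2)

/-- The mean square of the state over a window is controlled by that over the first window. -/
theorem integral_norm_sq_le (h : S.IsSol t₀ y) {C C' : ℝ} (hC0 : 0 < C)
    (hC : ∀ t y, ‖y.1‖ ^ 2 + ‖y.2‖ ^ 2 ≤ C * S.V t y)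
    (hC' : ∀ t y, S.V t y ≤ C' * (‖y.1‖ ^ 2 + ‖y.2‖ ^ 2)) {t : ℝ} (ht : t₀ + S.T ≤ t) :
    ∫ τ in (t - S.T)..t, (‖(y τ).1‖ ^ 2 + ‖(y τ).2‖ ^ 2) ≤
      C * C' * ∫ τ in t₀..(t₀ + S.T), (‖(y τ).1‖ ^ 2 + ‖(y τ).2‖ ^ 2) := by
  have hT := S.T_pos
  have hc1 := h.1.fst
  have hc2 := h.1.snd
  have hVc := h.continuous_V
  calc ∫ τ in (t - S.T)..t, (‖(y τ).1‖ ^ 2 + ‖(y τ).2‖ ^ 2)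
      ≤ ∫ τ in (t - S.T)..t, C * S.V τ (y τ) := by
        refine intervalIntegral.integral_mono_on (by linarith)
          (Continuous.intervalIntegrable (by fun_prop) _ _)
          (Continuous.intervalIntegrable (by fun_prop) _ _) fun τ _ => hC τ (y τ)
    -- Shifting the window onto [t₀, t₀ + T] lets monotonicity of V compare the two windows point by
    -- point.
    _ = ∫ τ in t₀..(t₀ + S.T), C * S.V (τ + (t - S.T - t₀)) (y (τ + (t - S.T - t₀))) := by
        rw [intervalIntegral.integral_comp_add_right (fun τ => C * S.V τ (y τ))]
        congr 1 <;> ring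
    _ ≤ ∫ τ in t₀..(t₀ + S.T), C * (C' * (‖(y τ).1‖ ^ 2 + ‖(y τ).2‖ ^ 2)) := by
        have hVc' : Continuous fun τ => S.V (τ + (t - S.T - t₀)) (y (τ + (t - S.T - t₀))) :=
          hVc.comp (by fun_prop : Continuous fun τ : ℝ => τ + (t - S.T - t₀))
        refine intervalIntegral.integral_mono_on (by linarith)
          (Continuous.intervalIntegrable (by fun_prop) _ _)
          (Continuous.intervalIntegrable (by fun_prop) _ _) fun τ hτ => ?_
        exact mul_le_mul_of_nonneg_left ((h.V_le hτ.1 (by linarith)).trans (hC' τ (y τ))) hC0.le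
    _ = _ := by simp only [← mul_assoc]; rw [intervalIntegral.integral_const_mul]

end IsSol

open Classical in
/-- The indicator of the times at which `Q` is not bounded below by `1 / n`. -/
noncomputable def defect (n : ℕ) (τ : ℝ) : ℝ :=
  if ∀ v : E, ‖v‖ ^ 2 ≤ n * (inner ℂ v (S.Q τ v)).re then 0 else 1

theorem defect_periodic (n : ℕ) : Function.Periodic (S.defect n) S.T := fun τ => by
  classical
  unfold defect
  exact if_congr (by rw [S.Q_per τ]) rfl rfl

theorem defect_nonneg (n : ℕ) (τ : ℝ) : 0 ≤ S.defect n τ := by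
  unfold defect; split_ifs <;> simp

theorem defect_le_one (n : ℕ) (τ : ℝ) : S.defect n τ ≤ 1 := by
  unfold defect; split_ifs <;> simp

/-- At times where Q ≥ 1/n the form ⟨v, Q v⟩ controls ‖v‖²; at the remaining times the a priori
bound B does. -/
theorem norm_sq_le_defect (n : ℕ) {τ B : ℝ} {v : E} (hv : ‖v‖ ^ 2 ≤ B)
    (hQ : 0 ≤ (inner ℂ v (S.Q τ v)).re) :
    ‖v‖ ^ 2 ≤ n * (inner ℂ v (S.Q τ v)).re + B * S.defect n τ := by
  unfold defect
  split_ifs with h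
  · simpa using h v
  · have : 0 ≤ (n : ℝ) * (inner ℂ v (S.Q τ v)).re := by positivity
    linarith

/-- By continuity in v it suffices to test the inequality on a countable dense set of vectors, so
the set of good times is a countable intersection. -/
theorem aestronglyMeasurable_defect [FiniteDimensional ℂ E] (n : ℕ) :
    AEStronglyMeasurable (S.defect n) volume := by
  have : ProperSpace E := FiniteDimensional.proper ℂ E
  obtain ⟨D, hDc, hDd⟩ := TopologicalSpace.exists_countable_dense E
  set A : Set ℝ := {τ | ∀ v : E, ‖v‖ ^ 2 ≤ n * (inner ℂ v (S.Q τ v)).re} with hA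
  have hAeq : A = ⋂ v ∈ D, {τ | ‖v‖ ^ 2 ≤ n * (inner ℂ v (S.Q τ v)).re} := by
    ext τ
    simp only [hA, mem_ofPred_eq, mem_iInter]
    refine ⟨fun h v _ => h v, fun h v => ?_⟩
    have hcl : IsClosed {v : E | ‖v‖ ^ 2 ≤ n * (inner ℂ v (S.Q τ v)).re} :=
      isClosed_le (by fun_prop) (by fun_prop)
    have hsub : closure D ⊆ {v : E | ‖v‖ ^ 2 ≤ n * (inner ℂ v (S.Q τ v)).re} :=
      hcl.closure_subset_iff.2 fun w hw => h w hw
    exact hsub (hDd v)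
  have hAm : NullMeasurableSet A volume := by
    rw [hAeq]
    refine NullMeasurableSet.biInter hDc fun v _ => ?_
    refine nullMeasurableSet_le aemeasurable_const ?_
    refine AEMeasurable.const_mul ?_ _
    exact (Complex.continuous_re.comp_aestronglyMeasurable (aestronglyMeasurable_const.inner
      (aestronglyMeasurable_eval S.Q_int.aestronglyMeasurable
        aestronglyMeasurable_const))).aemeasurable
  have e : S.defect n = Aᶜ.indicator fun _ => (1 : ℝ) := by
    ext τ
    by_cases hτ : τ ∈ A
    · rw [indicator_of_notMem (by simpa using hτ)]
      exact if_pos hτ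
    · rw [indicator_of_mem (by simpa using hτ)]
      exact if_neg hτ
  rw [e]
  exact aestronglyMeasurable_const.indicator₀ hAm.compl

theorem intervalIntegrable_defect [FiniteDimensional ℂ E] (n : ℕ) (a b : ℝ) :
    IntervalIntegrable (S.defect n) volume a b := by
  refine (intervalIntegrable_const (c := (1 : ℝ))).mono_fun
    (S.aestronglyMeasurable_defect n).restrict (Eventually.of_forall fun τ => ?_)
  simp only [Real.norm_of_nonneg (S.defect_nonneg n τ), norm_one]
  exact S.defect_le_one n τ

/-- At almost every time Q(τ) is positive definite on a finite-dimensional space, hence coercive,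
and the defect is 0 once n is large. Dominated convergence applies with bound 1. -/
theorem tendsto_integral_defect [FiniteDimensional ℂ E] :
    Tendsto (fun n => ∫ τ in (0 : ℝ)..S.T, S.defect n τ) atTop (𝓝 0) := by
  have h := intervalIntegral.tendsto_integral_filter_of_dominated_convergence
    (μ := volume) (a := 0) (b := S.T) (l := atTop) (F := S.defect) (f := fun _ => (0 : ℝ))
    (fun _ => (1 : ℝ)) (Eventually.of_forall fun n => (S.aestronglyMeasurable_defect n).restrict)
    (Eventually.of_forall fun n => Eventually.of_forall fun τ _ => by
      rw [Real.norm_of_nonneg (S.defect_nonneg n τ)]; exact S.defect_le_one n τ)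
    intervalIntegrable_const ?_
  · simpa using h
  · filter_upwards [S.Q_pos] with τ hτ _
    obtain ⟨p, hp0, hp⟩ := exists_coercive_of_pos (isCompact_singleton (x := ()))
      (B := fun _ => S.Q τ) continuousOn_const (fun _ _ v hv => hτ v hv)
    obtain ⟨N, hN⟩ := exists_nat_ge (1 / p)
    refine tendsto_const_nhds.congr' ?_
    filter_upwards [eventually_ge_atTop N] with n hn
    rw [defect, if_pos fun v => ?_]
    have h1 := hp () rfl v
    have hn' : 1 / p ≤ (n : ℝ) := hN.trans (by exact_mod_cast hn)
    have h0 : 0 ≤ (inner ℂ v (S.Q τ v)).re := le_trans (by positivity) h1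
    calc ‖v‖ ^ 2 = 1 / p * (p * ‖v‖ ^ 2) := by field_simp
      _ ≤ 1 / p * (inner ℂ v (S.Q τ v)).re := by gcongr
      _ ≤ _ := by gcongr

/-- The state `e` tends to `0` in mean square over a sliding window. -/
theorem IsSol.tendsto_integral_norm_sq [FiniteDimensional ℂ E] {t₀ : ℝ} {y : ℝ → E × F}
    (h : S.IsSol t₀ y) :
    Tendsto (fun t => ∫ τ in (t - S.T)..t, ‖(y τ).1‖ ^ 2) atTop (𝓝 0) := by
  have hT := S.T_pos
  obtain ⟨C, hC0, hC⟩ := S.exists_norm_sq_le_V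
  set B := C * S.V t₀ (y t₀) with hB
  have hV0 : ∀ t, 0 ≤ S.V t (y t) := fun t => add_nonneg (S.P_nonneg _ _) (sq_nonneg _)
  have hB0 : 0 ≤ B := mul_nonneg hC0.le (hV0 _)
  have hyB : ∀ t, t₀ ≤ t → ‖(y t).1‖ ^ 2 ≤ B := fun t ht => by
    have h1 := hC t (y t)
    have h2 := mul_le_mul_of_nonneg_left (h.V_le le_rfl ht) hC0.le
    nlinarith [sq_nonneg ‖(y t).2‖]
  have hlimV : ∃ l, Tendsto (fun t => S.V t (y t)) atTop (𝓝 l) := by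
    have hanti : Antitone fun t => S.V (max t t₀) (y (max t t₀)) := fun s t hst =>
      h.V_le (le_max_right _ _) (max_le_max hst le_rfl)
    have := tendsto_atTop_ciInf hanti ⟨0, by rintro _ ⟨t, rfl⟩; exact hV0 _⟩
    refine ⟨_, this.congr' ?_⟩
    filter_upwards [eventually_ge_atTop t₀] with t ht
    rw [max_eq_left ht]
  obtain ⟨l, hl⟩ := hlimV
  -- V is nonincreasing and nonnegative along the solution, so it converges and its drop over one
  -- window tends to 0.
  have hdiff : Tendsto (fun t => S.V (t - S.T) (y (t - S.T)) - S.V t (y t)) atTop (𝓝 0) := by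
    have := (hl.comp (tendsto_atTop_add_const_right atTop (-S.T) tendsto_id)).sub hl
    rw [sub_self] at this
    exact this
  rw [Metric.tendsto_nhds]
  intro ε hε
  -- The level n is fixed first, making the contribution of bad times less than ε/2 in every window
  -- by periodicity; only then is t taken large enough for n times the drop of V.
  have hn : ∃ n : ℕ, B * ∫ τ in (0 : ℝ)..S.T, S.defect n τ < ε / 2 := by
    have := (S.tendsto_integral_defect.const_mul B).eventually_lt_const
      (show B * 0 < ε / 2 by rw [mul_zero]; linarith)
    exact this.exists
  obtain ⟨n, hn⟩ := hn
  have hev := (hdiff.const_mul (n : ℝ)).eventually_lt_const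
    (show (n : ℝ) * 0 < ε / 2 by rw [mul_zero]; linarith)
  filter_upwards [hev, eventually_ge_atTop (t₀ + S.T)] with t h1 h2
  have hle : t - S.T ≤ t := by linarith
  have hc1 := h.1.fst
  have hQi := S.intervalIntegrable_inner_Q (e := fun τ => (y τ).1) (s := t - S.T) (t := t)
    hc1.continuousOn
  have hnn : 0 ≤ ∫ τ in (t - S.T)..t, ‖(y τ).1‖ ^ 2 :=
    intervalIntegral.integral_nonneg hle fun τ _ => sq_nonneg _
  rw [Real.dist_eq, sub_zero, abs_of_nonneg hnn]
  have hper : ∫ τ in (t - S.T)..t, S.defect n τ = ∫ τ in (0 : ℝ)..S.T, S.defect n τ := by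
    have := (S.defect_periodic n).intervalIntegral_add_eq (t - S.T) 0
    rwa [sub_add_cancel, zero_add] at this
  calc ∫ τ in (t - S.T)..t, ‖(y τ).1‖ ^ 2
      ≤ ∫ τ in (t - S.T)..t, ((n : ℝ) * (inner ℂ (y τ).1 (S.Q τ (y τ).1)).re +
          B * S.defect n τ) := by
        refine intervalIntegral.integral_mono_ae_restrict hle
          (Continuous.intervalIntegrable (by fun_prop) _ _)
          ((hQi.const_mul _).add ((S.intervalIntegrable_defect n _ _).const_mul _)) ?_
        refine (ae_restrict_iff' measurableSet_Icc).2 ?_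
        filter_upwards [ae_inner_Q_nonneg (S := S) y] with τ hτ hm
        exact S.norm_sq_le_defect n (hyB τ (by linarith [hm.1])) hτ
    _ = n * (∫ τ in (t - S.T)..t, (inner ℂ (y τ).1 (S.Q τ (y τ).1)).re) +
          B * ∫ τ in (0 : ℝ)..S.T, S.defect n τ := by
        rw [intervalIntegral.integral_add (hQi.const_mul _)
          ((S.intervalIntegrable_defect n _ _).const_mul _), intervalIntegral.integral_const_mul,
          intervalIntegral.integral_const_mul, hper]
    _ < ε / 2 + ε / 2 := by
        refine add_lt_add (lt_of_le_of_lt ?_ h1) hn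
        have := h.V_add_le (s := t - S.T) (by linarith) hle
        exact mul_le_mul_of_nonneg_left (by linarith) (Nat.cast_nonneg n)
    _ = ε := by ring

end Loop
end TimeDomain

/-! ### Vector signals and block Toeplitz matrices -/

/-- The operator of a matrix between Euclidean spaces. -/
noncomputable def mop {a b : ℕ} (A : Matrix (Fin a) (Fin b) ℂ) :
    EuclideanSpace ℂ (Fin b) →L[ℂ] EuclideanSpace ℂ (Fin a) :=
  LinearMap.toContinuousLinearMap (Matrix.toEuclideanLin A)

section Operators

variable {a b c : ℕ}

theorem toEuclideanLin_eq_mop (A : Matrix (Fin a) (Fin b) ℂ) (v : EuclideanSpace ℂ (Fin b)) :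
    Matrix.toEuclideanLin A v = mop A v := rfl

theorem mop_apply (A : Matrix (Fin a) (Fin b) ℂ) (v : EuclideanSpace ℂ (Fin b)) (i : Fin a) :
    mop A v i = ∑ j, A i j * v j := by
  rw [← toEuclideanLin_eq_mop, Matrix.toLpLin_apply]
  rfl

theorem mop_add (A B : Matrix (Fin a) (Fin b) ℂ) : mop (A + B) = mop A + mop B := by
  simp [mop]

theorem mop_sub (A B : Matrix (Fin a) (Fin b) ℂ) : mop (A - B) = mop A - mop B := by
  simp [mop]

theorem mop_neg (A : Matrix (Fin a) (Fin b) ℂ) : mop (-A) = -mop A := by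
  simp [mop]

theorem mop_smul (s : ℂ) (A : Matrix (Fin a) (Fin b) ℂ) : mop (s • A) = s • mop A := by
  simp [mop]

theorem mop_zero : mop (0 : Matrix (Fin a) (Fin b) ℂ) = 0 := by
  simp [mop]

theorem mop_sum {ι : Type*} (s : Finset ι) (A : ι → Matrix (Fin a) (Fin b) ℂ) :
    mop (∑ i ∈ s, A i) = ∑ i ∈ s, mop (A i) := by
  simp [mop]

theorem mop_one : mop (1 : Matrix (Fin a) (Fin a) ℂ) = 1 := by
  ext v i
  simp [mop_apply, Matrix.one_apply]

theorem mop_mul (A : Matrix (Fin a) (Fin b) ℂ) (B : Matrix (Fin b) (Fin c) ℂ) :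
    mop (A * B) = mop A ∘L mop B := by
  ext v i
  simp only [mop_apply, ContinuousLinearMap.comp_apply, Matrix.mul_apply, Finset.sum_mul,
    Finset.mul_sum, mul_assoc]
  exact Finset.sum_comm

theorem adjoint_mop (A : Matrix (Fin a) (Fin b) ℂ) :
    ContinuousLinearMap.adjoint (mop A) = mop Aᴴ := by
  symm
  rw [ContinuousLinearMap.eq_adjoint_iff]
  intro x y
  simp only [PiLp.inner_apply, mop_apply, RCLike.inner_apply, Matrix.conjTranspose_apply, map_sum,
    map_mul, Finset.mul_sum, Finset.sum_mul, RCLike.star_def, Complex.conj_conj]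
  rw [Finset.sum_comm]
  refine Finset.sum_congr rfl fun i _ => Finset.sum_congr rfl fun j _ => by ring

/-- Reduces integrability, continuity and integration of operator-valued functions to their scalar
entries. -/
theorem mop_eq_sum (A : Matrix (Fin a) (Fin b) ℂ) :
    mop A = ∑ i, ∑ j, A i j • mop (Matrix.single i j (1 : ℂ)) := by
  conv_lhs => rw [Matrix.matrix_eq_sum_single A]
  simp only [mop_sum, ← mop_smul, Matrix.smul_single, smul_eq_mul, mul_one]

theorem memLp_sum_smul {G : Type*} [NormedAddCommGroup G] [NormedSpace ℂ G]
    {A : ℝ → Matrix (Fin a) (Fin b) ℂ} {p : ℝ≥0∞} {μ : Measure ℝ}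
    (hA : ∀ i j, MemLp (fun t => A t i j) p μ) (B : Fin a → Fin b → G) :
    MemLp (fun t => ∑ i, ∑ j, A t i j • B i j) p μ := by
  have hB : ∀ i j, MemLp (fun t => A t i j • B i j) p μ := fun i j =>
    (hA i j).of_le_mul (c := ‖B i j‖) ((hA i j).1.smul_const _)
      (Eventually.of_forall fun t => by simp only [norm_smul, mul_comm, le_refl])
  exact memLp_finsetSum _ fun i _ => memLp_finsetSum _ fun j _ => hB i j

theorem memLp_mop {A : ℝ → Matrix (Fin a) (Fin b) ℂ} {p : ℝ≥0∞} {μ : Measure ℝ}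
    (hA : ∀ i j, MemLp (fun t => A t i j) p μ) : MemLp (fun t => mop (A t)) p μ := by
  have e : (fun t => mop (A t)) = fun t => ∑ i, ∑ j, A t i j • mop (Matrix.single i j (1 : ℂ)) :=
    funext fun t => mop_eq_sum (A t)
  rw [e]
  exact memLp_sum_smul hA fun i j => mop (Matrix.single i j (1 : ℂ))

theorem memLp_coord {x : ℝ → EuclideanSpace ℂ (Fin a)} {p : ℝ≥0∞} {μ : Measure ℝ} :
    MemLp x p μ ↔ ∀ i, MemLp (fun t => x t i) p μ := by
  constructor
  · intro h i
    exact (EuclideanSpace.proj (𝕜 := ℂ) i).comp_memLp' h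
  · intro h
    have e : x = fun t => ∑ i, x t i • EuclideanSpace.single i (1 : ℂ) := by
      funext t
      ext j
      simp [Finset.sum_apply, Pi.single_apply]
    rw [e]
    refine memLp_finsetSum _ fun i _ => ?_
    exact (ContinuousLinearMap.toSpanSingleton ℂ
      (EuclideanSpace.single i (1 : ℂ))).comp_memLp' (h i)

theorem integrable_coord {x : ℝ → EuclideanSpace ℂ (Fin a)} {μ : Measure ℝ} :
    Integrable x μ ↔ ∀ i, Integrable (fun t => x t i) μ := by
  simp only [← memLp_one_iff_integrable]
  exact memLp_coord

theorem hasSum_coord {ι : Type*} {f : ι → EuclideanSpace ℂ (Fin a)} {v : EuclideanSpace ℂ (Fin a)}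
    (h : ∀ i, HasSum (fun k => f k i) (v i)) : HasSum f v := by
  have h1 : HasSum (fun k => (EuclideanSpace.equiv (Fin a) ℂ) (f k))
      ((EuclideanSpace.equiv (Fin a) ℂ) v) := Pi.hasSum.2 h
  exact (EuclideanSpace.equiv (Fin a) ℂ).hasSum.1 h1

end Operators

/-! ### Phasors of vector signals -/

section Phasors

variable {T t : ℝ} {a b c : ℕ}

theorem phasor_apply (hT : 0 < T) {x : ℝ → EuclideanSpace ℂ (Fin a)} (hx : Integrable x (win T t))
    (k : ℤ) (i : Fin a) : phasor T x t k i = fc T (fun τ => x τ i) t k := by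
  have hi : IntervalIntegrable (fun τ => expo T k τ • x τ) volume (t - T) t :=
    (intervalIntegrable_win hT).2 (hx.bdd_smul 1 (continuous_expo T k).aestronglyMeasurable
      (Eventually.of_forall fun τ => (norm_expo T k τ).le))
  have := (EuclideanSpace.proj (𝕜 := ℂ) i).intervalIntegral_comp_comm hi
  rw [phasor, fc]
  simp only [PiLp.smul_apply, smul_eq_mul, PiLp.proj_apply] at this ⊢
  rw [this]

theorem phasor_congr (hT : 0 < T) {x y : ℝ → EuclideanSpace ℂ (Fin a)} (h : x =ᵐ[win T t] y)
    (k : ℤ) : phasor T x t k = phasor T y t k := by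
  rw [phasor, phasor, integral_win hT, integral_win hT]
  congr 1
  exact integral_congr_ae (h.mono fun τ hτ => by simp only [hτ])

theorem phasor_add (hT : 0 < T) {x y : ℝ → EuclideanSpace ℂ (Fin a)} (hx : Integrable x (win T t))
    (hy : Integrable y (win T t)) (k : ℤ) :
    phasor T (fun τ => x τ + y τ) t k = phasor T x t k + phasor T y t k := by
  ext i
  rw [PiLp.add_apply, phasor_apply hT hx, phasor_apply hT hy,
    phasor_apply hT (x := fun τ => x τ + y τ) (hx.add hy),
    ← fc_add hT (integrable_coord.1 hx i) (integrable_coord.1 hy i)]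
  rfl

theorem phasor_sub (hT : 0 < T) {x y : ℝ → EuclideanSpace ℂ (Fin a)} (hx : Integrable x (win T t))
    (hy : Integrable y (win T t)) (k : ℤ) :
    phasor T (fun τ => x τ - y τ) t k = phasor T x t k - phasor T y t k := by
  ext i
  rw [PiLp.sub_apply, phasor_apply hT hx, phasor_apply hT hy,
    phasor_apply hT (x := fun τ => x τ - y τ) (hx.sub hy),
    ← fc_sub hT (integrable_coord.1 hx i) (integrable_coord.1 hy i)]
  rfl

theorem phasor_periodic (hT : 0 < T) {x : ℝ → EuclideanSpace ℂ (Fin a)}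
    (hx : Function.Periodic x T) (s : ℝ) (k : ℤ) : phasor T x t k = phasor T x s k := by
  have h : Function.Periodic (fun τ => expo T k τ • x τ) T := fun τ => by
    simp only [expo_periodic hT k τ, hx τ]
  have := h.intervalIntegral_add_eq (t - T) (s - T)
  rw [sub_add_cancel, sub_add_cancel] at this
  rw [phasor, phasor, this]

theorem ae_eq_of_phasor_eq (hT : 0 < T) {x y : ℝ → EuclideanSpace ℂ (Fin a)}
    (hx : Integrable x (win T t)) (hy : Integrable y (win T t))
    (h : ∀ k, phasor T x t k = phasor T y t k) : x =ᵐ[win T t] y := by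
  have : ∀ i, ∀ᵐ τ ∂(win T t), x τ i = y τ i := fun i =>
    ae_eq_of_integrable_of_fc_eq hT (integrable_coord.1 hx i) (integrable_coord.1 hy i) fun k => by
      rw [← phasor_apply hT hx, ← phasor_apply hT hy, h]
  filter_upwards [ae_all_iff.2 this] with τ hτ
  ext i; exact hτ i

/-- `j ω k` -/
noncomputable abbrev jw (T : ℝ) (k : ℤ) : ℂ := Complex.I * ((2 * Real.pi / T * (k : ℝ) : ℝ) : ℂ)

theorem integral_coord {h : ℝ → EuclideanSpace ℂ (Fin a)} {r s : ℝ}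
    (hh : IntervalIntegrable h volume r s) (i : Fin a) :
    (∫ τ in r..s, h τ) i = ∫ τ in r..s, h τ i :=
  ((EuclideanSpace.proj (𝕜 := ℂ) i).intervalIntegral_comp_comm hh).symm

theorem intervalIntegrable_of_win (hT : 0 < T) {G : Type*} [NormedAddCommGroup G] {h : ℝ → G}
    (hh : Integrable h (win T t)) {r s : ℝ} (hr : r ∈ Icc (t - T) t) (hs : s ∈ Icc (t - T) t) :
    IntervalIntegrable h volume r s := by
  refine ((intervalIntegrable_win hT).2 hh).mono_set ?_
  rw [uIcc_of_le (by linarith : t - T ≤ t)]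
  exact uIcc_subset_Icc hr hs

theorem phasor_of_eq_primitive (hT : 0 < T) {f h : ℝ → EuclideanSpace ℂ (Fin a)}
    (hh : Integrable h (win T t)) (hfi : Integrable f (win T t))
    (hf : ∀ τ ∈ Icc (t - T) t, f τ = f (t - T) + ∫ s in (t - T)..τ, h s) (k : ℤ) :
    phasor T h t k = jw T k • phasor T f t k +
      expo T k t • (((1 / T : ℝ) : ℂ) • (f t - f (t - T))) := by
  ext i
  have := fc_of_eq_primitive hT (integrable_coord.1 hh i) (f := fun τ => f τ i) (fun τ hτ => by
    rw [← integral_coord (intervalIntegrable_of_win hT hh ⟨le_rfl, by linarith⟩ hτ), ← PiLp.add_apply,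
      ← hf τ hτ]) k
  rw [phasor_apply hT hh, this, PiLp.add_apply, PiLp.smul_apply, PiLp.smul_apply, PiLp.smul_apply,
    PiLp.sub_apply, phasor_apply hT hfi]
  rfl

theorem ae_eq_primitive_of_phasor (hT : 0 < T) {f h : ℝ → EuclideanSpace ℂ (Fin a)}
    (hf : MemLp f 2 (win T t)) (hh : Integrable h (win T t)) (c : EuclideanSpace ℂ (Fin a))
    (hk : ∀ k : ℤ, jw T k • phasor T f t k + expo T k t • c = phasor T h t k) :
    ∃ v, f =ᵐ[win T t] fun τ => v + ∫ s in (t - T)..τ, h s := by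
  have hfi := integrable_of_memLp_win hf
  have h1 : ∀ i, ∃ v, (fun τ => f τ i) =ᵐ[win T t] fun τ => v + ∫ s in (t - T)..τ, h s i := by
    intro i
    refine ae_eq_primitive_of_fc hT (memLp_coord.1 hf i) (integrable_coord.1 hh i) (c i) fun k => ?_
    rw [← phasor_apply hT hfi, ← phasor_apply hT hh, ← hk]
    rfl
  choose v hv using h1
  refine ⟨WithLp.toLp 2 v, ?_⟩
  filter_upwards [ae_all_iff.2 hv, ae_restrict_mem measurableSet_Ioc] with τ hτ hm
  ext i
  rw [hτ i, PiLp.add_apply, integral_coord (intervalIntegrable_of_win hT hh ⟨le_rfl, by linarith⟩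
    (Ioc_subset_Icc_self hm))]

/-! #### Square summable sequences -/

theorem norm_sq_ell2 (X : Ell2 a) : HasSum (fun k => ‖X k‖ ^ 2) (‖X‖ ^ 2) := by
  have := lp.hasSum_norm (p := 2) (by norm_num) X
  simpa using this

theorem hasSum_norm_sq_phasor (hT : 0 < T) {x : ℝ → EuclideanSpace ℂ (Fin a)}
    (hx : MemLp x 2 (win T t)) :
    HasSum (fun k => ‖phasor T x t k‖ ^ 2) (1 / T * ∫ τ in (t - T)..t, ‖x τ‖ ^ 2) := by
  have h1 := hasSum_sum fun i (_ : i ∈ Finset.univ) => hasSum_norm_sq_fc hT (memLp_coord.1 hx i)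
  have e1 : ∀ k, ‖phasor T x t k‖ ^ 2 = ∑ i, ‖fc T (fun τ => x τ i) t k‖ ^ 2 := fun k => by
    rw [EuclideanSpace.norm_sq_eq]
    simp only [phasor_apply hT (integrable_of_memLp_win hx)]
  simp only [e1]
  convert h1 using 1
  rw [← Finset.mul_sum, ← intervalIntegral.integral_finsetSum]
  · simp only [EuclideanSpace.norm_sq_eq]
  · intro i _
    exact (intervalIntegrable_win hT).2 (integrable_norm_sq (memLp_coord.1 hx i))

theorem memℓp_phasor (hT : 0 < T) {x : ℝ → EuclideanSpace ℂ (Fin a)} (hx : MemLp x 2 (win T t)) :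
    Memℓp (phasor T x t) 2 := by
  rw [memℓp_gen_iff (by norm_num)]
  simpa using (hasSum_norm_sq_phasor hT hx).summable

theorem norm_sq_of_phasor (hT : 0 < T) {x : ℝ → EuclideanSpace ℂ (Fin a)}
    (hx : MemLp x 2 (win T t)) {X : Ell2 a} (h : ∀ k, X k = phasor T x t k) :
    ‖X‖ ^ 2 = 1 / T * ∫ τ in (t - T)..t, ‖x τ‖ ^ 2 := by
  have h1 := norm_sq_ell2 X
  simp only [h] at h1
  exact h1.unique (hasSum_norm_sq_phasor hT hx)

theorem exists_periodic_signal (hT : 0 < T) (X : Ell2 a) :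
    ∃ x : ℝ → EuclideanSpace ℂ (Fin a), Function.Periodic x T ∧ (∀ t, MemLp x 2 (win T t)) ∧
      ∀ t k, phasor T x t k = X k := by
  have hX : ∀ i, Memℓp (fun k => X k i) 2 := by
    intro i
    rw [memℓp_gen_iff (by norm_num)]
    refine Summable.of_nonneg_of_le (fun k => by positivity) (fun k => ?_) (norm_sq_ell2 X).summable
    have := PiLp.norm_apply_le (X k) i
    simp only [ENNReal.toReal_ofNat, Real.rpow_ofNat]
    gcongr
  choose f hf1 hf2 hf3 using fun i => exists_periodic_of_memℓp hT (hX i)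
  have hm : ∀ t, MemLp (fun τ => WithLp.toLp 2 fun i => f i τ) 2 (win T t) := fun t =>
    memLp_coord.2 fun i => hf2 i t
  refine ⟨fun τ => WithLp.toLp 2 fun i => f i τ, fun τ => ?_, hm, fun t k => ?_⟩
  · simp only [fun i => hf1 i τ]
  · ext i
    rw [phasor_apply hT (integrable_of_memLp_win (hm t))]
    exact hf3 i t k

/-! #### Block Toeplitz matrices -/

/-- The block Toeplitz matrix of a matrix function over the window ending at `t`. -/
noncomputable def toepAt (T : ℝ) (A : ℝ → Matrix (Fin a) (Fin b) ℂ) (t : ℝ) : HMat a b :=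
  fun k l => phasorMat T A t (k - l)

theorem phasorMat_apply (A : ℝ → Matrix (Fin a) (Fin b) ℂ) (k : ℤ) (i : Fin a) (j : Fin b) :
    phasorMat T A t k i j = fc T (fun τ => A τ i j) t k := rfl

theorem toeplitz_eq_toepAt (hT : 0 < T) {A : ℝ → Matrix (Fin a) (Fin b) ℂ}
    (hA : Function.Periodic A T) (t : ℝ) : toeplitz T A = toepAt T A t := by
  ext k l i j
  exact fc_periodic hT (f := fun τ => A τ i j) (fun τ => by simp only [hA τ]) t _

theorem toepAt_congr (hT : 0 < T) {A B : ℝ → Matrix (Fin a) (Fin b) ℂ} (h : A =ᵐ[win T t] B) :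
    toepAt T A t = toepAt T B t := by
  ext k l i j
  exact fc_congr hT (h.mono fun τ hτ => by simp only [hτ]) _

theorem toepAt_adj (A : ℝ → Matrix (Fin a) (Fin b) ℂ) :
    (toepAt T A t).adj = toepAt T (fun τ => (A τ)ᴴ) t := by
  ext k l i j
  have := conj_fc (T := T) (t := t) (fun τ => A τ j i) (l - k)
  rw [neg_sub] at this
  exact this

theorem matN_adj (n : ℕ) : (matN T n).adj = -matN T n := by
  funext k l
  by_cases h : k = l
  · subst h
    simp [HMat.adj, matN, HMat.diag, Matrix.conjTranspose_smul]
  · simp [HMat.adj, matN, HMat.diag, h, Ne.symm h]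

theorem integrable_mop {A : ℝ → Matrix (Fin a) (Fin b) ℂ}
    (hA : ∀ i j, MemLp (fun τ => A τ i j) 2 (win T t)) {x : ℝ → EuclideanSpace ℂ (Fin b)}
    (hx : MemLp x 2 (win T t)) : Integrable (fun τ => mop (A τ) (x τ)) (win T t) := by
  refine integrable_coord.2 fun i => ?_
  simp only [mop_apply]
  exact integrable_finsetSum _ fun j _ => (hA i j).integrable_mul (memLp_coord.1 hx j)

/-- A Toeplitz matrix acts by convolution, and convolution of Fourier coefficients is multiplication
in time; an L² symbol times an L² signal is integrable, which is enough for phasors to make sense.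
-/
theorem hasSum_toepAt_act (hT : 0 < T) {A : ℝ → Matrix (Fin a) (Fin b) ℂ}
    {x : ℝ → EuclideanSpace ℂ (Fin b)} (hA : ∀ i j, MemLp (fun τ => A τ i j) 2 (win T t))
    (hx : MemLp x 2 (win T t)) (k : ℤ) :
    HasSum (fun l => mop (toepAt T A t k l) (phasor T x t l))
      (phasor T (fun τ => mop (A τ) (x τ)) t k) := by
  have hij : ∀ i j, Integrable (fun τ => A τ i j * x τ j) (win T t) := fun i j =>
    (hA i j).integrable_mul (memLp_coord.1 hx j)
  have hint : Integrable (fun τ => mop (A τ) (x τ)) (win T t) := integrable_mop hA hx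
  refine hasSum_coord fun i => ?_
  rw [phasor_apply hT hint]
  simp only [mop_apply]
  rw [fc_sum hT _ fun j _ => hij i j]
  refine hasSum_sum fun j _ => ?_
  have := hasSum_fc_mul hT (hA i j) (memLp_coord.1 hx j) k
  simp only [← phasor_apply hT (integrable_of_memLp_win hx)] at this
  exact this

theorem toepAt_act (hT : 0 < T) {A : ℝ → Matrix (Fin a) (Fin b) ℂ}
    {x : ℝ → EuclideanSpace ℂ (Fin b)} (hA : ∀ i j, MemLp (fun τ => A τ i j) 2 (win T t))
    (hx : MemLp x 2 (win T t)) :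
    (toepAt T A t).act (phasor T x t) = phasor T (fun τ => mop (A τ) (x τ)) t :=
  funext fun k => (hasSum_toepAt_act hT hA hx k).tsum_eq

theorem hasSum_matN_act (X : ℤ → EuclideanSpace ℂ (Fin a)) (k : ℤ) :
    HasSum (fun l => mop (matN T a k l) (X l)) (jw T k • X k) := by
  have e : jw T k • X k = mop (matN T a k k) (X k) := by
    rw [matN, HMat.diag, if_pos rfl, mop_smul, mop_one]
    rfl
  rw [e]
  refine hasSum_single k fun l hl => ?_
  rw [matN, HMat.diag, if_neg (Ne.symm hl), mop_zero]
  rfl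

/-- Although 𝒩 is unbounded, each of its rows has a single nonzero block. Row by row both series
converge, so no domain condition is needed. -/
theorem toepAt_sub_matN_act (hT : 0 < T) {A : ℝ → Matrix (Fin a) (Fin a) ℂ}
    {x : ℝ → EuclideanSpace ℂ (Fin a)} (hA : ∀ i j, MemLp (fun τ => A τ i j) 2 (win T t))
    (hx : MemLp x 2 (win T t)) (k : ℤ) :
    (toepAt T A t - matN T a).act (phasor T x t) k =
      phasor T (fun τ => mop (A τ) (x τ)) t k - jw T k • phasor T x t k := by
  rw [← ((hasSum_toepAt_act hT hA hx k).sub (hasSum_matN_act (T := T) (phasor T x t) k)).tsum_eq]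
  refine tsum_congr fun l => ?_
  rw [toEuclideanLin_eq_mop, Pi.sub_apply, Pi.sub_apply, mop_sub]
  rfl

theorem hasSum_toepAt_mul (hT : 0 < T) {A : ℝ → Matrix (Fin a) (Fin b) ℂ}
    {B : ℝ → Matrix (Fin b) (Fin c) ℂ} (hA : ∀ i j, MemLp (fun τ => A τ i j) 2 (win T t))
    (hB : ∀ i j, MemLp (fun τ => B τ i j) 2 (win T t)) (k l : ℤ) :
    HasSum (fun m => toepAt T A t k m * toepAt T B t m l)
      (phasorMat T (fun τ => A τ * B τ) t (k - l)) := by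
  refine Pi.hasSum.2 fun i => Pi.hasSum.2 fun j => ?_
  have hij : ∀ p, Integrable (fun τ => A τ i p * B τ p j) (win T t) := fun p =>
    (hA i p).integrable_mul (hB p j)
  rw [phasorMat_apply]
  simp only [Matrix.mul_apply]
  rw [fc_sum hT _ fun p _ => hij p]
  refine hasSum_sum fun p _ => ?_
  have := hasSum_fc_mul hT (hA i p) (hB p j) (k - l)
  -- The convolution index is m - l when the intermediate block index is m.
  rw [← (Equiv.subRight l).hasSum_iff] at this
  convert this using 2 with m
  simp [toepAt, phasorMat_apply]

theorem toepAt_mul (hT : 0 < T) {A : ℝ → Matrix (Fin a) (Fin b) ℂ}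
    {B : ℝ → Matrix (Fin b) (Fin c) ℂ} (hA : ∀ i j, MemLp (fun τ => A τ i j) 2 (win T t))
    (hB : ∀ i j, MemLp (fun τ => B τ i j) 2 (win T t)) :
    (toepAt T A t).mul (toepAt T B t) = toepAt T (fun τ => A τ * B τ) t := by
  funext k l
  exact (hasSum_toepAt_mul hT hA hB k l).tsum_eq

theorem hasSum_matN_mul (B : HMat a b) (k l : ℤ) :
    HasSum (fun m => matN T a k m * B m l) (jw T k • B k l) := by
  have e : jw T k • B k l = matN T a k k * B k l := by
    rw [matN, HMat.diag, if_pos rfl, Matrix.smul_mul, Matrix.one_mul]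
  rw [e]
  refine hasSum_single k fun m hm => ?_
  rw [matN, HMat.diag, if_neg (Ne.symm hm), Matrix.zero_mul]

theorem hasSum_mul_matN (B : HMat a b) (k l : ℤ) :
    HasSum (fun m => B k m * matN T b m l) (jw T l • B k l) := by
  have e : jw T l • B k l = B k l * matN T b l l := by
    rw [matN, HMat.diag, if_pos rfl, Matrix.mul_smul, Matrix.mul_one]
  rw [e]
  refine hasSum_single l fun m hm => ?_
  rw [matN, HMat.diag, if_neg hm, Matrix.mul_zero]

theorem toepAt_sub_matN_mul (hT : 0 < T) {A : ℝ → Matrix (Fin a) (Fin a) ℂ}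
    {B : ℝ → Matrix (Fin a) (Fin b) ℂ} (hA : ∀ i j, MemLp (fun τ => A τ i j) 2 (win T t))
    (hB : ∀ i j, MemLp (fun τ => B τ i j) 2 (win T t)) (k l : ℤ) :
    (toepAt T A t - matN T a).mul (toepAt T B t) k l =
      phasorMat T (fun τ => A τ * B τ) t (k - l) - jw T k • phasorMat T B t (k - l) := by
  refine Eq.trans ?_ ((hasSum_toepAt_mul hT hA hB k l).sub
    (hasSum_matN_mul (T := T) (toepAt T B t) k l)).tsum_eq
  refine tsum_congr fun m => ?_
  rw [Pi.sub_apply, Pi.sub_apply, Matrix.sub_mul]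

theorem toepAt_mul_sub_matN (hT : 0 < T) {A : ℝ → Matrix (Fin a) (Fin b) ℂ}
    {B : ℝ → Matrix (Fin b) (Fin b) ℂ} (hA : ∀ i j, MemLp (fun τ => A τ i j) 2 (win T t))
    (hB : ∀ i j, MemLp (fun τ => B τ i j) 2 (win T t)) (k l : ℤ) :
    (toepAt T A t).mul (toepAt T B t - matN T b) k l =
      phasorMat T (fun τ => A τ * B τ) t (k - l) - jw T l • phasorMat T A t (k - l) := by
  refine Eq.trans ?_ ((hasSum_toepAt_mul hT hA hB k l).sub
    (hasSum_mul_matN (T := T) (toepAt T A t) k l)).tsum_eq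
  refine tsum_congr fun m => ?_
  rw [Pi.sub_apply, Pi.sub_apply, Matrix.mul_sub]

theorem affineMat_eq_toepAt (hT : 0 < T) (Dind Ddep : Matrix (Fin a) (Fin b) ℂ)
    {S : ℤ → EuclideanSpace ℂ (Fin 1)} {s : ℝ → EuclideanSpace ℂ (Fin 1)}
    (hs : Integrable s (win T t)) (h : ∀ k, phasor T s t k = S k) :
    affineMat Dind Ddep S = toepAt T (fun τ => Dind + s τ 0 • Ddep) t := by
  ext k l i j
  have e : ∀ τ, (Dind + s τ 0 • Ddep) i j = Dind i j + Ddep i j * s τ 0 := fun τ => by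
    simp [mul_comm]
  rw [toepAt, phasorMat_apply]
  simp only [e]
  rw [fc_add hT (integrable_const _) ((integrable_coord.1 hs 0).const_mul _), fc_const hT,
    fc_const_mul, ← phasor_apply hT hs, h]
  by_cases hkl : k = l
  · simp [affineMat, HMat.diag, hkl, mul_comm]
  · simp [affineMat, HMat.diag, hkl, sub_eq_zero, mul_comm]

/-- A vector as a column. -/
def colMat (v : EuclideanSpace ℂ (Fin a)) : Matrix (Fin a) (Fin 1) ℂ := Matrix.of fun i _ => v i

theorem mop_colMat (v : EuclideanSpace ℂ (Fin a)) (s : EuclideanSpace ℂ (Fin 1)) :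
    mop (colMat v) s = s 0 • v := by
  ext i
  simp [mop_apply, colMat, mul_comm]

theorem mop_colMat_conjTranspose (v w : EuclideanSpace ℂ (Fin a)) :
    mop (colMat v)ᴴ w 0 = inner ℂ v w := by
  simp [mop_apply, colMat, PiLp.inner_apply, mul_comm]

theorem diag_mul (D : Matrix (Fin a) (Fin b) ℂ) (B : HMat b c) (k l : ℤ) :
    (HMat.diag fun _ => D).mul B k l = D * B k l := by
  rw [HMat.mul, tsum_eq_single k]
  · rw [HMat.diag, if_pos rfl]
  · intro m hm
    rw [HMat.diag, if_neg (Ne.symm hm), Matrix.zero_mul]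

theorem phasor_mop (hT : 0 < T) (D : Matrix (Fin a) (Fin b) ℂ) {x : ℝ → EuclideanSpace ℂ (Fin b)}
    (hx : Integrable x (win T t)) (k : ℤ) :
    phasor T (fun τ => mop D (x τ)) t k = mop D (phasor T x t k) := by
  have hi : IntervalIntegrable (fun τ => expo T k τ • x τ) volume (t - T) t :=
    (intervalIntegrable_win hT).2 (hx.bdd_smul 1 (continuous_expo T k).aestronglyMeasurable
      (Eventually.of_forall fun τ => (norm_expo T k τ).le))
  rw [phasor, phasor, map_smul, ← (mop D).intervalIntegral_comp_comm hi]
  simp only [map_smul]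

theorem matG_eq_toepAt (hT : 0 < T) {n m : ℕ} (Adep : Matrix (Fin n) (Fin n) ℂ)
    (Bdep : Matrix (Fin n) (Fin m) ℂ) {x : ℝ → EuclideanSpace ℂ (Fin n)}
    {w : ℝ → EuclideanSpace ℂ (Fin m)} (hx : Integrable x (win T t)) (hw : Integrable w (win T t)) :
    matG Adep Bdep (phasor T w t) (phasor T x t) =
      toepAt T (fun τ => colMat (mop Adep (x τ) + mop Bdep (w τ))) t := by
  have hx' : Integrable (fun τ => mop Adep (x τ)) (win T t) := (mop Adep).integrable_comp hx
  have hw' : Integrable (fun τ => mop Bdep (w τ)) (win T t) := (mop Bdep).integrable_comp hw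
  ext k l i j
  have h1 : toepAt T (fun τ => colMat (mop Adep (x τ) + mop Bdep (w τ))) t k l i j =
      phasor T (fun τ => mop Adep (x τ) + mop Bdep (w τ)) t (k - l) i :=
    (phasor_apply hT (hx'.add hw') (k - l) i).symm
  rw [h1, phasor_add hT hx' hw', phasor_mop hT _ hx, phasor_mop hT _ hw, matG, Pi.add_apply,
    Pi.add_apply, diag_mul, diag_mul, PiLp.add_apply, mop_apply, mop_apply]
  simp [Matrix.mul_apply, seqToeplitz]

end Phasors

/-! ### The harmonic closed loop in terms of signals over a window -/

/-- A closed loop in the time domain, together with the matrix functions and signals whose phasors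
define the harmonic closed loop. -/
structure Plant (n m q : ℕ) extends
    Loop (EuclideanSpace ℂ (Fin n)) (EuclideanSpace ℂ (Fin q)) where
  Adep : Matrix (Fin n) (Fin n) ℂ
  Bdep : Matrix (Fin n) (Fin m) ℂ
  w : ℝ → EuclideanSpace ℂ (Fin m)
  xe : ℝ → EuclideanSpace ℂ (Fin n)
  Xe : Ell2 n
  Se : Ell2 1
  aMat : ℝ → Matrix (Fin n) (Fin n) ℂ
  oMat : ℝ → Matrix (Fin q) (Fin q) ℂ
  cMat : ℝ → Matrix (Fin q) (Fin n) ℂ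
  PMat : ℝ → Matrix (Fin n) (Fin n) ℂ
  MMat : ℝ → Matrix (Fin q) (Fin n) ℂ
  aMat_per : Function.Periodic aMat T
  oMat_per : Function.Periodic oMat T
  cMat_per : Function.Periodic cMat T
  PMat_per : Function.Periodic PMat T
  MMat_per : Function.Periodic MMat T
  w_per : Function.Periodic w T
  aMat_mem : ∀ t i j, MemLp (fun τ => aMat τ i j) 2 (win T t)
  oMat_mem : ∀ t i j, MemLp (fun τ => oMat τ i j) 2 (win T t)
  cMat_mem : ∀ t i j, MemLp (fun τ => cMat τ i j) 2 (win T t)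
  PMat_mem : ∀ t i j, MemLp (fun τ => PMat τ i j) 2 (win T t)
  MMat_mem : ∀ t i j, MemLp (fun τ => MMat τ i j) 2 (win T t)
  w_mem : ∀ t, MemLp w 2 (win T t)
  xe_cont : Continuous xe
  xe_phasor : ∀ t k, phasor T xe t k = Xe k
  a_eq : ∀ t, a t = mop (aMat t)
  o_eq : ∀ t, o t = mop (oMat t)
  c_eq : ∀ t, c t = mop (cMat t)
  P_eq_mop : ∀ t, P t = mop (PMat t)
  M_eq_mop : ∀ t, M t = mop (MMat t)
  D_eq : D = mop Adep
  g₀_eq : ∀ t, g₀ t = mop Adep (xe t) + mop Bdep (w t)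

namespace Plant

variable {n m q : ℕ} (p : Plant n m q)

/-- The input matrix of the harmonic loop. -/
noncomputable def G : (ℤ → EuclideanSpace ℂ (Fin n)) → HMat n 1 :=
  matG p.Adep p.Bdep (phasor p.T p.w 0)

/-- The solutions of the harmonic loop. -/
def Sol (I : Set ℝ) (X : ℝ → Ell2 n) (Z : ℝ → Ell2 q) (S : ℝ → Ell2 1) : Prop :=
  IsAugmentedSolution p.T (toeplitz p.T p.aMat) (toeplitz p.T p.oMat) (toeplitz p.T p.cMat)
    p.G p.Xe p.Se I X Z S ∧
  IsForwardingFeedback p.η (toeplitz p.T p.PMat) (toeplitz p.T p.MMat) p.G p.Xe p.Se I X Z S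

/-- The feedback as a signal in `ℂ¹`. -/
noncomputable def uVec (t : ℝ) (y : EuclideanSpace ℂ (Fin n) × EuclideanSpace ℂ (Fin q)) :
    EuclideanSpace ℂ (Fin 1) :=
  -((p.η : ℂ) • mop (colMat (p.g t y.1))ᴴ (p.ρ t y))

theorem uVec_apply (t : ℝ) (y : EuclideanSpace ℂ (Fin n) × EuclideanSpace ℂ (Fin q)) :
    p.uVec t y 0 = p.u t y := by
  rw [uVec, PiLp.neg_apply, PiLp.smul_apply, mop_colMat_conjTranspose, smul_eq_mul]
  rfl

section Window

variable {t : ℝ} {e : ℝ → EuclideanSpace ℂ (Fin n)} {z : ℝ → EuclideanSpace ℂ (Fin q)}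

theorem memLp_g (he : MemLp e 2 (win p.T t)) : MemLp (fun τ => p.g τ (e τ)) 2 (win p.T t) :=
  (p.D.comp_memLp' he).add (p.g₀_mem _ _)

theorem memLp_M (he : MemLp e 2 (win p.T t)) : MemLp (fun τ => p.M τ (e τ)) 2 (win p.T t) := by
  obtain ⟨K, -, hK⟩ := p.exists_norm_bound
  exact he.of_le_mul (c := K) (aestronglyMeasurable_eval p.M_cont.aestronglyMeasurable he.1)
    (Eventually.of_forall fun τ => (p.M τ).le_of_opNorm_le (hK τ).2 _)

theorem memLp_P (he : MemLp e 2 (win p.T t)) : MemLp (fun τ => p.P τ (e τ)) 2 (win p.T t) := by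
  obtain ⟨K, -, hK⟩ := p.exists_norm_bound
  exact he.of_le_mul (c := K) (aestronglyMeasurable_eval p.P_cont.aestronglyMeasurable he.1)
    (Eventually.of_forall fun τ => (p.P τ).le_of_opNorm_le (hK τ).1 _)

theorem memLp_adjoint_M (hz : MemLp z 2 (win p.T t)) :
    MemLp (fun τ => ContinuousLinearMap.adjoint (p.M τ) (z τ)) 2 (win p.T t) := by
  obtain ⟨K, -, hK⟩ := p.exists_norm_bound
  refine hz.of_le_mul (c := K) (aestronglyMeasurable_eval
    ((ContinuousLinearMap.adjoint (𝕜 := ℂ)).continuous.comp_aestronglyMeasurable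
      p.M_cont.aestronglyMeasurable) hz.1) (Eventually.of_forall fun τ => ?_)
  exact ContinuousLinearMap.le_of_opNorm_le _
    ((LinearIsometryEquiv.norm_map _ _).trans_le (hK τ).2) _

theorem memLp_ρ (he : MemLp e 2 (win p.T t)) (hz : MemLp z 2 (win p.T t)) :
    MemLp (fun τ => p.ρ τ (e τ, z τ)) 2 (win p.T t) :=
  (p.memLp_P he).sub (p.memLp_adjoint_M (hz.sub (p.memLp_M he)))

theorem memLp_colMat {b : ℕ} {v : ℝ → EuclideanSpace ℂ (Fin b)} {μ : Measure ℝ}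
    (hv : MemLp v 2 μ) (i : Fin b) (j : Fin 1) : MemLp (fun τ => colMat (v τ) i j) 2 μ :=
  memLp_coord.1 hv i

theorem memLp_conjTranspose {a b : ℕ} {A : ℝ → Matrix (Fin a) (Fin b) ℂ} {s : ℝ≥0∞}
    {μ : Measure ℝ} (hA : ∀ i j, MemLp (fun τ => A τ i j) s μ) (i : Fin b) (j : Fin a) :
    MemLp (fun τ => (A τ)ᴴ i j) s μ :=
  (hA j i).star

theorem integrable_uVec (he : MemLp e 2 (win p.T t)) (hz : MemLp z 2 (win p.T t)) :
    Integrable (fun τ => p.uVec τ (e τ, z τ)) (win p.T t) :=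
  ((integrable_mop (memLp_conjTranspose (memLp_colMat (p.memLp_g he)))
    (p.memLp_ρ he hz)).smul (p.η : ℂ)).neg

variable {X : Ell2 n} {Z : Ell2 q} {S : Ell2 1} {s : ℝ → EuclideanSpace ℂ (Fin 1)}

/-- The signal behind X is e + xe, and the phasors of the periodic w are the same over every window,
so 𝒢(X) is the Toeplitz matrix of the column g(e). -/
theorem G_eq (he : MemLp e 2 (win p.T t)) (hX : ∀ k, (X - p.Xe) k = phasor p.T e t k) :
    p.G X = toepAt p.T (fun τ => colMat (p.g τ (e τ))) t := by
  have hxe : Integrable p.xe (win p.T t) :=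
    (intervalIntegrable_win p.T_pos).1 (p.xe_cont.intervalIntegrable _ _)
  have hX' : (X : ℤ → EuclideanSpace ℂ (Fin n)) = phasor p.T (fun τ => e τ + p.xe τ) t := by
    funext k
    rw [phasor_add p.T_pos (integrable_of_memLp_win he) hxe, ← hX, p.xe_phasor]
    simp
  have hw : phasor p.T p.w 0 = phasor p.T p.w t := by
    funext k
    exact phasor_periodic p.T_pos p.w_per t k
  rw [G, hX', hw, matG_eq_toepAt p.T_pos _ _ (x := fun τ => e τ + p.xe τ)
    ((integrable_of_memLp_win he).add hxe)
    (integrable_of_memLp_win (p.w_mem t))]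
  congr 1
  funext τ
  rw [Loop.g, p.D_eq, p.g₀_eq, map_add, add_assoc]

theorem integrable_state (he : MemLp e 2 (win p.T t)) (hs : MemLp s 2 (win p.T t)) :
    Integrable (fun τ => p.a τ (e τ) + s τ 0 • p.g τ (e τ)) (win p.T t) := by
  refine Integrable.add ?_ ?_
  · simp only [p.a_eq]
    exact integrable_mop (p.aMat_mem t) he
  · have := integrable_mop (memLp_colMat (p.memLp_g he)) hs
    simpa only [mop_colMat] using this

/-- The input signal s is an arbitrary L² signal rather than the feedback, since L² membership of
the input is known from S ∈ ℓ² and not from the feedback formula. -/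
theorem state_act (he : MemLp e 2 (win p.T t)) (hs : MemLp s 2 (win p.T t))
    (hX : ∀ k, (X - p.Xe) k = phasor p.T e t k) (hS : ∀ k, (S - p.Se) k = phasor p.T s t k)
    (k : ℤ) :
    (toeplitz p.T p.aMat - matN p.T n).act ↑(X - p.Xe) k + (p.G X).act ↑(S - p.Se) k =
      phasor p.T (fun τ => p.a τ (e τ) + s τ 0 • p.g τ (e τ)) t k -
        jw p.T k • phasor p.T e t k := by
  rw [p.G_eq he hX, toeplitz_eq_toepAt p.T_pos p.aMat_per t, funext hX, funext hS,
    toepAt_sub_matN_act p.T_pos (p.aMat_mem t) he,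
    toepAt_act p.T_pos (memLp_colMat (p.memLp_g he)) hs]
  have h1 := integrable_mop (p.aMat_mem t) he
  have h2 := integrable_mop (memLp_colMat (p.memLp_g he)) hs
  simp only [mop_colMat, ← p.a_eq] at h1 h2 ⊢
  rw [phasor_add p.T_pos h1 h2]
  abel

theorem integrable_extra (he : MemLp e 2 (win p.T t)) (hz : MemLp z 2 (win p.T t)) :
    Integrable (fun τ => p.o τ (z τ) + p.c τ (e τ)) (win p.T t) := by
  simp only [p.o_eq, p.c_eq]
  exact (integrable_mop (p.oMat_mem t) hz).add (integrable_mop (p.cMat_mem t) he)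

theorem extra_act (he : MemLp e 2 (win p.T t)) (hz : MemLp z 2 (win p.T t))
    (hX : ∀ k, (X - p.Xe) k = phasor p.T e t k) (hZ : ∀ k, Z k = phasor p.T z t k) (k : ℤ) :
    (toeplitz p.T p.oMat - matN p.T q).act Z k + (toeplitz p.T p.cMat).act ↑(X - p.Xe) k =
      phasor p.T (fun τ => p.o τ (z τ) + p.c τ (e τ)) t k - jw p.T k • phasor p.T z t k := by
  rw [toeplitz_eq_toepAt p.T_pos p.oMat_per t, toeplitz_eq_toepAt p.T_pos p.cMat_per t,
    funext hX, funext hZ, toepAt_sub_matN_act p.T_pos (p.oMat_mem t) hz,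
    toepAt_act p.T_pos (p.cMat_mem t) he]
  simp only [p.o_eq, p.c_eq]
  rw [phasor_add p.T_pos (integrable_mop (p.oMat_mem t) hz) (integrable_mop (p.cMat_mem t) he)]
  abel

theorem feedback_act (he : MemLp e 2 (win p.T t)) (hz : MemLp z 2 (win p.T t))
    (hX : ∀ k, (X - p.Xe) k = phasor p.T e t k) (hZ : ∀ k, Z k = phasor p.T z t k) :
    (p.G X).adj.act ((toeplitz p.T p.PMat).act ↑(X - p.Xe) - (toeplitz p.T p.MMat).adj.act
        (⇑Z - (toeplitz p.T p.MMat).act ↑(X - p.Xe))) =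
      phasor p.T (fun τ => mop (colMat (p.g τ (e τ)))ᴴ (p.ρ τ (e τ, z τ))) t := by
  rw [p.G_eq he hX, toeplitz_eq_toepAt p.T_pos p.PMat_per t,
    toeplitz_eq_toepAt p.T_pos p.MMat_per t, funext hX, funext hZ,
    toepAt_act p.T_pos (p.PMat_mem t) he, toepAt_act p.T_pos (p.MMat_mem t) he, toepAt_adj,
    toepAt_adj]
  simp only [← p.P_eq_mop, ← p.M_eq_mop]
  have hd : phasor p.T z t - phasor p.T (fun τ => p.M τ (e τ)) t =
      phasor p.T (fun τ => z τ - p.M τ (e τ)) t := funext fun k =>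
    (phasor_sub p.T_pos (integrable_of_memLp_win hz) (integrable_of_memLp_win (p.memLp_M he)) k).symm
  have hzM : MemLp (fun τ => z τ - p.M τ (e τ)) 2 (win p.T t) := hz.sub (p.memLp_M he)
  rw [hd, toepAt_act p.T_pos (memLp_conjTranspose (p.MMat_mem t)) hzM]
  simp only [← adjoint_mop, ← p.M_eq_mop]
  have hr : phasor p.T (fun τ => p.P τ (e τ)) t - phasor p.T (fun τ =>
      ContinuousLinearMap.adjoint (p.M τ) (z τ - p.M τ (e τ))) t =
      phasor p.T (fun τ => p.ρ τ (e τ, z τ)) t := funext fun k =>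
    (phasor_sub p.T_pos (integrable_of_memLp_win (p.memLp_P he))
      (integrable_of_memLp_win (p.memLp_adjoint_M hzM)) k).symm
  rw [hr]
  simp only [adjoint_mop]
  exact toepAt_act p.T_pos (memLp_conjTranspose (memLp_colMat (p.memLp_g he))) (p.memLp_ρ he hz)

/-- All the Toeplitz factors of the law multiply out in time, and the adjoint of the column g is the
pairing with g. The harmonic law thus says exactly that S - Se has the phasors of u. -/
theorem feedback_iff (he : MemLp e 2 (win p.T t)) (hz : MemLp z 2 (win p.T t))
    (hX : ∀ k, (X - p.Xe) k = phasor p.T e t k) (hZ : ∀ k, Z k = phasor p.T z t k) (k : ℤ) :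
    (S k = p.Se k - (p.η : ℂ) • (p.G X).adj.act ((toeplitz p.T p.PMat).act ↑(X - p.Xe) -
      (toeplitz p.T p.MMat).adj.act (⇑Z - (toeplitz p.T p.MMat).act ↑(X - p.Xe))) k) ↔
      (S - p.Se) k = phasor p.T (fun τ => p.uVec τ (e τ, z τ)) t k := by
  rw [p.feedback_act he hz hX hZ]
  have h1 : phasor p.T (fun τ => p.uVec τ (e τ, z τ)) t k = -((p.η : ℂ) •
      phasor p.T (fun τ => mop (colMat (p.g τ (e τ)))ᴴ (p.ρ τ (e τ, z τ))) t k) := by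
    simp only [phasor, uVec, smul_neg, intervalIntegral.integral_neg]
    simp only [smul_comm (expo _ _ _) (p.η : ℂ), intervalIntegral.integral_smul]
    rw [smul_comm]
  rw [h1, lp.coeFn_sub, Pi.sub_apply, sub_eq_add_neg (p.Se k), sub_eq_iff_eq_add, add_comm (p.Se k)]

end Window

end Plant

/-! ### From time domain solutions to harmonic solutions -/

theorem fst_intervalIntegral {E F : Type*} [NormedAddCommGroup E] [NormedSpace ℝ E]
    [NormedAddCommGroup F] [NormedSpace ℝ F] [CompleteSpace E] [CompleteSpace F] {h : ℝ → E × F}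
    {s t : ℝ} (hh : IntervalIntegrable h volume s t) :
    (∫ τ in s..t, h τ).1 = ∫ τ in s..t, (h τ).1 :=
  ((ContinuousLinearMap.fst ℝ E F).intervalIntegral_comp_comm hh).symm

theorem snd_intervalIntegral {E F : Type*} [NormedAddCommGroup E] [NormedSpace ℝ E]
    [NormedAddCommGroup F] [NormedSpace ℝ F] [CompleteSpace E] [CompleteSpace F] {h : ℝ → E × F}
    {s t : ℝ} (hh : IntervalIntegrable h volume s t) :
    (∫ τ in s..t, h τ).2 = ∫ τ in s..t, (h τ).2 :=
  ((ContinuousLinearMap.snd ℝ E F).intervalIntegral_comp_comm hh).symm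

/-! ### Sliding phasors of continuous signals -/

section ContinuousSignals

variable {T : ℝ} {a : ℕ}

theorem hasDerivAt_phasor {x : ℝ → EuclideanSpace ℂ (Fin a)} (hT : 0 < T) (hx : Continuous x)
    (k : ℤ) (t : ℝ) :
    HasDerivAt (fun r => phasor T x r k)
      (expo T k t • (((1 / T : ℝ) : ℂ) • (x t - x (t - T)))) t := by
  have hφ : Continuous fun τ => expo T k τ • x τ := (continuous_expo T k).smul hx
  have h1 : ∀ r, HasDerivAt (fun r => ∫ τ in (0 : ℝ)..r, expo T k τ • x τ) (expo T k r • x r) r :=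
    fun r => (hφ.integral_hasStrictDerivAt 0 r).hasDerivAt
  have h2 : HasDerivAt (fun r => ∫ τ in (0 : ℝ)..(r - T), expo T k τ • x τ)
      (expo T k (t - T) • x (t - T)) t :=
    (h1 (t - T)).comp_sub_const t T
  have h3 := ((h1 t).sub h2).const_smul ((1 / T : ℝ) : ℂ)
  have e1 : expo T k (t - T) = expo T k t := by
    have := expo_periodic hT k (t - T)
    rw [sub_add_cancel] at this
    exact this.symm
  rw [e1, ← smul_sub, smul_comm] at h3
  refine h3.congr_of_eventuallyEq (Eventually.of_forall fun r => ?_)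
  simp only [phasor, Pi.smul_apply, Pi.sub_apply]
  rw [intervalIntegral.integral_interval_sub_left (hφ.intervalIntegrable _ _)
    (hφ.intervalIntegrable _ _)]

theorem memLp_win_of_continuous {G : Type*} [NormedAddCommGroup G] {x : ℝ → G} (hx : Continuous x)
    (p : ℝ≥0∞) (t : ℝ) : MemLp x p (win T t) := by
  obtain ⟨C, hC⟩ := isCompact_Icc.exists_bound_of_continuousOn
    (hx.continuousOn (s := Icc (t - T) t))
  exact MemLp.of_bound hx.aestronglyMeasurable C ((ae_restrict_iff' measurableSet_Ioc).2
    (Eventually.of_forall fun τ hτ => hC τ (Ioc_subset_Icc_self hτ)))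

/-- Every phasor derivative is the same jump (x(t) - x(t - T)) / T multiplied by `expo T k t`, which
is the coincidence condition. The constant `X₀` makes room for the equilibrium. -/
theorem inH_of_continuous (hT : 0 < T) {x : ℝ → EuclideanSpace ℂ (Fin a)} (hx : Continuous x)
    {X : ℝ → Ell2 a} {X₀ : Ell2 a} (hX : ∀ t k, X t k = X₀ k + phasor T x t k) {I : Set ℝ}
    (hI : I ⊆ Ici 0) : InH T I X := by
  have hd : ∀ k t, HasDerivAt (fun r => X r k)
      (expo T k t • (((1 / T : ℝ) : ℂ) • (x t - x (t - T)))) t := fun k t => by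
    simp only [hX]
    exact (hasDerivAt_phasor hT hx k t).const_add _
  refine ⟨fun k c hc => ?_, fun k => Eventually.of_forall fun t => ?_⟩
  · have hcont : Continuous fun t => expo T k t • (((1 / T : ℝ) : ℂ) • (x t - x (t - T))) :=
      (continuous_expo T k).smul
        ((hx.sub (hx.comp (continuous_sub_right T))).const_smul ((1 / T : ℝ) : ℂ))
    refine absCont_of_eq_primitive (hI hc) (hcont.intervalIntegrable _ _) fun t _ => ?_
    rw [intervalIntegral.integral_eq_sub_of_hasDerivAt (fun s _ => hd k s)
      (hcont.intervalIntegrable _ _), add_sub_cancel]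
  · rw [(hd k t).deriv, (hd 0 t).deriv, expo_zero, one_smul]

end ContinuousSignals

namespace Plant

variable {n m q : ℕ} (p : Plant n m q)

/-- Along a continuous trajectory ρ is bounded, so u inherits the L² integrability of g. This is
what places S(t) in ℓ². -/
theorem memLp_uVec {y : ℝ → EuclideanSpace ℂ (Fin n) × EuclideanSpace ℂ (Fin q)}
    (hy : Continuous y) (t : ℝ) : MemLp (fun τ => p.uVec τ (y τ)) 2 (win p.T t) := by
  refine memLp_coord.2 fun i => ?_
  obtain rfl : i = 0 := Subsingleton.elim _ _
  simp only [uVec_apply]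
  obtain ⟨K, hK0, hK⟩ := p.exists_norm_bound
  obtain ⟨R, hR⟩ := isCompact_Icc.exists_bound_of_continuousOn
    (hy.continuousOn (s := Icc (t - p.T) t))
  refine (p.memLp_g (memLp_win_of_continuous hy.fst 2 t)).of_le_mul
    (c := p.η * ((K + K * (1 + K)) * R))
    (p.aestronglyMeasurable_u_smul_g Measure.absolutelyContinuous_restrict
      hy.aestronglyMeasurable).1
    ((ae_restrict_iff' measurableSet_Ioc).2 (Eventually.of_forall fun τ hτ => ?_))
  have h1 := p.norm_ρ_le hK τ (y τ)
  have h2 := hR τ (Ioc_subset_Icc_self hτ)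
  have h3 := p.η_pos
  rw [Loop.u, norm_neg, norm_mul, Complex.norm_real, Real.norm_of_nonneg h3.le, mul_assoc]
  refine mul_le_mul_of_nonneg_left ?_ h3.le
  calc ‖inner ℂ (p.g τ (y τ).1) (p.ρ τ (y τ))‖ ≤ ‖p.g τ (y τ).1‖ * ‖p.ρ τ (y τ)‖ :=
        norm_inner_le_norm _ _
    _ ≤ ‖p.g τ (y τ).1‖ * ((K + K * (1 + K)) * R) := by
        refine mul_le_mul_of_nonneg_left (h1.trans ?_) (norm_nonneg _)
        gcongr
    _ = _ := mul_comm _ _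

/-- The phasors of time domain solutions form a harmonic solution. -/
theorem exists_sol_of_isSol {y : ℝ → EuclideanSpace ℂ (Fin n) × EuclideanSpace ℂ (Fin q)}
    (hy : p.IsSol (-p.T) y) : ∃ X Z S, p.Sol (Ici 0) X Z S ∧
      ∀ t, (∀ k, (X t - p.Xe) k = phasor p.T (fun τ => (y τ).1) t k) ∧
        ∀ k, Z t k = phasor p.T (fun τ => (y τ).2) t k := by
  have hT := p.T_pos
  have he : ∀ t, MemLp (fun τ => (y τ).1) 2 (win p.T t) := memLp_win_of_continuous hy.1.fst 2
  have hz : ∀ t, MemLp (fun τ => (y τ).2) 2 (win p.T t) := memLp_win_of_continuous hy.1.snd 2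
  have hu := p.memLp_uVec hy.1
  let X : ℝ → Ell2 n := fun t => p.Xe + ⟨_, memℓp_phasor hT (he t)⟩
  let Z : ℝ → Ell2 q := fun t => ⟨_, memℓp_phasor hT (hz t)⟩
  let S : ℝ → Ell2 1 := fun t => p.Se + ⟨_, memℓp_phasor hT (hu t)⟩
  have hX : ∀ t k, (X t - p.Xe) k = phasor p.T (fun τ => (y τ).1) t k := fun t k => by
    simp only [X, add_sub_cancel_left]
  have hZ : ∀ t k, Z t k = phasor p.T (fun τ => (y τ).2) t k := fun t k => rfl
  have hS : ∀ t k, (S t - p.Se) k = phasor p.T (fun τ => p.uVec τ (y τ)) t k := fun t k => by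
    simp only [S, add_sub_cancel_left]
  have hX' : ∀ t k, X t k = p.Xe k + phasor p.T (fun τ => (y τ).1) t k := fun t k => rfl
  have hint : ∀ r s, IntervalIntegrable (fun τ => p.rhs 1 τ (y τ)) volume r s := fun r s =>
    p.intervalIntegrable_rhs hy.1.continuousOn
  refine ⟨X, Z, S, ⟨⟨inH_of_continuous hT hy.1.fst hX' subset_rfl,
    inH_of_continuous hT hy.1.snd (X₀ := 0) (fun t k => by simp [hZ]) subset_rfl,
    fun k => ?_, fun k => ?_⟩, fun t _ k => ?_⟩, fun t => ⟨hX t, hZ t⟩⟩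
  · refine (ae_restrict_iff' measurableSet_Ici).2 (Eventually.of_forall fun t ht => ?_)
    -- For t ≥ 0 the whole window lies after -T, where the time solution starts.
    have h0 : -p.T ≤ t - p.T := by linarith [mem_Ici.1 ht]
    change HasDerivAt _ ((toeplitz p.T p.aMat - matN p.T n).act ↑(X t - p.Xe) k +
      (p.G (X t)).act ↑(S t - p.Se) k) t
    rw [p.state_act (he t) (hu t) (hX t) (hS t)]
    simp only [uVec_apply]
    have h1 := phasor_of_eq_primitive hT (f := fun τ => (y τ).1)
      (h := fun τ => (p.rhs 1 τ (y τ)).1) (t := t)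
      ((intervalIntegrable_win hT).1 ⟨(hint _ _).1.fst, (hint _ _).2.fst⟩)
      (integrable_of_memLp_win (he t)) (fun τ hτ => by
        have := congrArg Prod.fst (hy.eq_add h0 hτ.1)
        rwa [Prod.fst_add, fst_intervalIntegral (hint _ _)] at this) k
    simp only [Loop.rhs, one_smul] at h1
    -- Integration by parts produces the term jωk times the phasor, which the -𝒩 of the model
    -- cancels; only the jump remains, and it is the derivative of the sliding phasor.
    rw [h1, add_sub_cancel_left]
    simp only [hX']
    exact (hasDerivAt_phasor hT hy.1.fst k t).const_add _
  · refine (ae_restrict_iff' measurableSet_Ici).2 (Eventually.of_forall fun t ht => ?_)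
    have h0 : -p.T ≤ t - p.T := by linarith [mem_Ici.1 ht]
    change HasDerivAt _ ((toeplitz p.T p.oMat - matN p.T q).act (Z t) k +
      (toeplitz p.T p.cMat).act ↑(X t - p.Xe) k) t
    rw [p.extra_act (he t) (hz t) (hX t) (hZ t)]
    have h1 := phasor_of_eq_primitive hT (f := fun τ => (y τ).2)
      (h := fun τ => (p.rhs 1 τ (y τ)).2) (t := t)
      ((intervalIntegrable_win hT).1 ⟨(hint _ _).1.snd, (hint _ _).2.snd⟩)
      (integrable_of_memLp_win (hz t)) (fun τ hτ => by
        have := congrArg Prod.snd (hy.eq_add h0 hτ.1)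
        rwa [Prod.snd_add, snd_intervalIntegral (hint _ _)] at this) k
    simp only [Loop.rhs] at h1
    rw [h1, add_sub_cancel_left]
    exact hasDerivAt_phasor hT hy.1.snd k t
  · exact (p.feedback_iff (he t) (hz t) (hX t) (hZ t) k).2 (hS t k)

end Plant

/-! ### From harmonic solutions to time domain solutions -/

/-- Signals representing the states of a harmonic trajectory at two times agree on the common part
of the windows. -/
theorem ae_eq_of_inH {T : ℝ} (hT : 0 < T) {a : ℕ} {I : Set ℝ} {X : ℝ → Ell2 a} (hX : InH T I X)
    (hd : ∀ k : ℤ, ∀ᵐ r ∂(volume.restrict I), DifferentiableAt ℝ (fun r => X r k) r)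
    {s t : ℝ} (hs : 0 ≤ s) (hst : s ≤ t) (htT : t ≤ s + T) (hI : Icc 0 t ⊆ I)
    {x x' : ℝ → EuclideanSpace ℂ (Fin a)} (hx : Integrable x (win T t))
    (hx' : Integrable x' (win T t))
    (h : ∀ k : ℤ, phasor T x' t k - phasor T x t k = X t k - X s k) :
    x' =ᵐ[volume.restrict (Ioc (t - T) s)] x := by
  have ht : 0 ≤ t := hs.trans hst
  -- By coincidence every phasor is a primitive of `expo T k * c` with this single profile c.
  set c := deriv (fun r => X r 0) with hc
  have hder : ∀ k : ℤ, ∀ i, ∀ r ∈ Icc 0 t,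
      IntervalIntegrable (fun τ => expo T k τ * c τ i) volume 0 r ∧
        ∫ τ in (0 : ℝ)..r, expo T k τ * c τ i = X r k i - X 0 k i := by
    intro k i r hr
    refine integrable_deriv_of_absCont (f := fun r => X r k i) hr.1
      (absCont_comp_clm ((EuclideanSpace.proj (𝕜 := ℂ) i).restrictScalars ℝ)
        (hX.1 k r (hI hr))) ?_
    have h1 := (hd k).and (hX.2 k)
    have h2 := ae_restrict_of_ae_restrict_of_subset
      ((Ioo_subset_Icc_self.trans (Icc_subset_Icc_right hr.2)).trans hI) h1
    filter_upwards [(ae_restrict_iff' measurableSet_Ioo).1 h2] with τ hτ hm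
    have h3 := (hτ hm).1.hasDerivAt
    rw [(hτ hm).2] at h3
    exact ((EuclideanSpace.proj (𝕜 := ℂ) i).restrictScalars ℝ).hasFDerivAt.comp_hasDerivAt τ h3
  have hcint : IntegrableOn c (Ioc 0 t) := integrable_coord.2 fun i => by
    have := (hder 0 i t ⟨ht, le_rfl⟩).1
    simp only [expo_zero, one_mul] at this
    exact (intervalIntegrable_iff_integrableOn_Ioc_of_le ht).1 this
  have hsub : Ioc s t ⊆ Ioc (t - T) t := Ioc_subset_Ioc_left (by linarith)
  have hind : Integrable ((Ioc s t).indicator fun τ => (T : ℂ) • c τ) (win T t) := by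
    refine Integrable.mono_measure ?_ Measure.restrict_le_self
    exact (integrable_indicator_iff measurableSet_Ioc).2
      ((hcint.mono_set (Ioc_subset_Ioc_left hs)).smul (T : ℂ))
  -- X(t) - X(s) is thus the phasor sequence of T c restricted to (s, t]. By uniqueness x' - x is
  -- that function, which vanishes on the rest of the window.
  have hph : ∀ k, phasor T (fun τ => x' τ - x τ) t k =
      phasor T ((Ioc s t).indicator fun τ => (T : ℂ) • c τ) t k := by
    intro k
    rw [phasor_sub hT hx' hx, h]
    ext i
    have e : (fun τ => expo T k τ * ((Ioc s t).indicator (fun τ => (T : ℂ) • c τ) τ) i) =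
        (Ioc s t).indicator fun τ => (T : ℂ) * (expo T k τ * c τ i) := by
      funext τ
      by_cases hτ : τ ∈ Ioc s t
      · simp only [indicator_of_mem hτ, PiLp.smul_apply, smul_eq_mul]; ring
      · simp [indicator_of_notMem hτ]
    rw [phasor_apply hT hind, fc, integral_win hT, e, setIntegral_indicator measurableSet_Ioc,
      inter_eq_self_of_subset_right hsub, ← intervalIntegral.integral_of_le hst,
      intervalIntegral.integral_const_mul, ← intervalIntegral.integral_interval_sub_left
        (hder k i t ⟨ht, le_rfl⟩).1 (hder k i s ⟨hs, hst⟩).1,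
      (hder k i t ⟨ht, le_rfl⟩).2, (hder k i s ⟨hs, hst⟩).2, PiLp.sub_apply]
    have : (T : ℂ) ≠ 0 := by exact_mod_cast hT.ne'
    push_cast
    field_simp
    ring
  have hfin := ae_eq_of_phasor_eq hT (x := fun τ => x' τ - x τ) (hx'.sub hx) hind hph
  have hfin' := ae_restrict_of_ae_restrict_of_subset
    (Ioc_subset_Ioc_right hst : Ioc (t - T) s ⊆ Ioc (t - T) t) hfin
  filter_upwards [hfin', ae_restrict_mem measurableSet_Ioc] with τ hτ hm
  rw [indicator_of_notMem (fun h => absurd h.1 (not_lt.2 hm.2))] at hτ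
  exact sub_eq_zero.1 hτ

theorem continuousOn_const_add_primitive {G : Type*} [NormedAddCommGroup G] [NormedSpace ℝ G]
    {h : ℝ → G} {α β : ℝ} (hαβ : α ≤ β) (hh : IntervalIntegrable h volume α β) (v : G) :
    ContinuousOn (fun τ => v + ∫ s in α..τ, h s) (Icc α β) := by
  have := intervalIntegral.continuousOn_primitive_interval (a := α) (b := β) (f := h) (μ := volume)
    (by rw [uIcc_of_le hαβ]; exact (intervalIntegrable_iff_integrableOn_Icc_of_le hαβ).1 hh)
  rw [uIcc_of_le hαβ] at this
  exact continuousOn_const.add this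

/-- All the intervals (γ, β] end at β, so any two overlap in a set of positive measure and their
constants coincide; countably many of them exhaust (α, β]. -/
theorem ae_eq_primitive_of_forall_Ioo {G : Type*} [NormedAddCommGroup G] [NormedSpace ℝ G]
    {x h : ℝ → G} {α β : ℝ} (hαβ : α < β)
    (H : ∀ γ ∈ Ioo α β, ∃ v, x =ᵐ[volume.restrict (Ioc γ β)] fun τ => v + ∫ s in α..τ, h s) :
    ∃ v, x =ᵐ[volume.restrict (Ioc α β)] fun τ => v + ∫ s in α..τ, h s := by
  choose! v hv using H
  have hconst : ∀ γ ∈ Ioo α β, ∀ γ' ∈ Ioo α β, v γ = v γ' := by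
    intro γ hγ γ' hγ'
    have h1 := ae_restrict_of_ae_restrict_of_subset
      (Ioc_subset_Ioc_left (le_max_left γ γ') : Ioc (max γ γ') β ⊆ _) (hv γ hγ)
    have h2 := ae_restrict_of_ae_restrict_of_subset
      (Ioc_subset_Ioc_left (le_max_right γ γ') : Ioc (max γ γ') β ⊆ _) (hv γ' hγ')
    have hne : NeBot (ae (volume.restrict (Ioc (max γ γ') β))) := by
      rw [ae_neBot, Ne, Measure.restrict_eq_zero, Real.volume_Ioc, ENNReal.ofReal_eq_zero]
      have := max_lt hγ.2 hγ'.2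
      intro h; linarith
    obtain ⟨τ, h3, h4⟩ := (h1.and h2).exists
    exact add_right_cancel (h3.symm.trans h4)
  obtain ⟨γ₀, hγ₀⟩ := exists_between hαβ
  refine ⟨v γ₀, ?_⟩
  have hseq : ∀ j : ℕ, α + (β - α) / (j + 2) ∈ Ioo α β := by
    intro j
    have hj : (0 : ℝ) ≤ j := j.cast_nonneg
    have h0 : 0 < β - α := sub_pos.2 hαβ
    have h1 : 0 < (β - α) / (j + 2) := by positivity
    have h2 : (β - α) / (j + 2) < β - α := div_lt_self h0 (by linarith)
    exact ⟨by linarith, by linarith⟩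
  have hU : Ioc α β ⊆ ⋃ j : ℕ, Ioc (α + (β - α) / (j + 2)) β := by
    intro τ hτ
    obtain ⟨j, hj⟩ := exists_nat_gt ((β - α) / (τ - α))
    have h0 : 0 < τ - α := sub_pos.2 hτ.1
    refine mem_iUnion.2 ⟨j, ?_, hτ.2⟩
    rw [div_lt_iff₀ h0] at hj
    have hj0 : (0 : ℝ) ≤ j := j.cast_nonneg
    have : (β - α) / (j + 2) < τ - α := by
      rw [div_lt_iff₀ (by positivity)]
      nlinarith
    linarith
  refine ae_restrict_of_ae_restrict_of_subset hU ?_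
  refine (ae_restrict_iUnion_iff _ _).2 fun j => ?_
  rw [hconst γ₀ hγ₀ _ (hseq j)]
  exact hv _ (hseq j)

theorem eqOn_Icc_of_ae_eq {G : Type*} [TopologicalSpace G] [T2Space G] {f g : ℝ → G} {α β : ℝ}
    (hαβ : α < β) (hf : ContinuousOn f (Icc α β)) (hg : ContinuousOn g (Icc α β))
    (h : f =ᵐ[volume.restrict (Ioc α β)] g) : EqOn f g (Icc α β) := by
  rw [restrict_Ioc_eq_restrict_Icc] at h
  exact Measure.eqOn_Icc_of_ae_eq volume hαβ.ne h hf hg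

namespace Loop

variable {E F : Type*} [NormedAddCommGroup E] [InnerProductSpace ℂ E] [CompleteSpace E]
  [NormedAddCommGroup F] [InnerProductSpace ℂ F] [CompleteSpace F] (S : Loop E F)

/-- A signal that satisfies the integral equation almost everywhere is a solution. -/
theorem ae_eq_of_ae_eq_primitive {x y : ℝ → E × F} {α β γ : ℝ} (hγ : γ ∈ Ioc α β) (v : E × F)
    (hi : IntegrableOn (fun τ => S.rhs 1 τ (x τ)) (Ioc α β))
    (hx : x =ᵐ[volume.restrict (Ioc α β)] fun τ => v + ∫ s in α..τ, S.rhs 1 s (x s))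
    (hy : Continuous y) (hyeq : ∀ t ∈ Icc α β, y t = y α + ∫ s in α..t, S.rhs 1 s (y s))
    (h : v = y α ∨ x =ᵐ[volume.restrict (Ioc α γ)] y) :
    x =ᵐ[volume.restrict (Ioc α β)] y := by
  have hαβ : α < β := hγ.1.trans_le hγ.2
  have hii := (intervalIntegrable_iff_integrableOn_Ioc_of_le hαβ.le).2 hi
  have hcont := continuousOn_const_add_primitive hαβ.le hii v
  -- x' is the continuous representative of x; since they agree almost everywhere, x' satisfies the
  -- integral equation at every time and pointwise uniqueness applies.
  set x' := fun τ => v + ∫ s in α..τ, S.rhs 1 s (x s) with hx'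
  have h0' : x' α = v := by simp [hx']
  have h0 : x' α = y α := by
    rcases h with h | h
    · rw [h0', h]
    · refine eqOn_Icc_of_ae_eq hγ.1 (hcont.mono (Icc_subset_Icc_right hγ.2)) hy.continuousOn ?_
        (left_mem_Icc.2 hγ.1.le)
      filter_upwards [ae_restrict_of_ae_restrict_of_subset (Ioc_subset_Ioc_right hγ.2) hx, h]
        with τ h1 h2
      rw [← h1, h2]
  have hxeq : ∀ t ∈ Icc α β, x' t = x' α + ∫ s in α..t, S.rhs 1 s (x' s) := by
    intro t ht
    have : ∫ s in α..t, S.rhs 1 s (x' s) = ∫ s in α..t, S.rhs 1 s (x s) := by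
      rw [intervalIntegral.integral_of_le ht.1, intervalIntegral.integral_of_le ht.1]
      refine integral_congr_ae ?_
      filter_upwards [ae_restrict_of_ae_restrict_of_subset (Ioc_subset_Ioc_right ht.2) hx]
        with s hs
      simp only [hs]
    rw [this, h0']
  have huniq := S.unique hcont hy.continuousOn hxeq hyeq h0
  filter_upwards [hx, ae_restrict_mem measurableSet_Ioc] with τ hτ hm
  rw [hτ, huniq τ (Ioc_subset_Icc_self hm)]

end Loop

namespace Plant

variable {n m q : ℕ} (p : Plant n m q)

section Window

variable {t : ℝ} {e : ℝ → EuclideanSpace ℂ (Fin n)} {z : ℝ → EuclideanSpace ℂ (Fin q)}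
  {X : Ell2 n} {Z : Ell2 q} {S : Ell2 1}

/-- The feedback formula alone makes u only integrable, too little to integrate u g. But S ∈ ℓ² is
the phasor sequence of an L² signal, and uniqueness in L¹ identifies that signal with u. -/
theorem rhs_of_feedback (he : MemLp e 2 (win p.T t)) (hz : MemLp z 2 (win p.T t))
    (hX : ∀ k, (X - p.Xe) k = phasor p.T e t k)
    (hS : ∀ k, (S - p.Se) k = phasor p.T (fun τ => p.uVec τ (e τ, z τ)) t k) :
    Integrable (fun τ => (p.rhs 1 τ (e τ, z τ)).1) (win p.T t) ∧
      ∀ k, (toeplitz p.T p.aMat - matN p.T n).act ↑(X - p.Xe) k + (p.G X).act ↑(S - p.Se) k =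
        phasor p.T (fun τ => (p.rhs 1 τ (e τ, z τ)).1) t k - jw p.T k • phasor p.T e t k := by
  obtain ⟨s, -, hs, hsS⟩ := exists_periodic_signal p.T_pos (S - p.Se)
  have hsu := ae_eq_of_phasor_eq p.T_pos (integrable_of_memLp_win (hs t)) (p.integrable_uVec he hz)
    fun k => by rw [hsS, hS]
  have hae : (fun τ => p.a τ (e τ) + s τ 0 • p.g τ (e τ)) =ᵐ[win p.T t]
      fun τ => (p.rhs 1 τ (e τ, z τ)).1 := by
    filter_upwards [hsu] with τ hτ
    rw [hτ, uVec_apply, Loop.rhs, one_smul]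
  refine ⟨(p.integrable_state he (hs t)).congr hae, fun k => ?_⟩
  rw [p.state_act he (hs t) hX (fun k => (hsS t k).symm), phasor_congr p.T_pos hae]

end Window

variable {I : Set ℝ} {X : ℝ → Ell2 n} {Z : ℝ → Ell2 q} {S : ℝ → Ell2 1}

/-- Every harmonic solution is the Fourier decomposition of a time domain solution. -/
theorem exists_isSol_of_sol (hsol : p.Sol I X Z S) (hIm : MeasurableSet I)
    (hI : ∀ t ∈ I, 0 ≤ t ∧ ∃ t', t < t' ∧ Icc 0 t' ⊆ I) :
    ∃ y, p.IsSol (-p.T) y ∧ ∀ t ∈ I, (∀ k, (X t - p.Xe) k = phasor p.T (fun τ => (y τ).1) t k) ∧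
      ∀ k, Z t k = phasor p.T (fun τ => (y τ).2) t k := by
  have hT := p.T_pos
  obtain ⟨⟨hXH, hZH, hXd, hZd⟩, hfb⟩ := hsol
  -- At each time separately, the state is represented by a periodic signal; the rest of the proof
  -- shows that these signals fit together.
  choose e he1 he2 he3 using fun t => exists_periodic_signal hT (X t - p.Xe)
  choose z hz1 hz2 hz3 using fun t => exists_periodic_signal hT (Z t)
  let x : ℝ → ℝ → EuclideanSpace ℂ (Fin n) × EuclideanSpace ℂ (Fin q) := fun t τ => (e t τ, z t τ)
  have hX : ∀ t k, (X t - p.Xe) k = phasor p.T (e t) t k := fun t k => (he3 t t k).symm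
  have hZ : ∀ t k, Z t k = phasor p.T (z t) t k := fun t k => (hz3 t t k).symm
  have hS : ∀ t ∈ I, ∀ k, (S t - p.Se) k = phasor p.T (fun τ => p.uVec τ (x t τ)) t k :=
    fun t ht k => (p.feedback_iff (he2 t t) (hz2 t t) (hX t) (hZ t) k).1 (hfb t ht k)
  have hrhs := fun t (ht : t ∈ I) => p.rhs_of_feedback (he2 t t) (hz2 t t) (hX t) (hS t ht)
  have hint : ∀ t ∈ I, Integrable (fun τ => p.rhs 1 τ (x t τ)) (win p.T t) := fun t ht =>
    (hrhs t ht).1.prodMk (p.integrable_extra (he2 t t) (hz2 t t))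
  -- The differential equations hold for almost every t only. At such t they say that the signal has
  -- the coefficients of a primitive of the vector field, with the derivative of the zeroth phasor
  -- in the role of the jump term.
  have hgood : ∀ᵐ t, t ∈ I → ∃ v, x t =ᵐ[win p.T t] fun τ =>
      v + ∫ s in (t - p.T)..τ, p.rhs 1 s (x t s) := by
    filter_upwards [ae_all_iff.2 fun k => (ae_restrict_iff' hIm).1 (hXd k),
      ae_all_iff.2 fun k => (ae_restrict_iff' hIm).1 (hXH.2 k),
      ae_all_iff.2 fun k => (ae_restrict_iff' hIm).1 (hZd k),
      ae_all_iff.2 fun k => (ae_restrict_iff' hIm).1 (hZH.2 k)] with t h1 h2 h3 h4 ht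
    have hk1 : ∀ k, jw p.T k • phasor p.T (e t) t k + expo p.T k t • deriv (fun r => X r 0) t =
        phasor p.T (fun τ => (p.rhs 1 τ (x t τ)).1) t k := fun k => by
      rw [← h2 k ht, (h1 k ht).deriv]
      exact (eq_sub_iff_add_eq'.1 ((hrhs t ht).2 k))
    have hk2 : ∀ k, jw p.T k • phasor p.T (z t) t k + expo p.T k t • deriv (fun r => Z r 0) t =
        phasor p.T (fun τ => (p.rhs 1 τ (x t τ)).2) t k := fun k => by
      rw [← h4 k ht, (h3 k ht).deriv]
      exact (eq_sub_iff_add_eq'.1 (p.extra_act (he2 t t) (hz2 t t) (hX t) (hZ t) k))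
    obtain ⟨v₁, hv₁⟩ := ae_eq_primitive_of_phasor hT (he2 t t) (hint t ht).fst _ hk1
    obtain ⟨v₂, hv₂⟩ := ae_eq_primitive_of_phasor hT (hz2 t t) (hint t ht).snd _ hk2
    refine ⟨(v₁, v₂), ?_⟩
    filter_upwards [hv₁, hv₂, ae_restrict_mem measurableSet_Ioc] with τ h5 h6 hm
    have hi := intervalIntegrable_of_win hT (hint t ht) (r := t - p.T) (s := τ)
      ⟨le_rfl, by linarith⟩ (Ioc_subset_Icc_self hm)
    refine Prod.ext ?_ ?_
    · rw [Prod.fst_add, fst_intervalIntegral hi]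
      exact h5
    · rw [Prod.snd_add, snd_intervalIntegral hi]
      exact h6
  -- The signal at time s is periodic, so it also represents X(s), Z(s) over the window ending at t;
  -- the coincidence condition then compares the two.
  have hpair : ∀ s ∈ I, ∀ t ∈ I, s ≤ t → t ≤ s + p.T → Icc 0 t ⊆ I →
      x t =ᵐ[volume.restrict (Ioc (t - p.T) s)] x s := by
    intro s hs t ht hst htT hIt
    have h1 := ae_eq_of_inH hT hXH (fun k => (hXd k).mono fun r hr => hr.differentiableAt)
      (hI s hs).1 hst htT hIt (integrable_of_memLp_win (he2 s t)) (integrable_of_memLp_win (he2 t t))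
      fun k => by rw [he3, he3]; simp
    have h2 := ae_eq_of_inH hT hZH (fun k => (hZd k).mono fun r hr => hr.differentiableAt)
      (hI s hs).1 hst htT hIt (integrable_of_memLp_win (hz2 s t)) (integrable_of_memLp_win (hz2 t t))
      fun k => by rw [hz3, hz3]
    filter_upwards [h1, h2] with τ h3 h4
    exact Prod.ext h3 h4
  -- An exceptional t is reached from good times r slightly larger: the signals agree on (r - T, t],
  -- and these intervals fill (t - T, t] as r decreases to t. This is why I must extend beyond each
  -- of its points.
  have hall : ∀ t ∈ I, ∃ v, x t =ᵐ[win p.T t] fun τ =>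
      v + ∫ s in (t - p.T)..τ, p.rhs 1 s (x t s) := by
    intro t ht
    obtain ⟨t', htt', hIt'⟩ := (hI t ht).2
    refine ae_eq_primitive_of_forall_Ioo (by linarith) fun γ hγ => ?_
    obtain ⟨r, ⟨v, hv⟩, hr⟩ : ∃ r, (∃ v, x r =ᵐ[win p.T r] fun τ =>
        v + ∫ s in (r - p.T)..τ, p.rhs 1 s (x r s)) ∧ r ∈ Ioo t (min t' (γ + p.T)) := by
      have hlt : t < min t' (γ + p.T) := lt_min htt' (by linarith [hγ.1])
      have hne : NeBot (ae (volume.restrict (Ioo t (min t' (γ + p.T))))) := by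
        rw [ae_neBot, Ne, Measure.restrict_eq_zero, Real.volume_Ioo, ENNReal.ofReal_eq_zero]
        intro h; linarith
      obtain ⟨r, h1, h2⟩ := ((ae_restrict_of_ae (s := Ioo t (min t' (γ + p.T))) hgood).and
        (ae_restrict_mem measurableSet_Ioo)).exists
      exact ⟨r, h1 (hIt' ⟨(hI t ht).1.trans h2.1.le, (h2.2.trans_le (min_le_left _ _)).le⟩), h2⟩
    have hrt' : r < t' := hr.2.trans_le (min_le_left _ _)
    have hrγ : r < γ + p.T := hr.2.trans_le (min_le_right _ _)
    have hIr : Icc 0 r ⊆ I := (Icc_subset_Icc_right hrt'.le).trans hIt'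
    have hrI : r ∈ I := hIr ⟨(hI t ht).1.trans hr.1.le, le_rfl⟩
    have hrt := hpair t ht r hrI hr.1.le (by linarith [hγ.2]) hIr
    have hmem : ∀ τ ∈ Icc (r - p.T) t, IntervalIntegrable (fun s => p.rhs 1 s (x t s)) volume
        (t - p.T) τ := fun τ hτ => intervalIntegrable_of_win hT (hint t ht)
      ⟨le_rfl, by linarith⟩ ⟨by linarith [hτ.1, hr.1], hτ.2⟩
    -- The primitive based at r - T is rebased at t - T.
    refine ⟨v - ∫ s in (t - p.T)..(r - p.T), p.rhs 1 s (x t s), ?_⟩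
    filter_upwards [ae_restrict_of_ae_restrict_of_subset
      (Ioc_subset_Ioc (by linarith) hr.1.le : Ioc γ t ⊆ Ioc (r - p.T) r) hv,
      ae_restrict_of_ae_restrict_of_subset
      (Ioc_subset_Ioc_left (by linarith) : Ioc γ t ⊆ Ioc (r - p.T) t) hrt,
      ae_restrict_mem measurableSet_Ioc] with τ h1 h2 hm
    have hrτ : r - p.T ≤ τ := by linarith [hm.1]
    have h3 : ∫ s in (r - p.T)..τ, p.rhs 1 s (x r s) = ∫ s in (r - p.T)..τ, p.rhs 1 s (x t s) := by
      rw [intervalIntegral.integral_of_le hrτ, intervalIntegral.integral_of_le hrτ]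
      refine integral_congr_ae ?_
      filter_upwards [ae_restrict_of_ae_restrict_of_subset (Ioc_subset_Ioc_right hm.2) hrt]
        with s hs
      simp only [hs]
    rw [← h2, h1, h3, ← intervalIntegral.integral_interval_sub_left
      (hmem τ ⟨hrτ, hm.2⟩) (hmem (r - p.T) ⟨le_rfl, by linarith [hγ.2]⟩)]
    abel
  choose! v hv using hall
  -- v 0 is the value at -T of the continuous representative over the first window; it determines
  -- the only possible trajectory.
  obtain ⟨y, hy, hy0⟩ := p.exists_isSol (-p.T) (v 0)
  -- Advancing by at most half a period keeps an overlap (t - T, s] of positive length with a window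
  -- already identified, and agreement there is the initial condition for uniqueness on the new
  -- window.
  have hstep : ∀ N : ℕ, ∀ t ∈ I, t ≤ N * (p.T / 2) → x t =ᵐ[win p.T t] y := by
    intro N
    induction N with
    | zero =>
      intro t ht htN
      obtain rfl : t = 0 := le_antisymm (by simpa using htN) (hI t ht).1
      refine p.ae_eq_of_ae_eq_primitive (γ := 0) ⟨by linarith, le_rfl⟩ (v 0) (hint 0 ht) (hv 0 ht)
        hy.1 (fun t ht => ?_) (Or.inl ?_)
      · rw [zero_sub] at ht ⊢
        exact hy.2 t ht.1
      · rw [zero_sub, hy0]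
    | succ N ih =>
      intro t ht htN
      by_cases htN' : t ≤ N * (p.T / 2)
      · exact ih t ht htN'
      push Not at htN'
      push_cast at htN
      set s := N * (p.T / 2) with hs
      have hs0 : 0 ≤ s := by positivity
      obtain ⟨t', htt', hIt'⟩ := (hI t ht).2
      have hIt : Icc 0 t ⊆ I := (Icc_subset_Icc_right htt'.le).trans hIt'
      have hsI : s ∈ I := hIt ⟨hs0, htN'.le⟩
      have hsT : t ≤ s + p.T / 2 := by rw [hs]; linarith
      refine p.ae_eq_of_ae_eq_primitive (γ := s) ⟨by linarith, htN'.le⟩ (v t) (hint t ht) (hv t ht)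
        hy.1 (fun r hr => hy.eq_add (by linarith) hr.1) (Or.inr ?_)
      filter_upwards [hpair s hsI t ht htN'.le (by linarith) hIt,
        ae_restrict_of_ae_restrict_of_subset
        (Ioc_subset_Ioc_left (by linarith) : Ioc (t - p.T) s ⊆ Ioc (s - p.T) s)
        (ih s hsI le_rfl)] with τ h1 h2
      rw [h1, h2]
  refine ⟨y, hy, fun t ht => ?_⟩
  obtain ⟨N, hN⟩ := exists_nat_gt (t / (p.T / 2))
  have hxy := hstep N t ht ((div_lt_iff₀ (by positivity)).1 hN).le
  exact ⟨fun k => (hX t k).trans (phasor_congr hT (hxy.mono fun τ hτ => congrArg Prod.fst hτ) k),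
    fun k => (hZ t k).trans (phasor_congr hT (hxy.mono fun τ hτ => congrArg Prod.snd hτ) k)⟩

end Plant

/-! ### Global asymptotic stability -/

namespace Plant

variable {n m q : ℕ} (p : Plant n m q)

variable {X : ℝ → Ell2 n} {Z : ℝ → Ell2 q} {S : ℝ → Ell2 1}

theorem exists_isSol_of_sol_Ici (hsol : p.Sol (Ici 0) X Z S) :
    ∃ y, p.IsSol (-p.T) y ∧ ∀ t, 0 ≤ t →
      (∀ k, (X t - p.Xe) k = phasor p.T (fun τ => (y τ).1) t k) ∧
      ∀ k, Z t k = phasor p.T (fun τ => (y τ).2) t k :=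
  p.exists_isSol_of_sol hsol measurableSet_Ici fun t ht =>
    ⟨ht, t + 1, by linarith, Icc_subset_Ici_self⟩

theorem norm_sq_of_isSol {y : ℝ → EuclideanSpace ℂ (Fin n) × EuclideanSpace ℂ (Fin q)}
    (hy : Continuous y) {t : ℝ} {X : Ell2 n} {Z : Ell2 q}
    (hX : ∀ k, X k = phasor p.T (fun τ => (y τ).1) t k)
    (hZ : ∀ k, Z k = phasor p.T (fun τ => (y τ).2) t k) :
    ‖X‖ ^ 2 + ‖Z‖ ^ 2 = 1 / p.T * ∫ τ in (t - p.T)..t, (‖(y τ).1‖ ^ 2 + ‖(y τ).2‖ ^ 2) := by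
  rw [norm_sq_of_phasor p.T_pos (memLp_win_of_continuous hy.fst 2 t) hX,
    norm_sq_of_phasor p.T_pos (memLp_win_of_continuous hy.snd 2 t) hZ, ← mul_add,
    intervalIntegral.integral_add]
  · exact (hy.fst.norm.pow 2).intervalIntegrable _ _
  · exact (hy.snd.norm.pow 2).intervalIntegrable _ _

/-- The norm of the state is controlled by its initial value, uniformly in the solution. -/
theorem exists_norm_sq_le : ∃ C, 0 < C ∧ ∀ X Z S, p.Sol (Ici 0) X Z S → ∀ t, 0 ≤ t →
    ‖X t - p.Xe‖ ^ 2 + ‖Z t‖ ^ 2 ≤ C * (‖X 0 - p.Xe‖ ^ 2 + ‖Z 0‖ ^ 2) := by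
  obtain ⟨C, hC0, hC⟩ := p.exists_norm_sq_le_V
  obtain ⟨C', hC0', hC'⟩ := p.V_le
  refine ⟨C * C', by positivity, fun X Z S hsol t ht => ?_⟩
  obtain ⟨y, hy, hXZ⟩ := p.exists_isSol_of_sol_Ici hsol
  rw [p.norm_sq_of_isSol hy.1 (hXZ t ht).1 (hXZ t ht).2,
    p.norm_sq_of_isSol hy.1 (hXZ 0 le_rfl).1 (hXZ 0 le_rfl).2]
  have h := hy.integral_norm_sq_le hC0 hC hC' (t := t) (by linarith)
  have hT := p.T_pos
  rw [neg_add_cancel] at h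
  rw [zero_sub, mul_left_comm]
  gcongr

theorem tendsto_of_sol (hsol : p.Sol (Ici 0) X Z S) : Tendsto X atTop (𝓝 p.Xe) := by
  obtain ⟨y, hy, hXZ⟩ := p.exists_isSol_of_sol_Ici hsol
  rw [tendsto_iff_norm_sub_tendsto_zero]
  have h1 := (hy.tendsto_integral_norm_sq.const_mul (1 / p.T)).sqrt
  rw [mul_zero, Real.sqrt_zero] at h1
  refine h1.congr' ?_
  filter_upwards [eventually_ge_atTop 0] with t ht
  rw [← norm_sq_of_phasor p.T_pos (memLp_win_of_continuous hy.1.fst 2 t) (hXZ t ht).1,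
    Real.sqrt_sq (norm_nonneg _)]

theorem globallyAsymptoticallyStable : GloballyAsymptoticallyStable p.T p.Xe p.Sol where
  exists_solution x₀ z₀ := by
    -- The loop is written in the error x - xe.
    obtain ⟨y, hy, hy0⟩ := p.exists_isSol (-p.T) (x₀ - p.xe (-p.T), z₀)
    obtain ⟨X, Z, S, hsol, hXZ⟩ := p.exists_sol_of_isSol hy
    refine ⟨X, Z, S, hsol, fun τ => (y τ).1 + p.xe τ, fun τ => (y τ).2,
      (hy.1.fst.add p.xe_cont).continuousOn, hy.1.snd.continuousOn, by simp [hy0], by simp [hy0],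
      fun t _ k => ⟨?_, (hXZ t).2 k⟩⟩
    rw [phasor_add p.T_pos (integrable_of_memLp_win (memLp_win_of_continuous hy.1.fst 2 t))
      (integrable_of_memLp_win (memLp_win_of_continuous p.xe_cont 2 t)), ← (hXZ t).1,
      p.xe_phasor]
    simp
  extends_solution b _ X Z S hsol := by
    obtain ⟨y, hy, hXZ⟩ := p.exists_isSol_of_sol hsol measurableSet_Ico fun t ht => by
      obtain ⟨t', h1, h2⟩ := exists_between ht.2
      exact ⟨ht.1, t', h1, fun s hs => ⟨hs.1, hs.2.trans_lt h2⟩⟩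
    obtain ⟨X', Z', S', hsol', hXZ'⟩ := p.exists_sol_of_isSol hy
    refine ⟨X', Z', S', hsol', fun t ht => ?_⟩
    have h1 : X' t = X t := sub_left_injective (b := p.Xe) (lp.ext (funext fun k => by
      rw [(hXZ' t).1, (hXZ t ht).1]))
    have h2 : Z' t = Z t := lp.ext (funext fun k => by rw [(hXZ' t).2, (hXZ t ht).2])
    refine ⟨h1, h2, lp.ext (funext fun k => ?_)⟩
    -- The law holds at every time and determines S from X and Z.
    rw [hsol'.2 t ht.1 k, hsol.2 t ht k, h1, h2]
  stable ε hε := by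
    obtain ⟨C, hC0, hC⟩ := p.exists_norm_sq_le
    -- The two initial squared norms share the budget ε² / C equally.
    refine ⟨ε / Real.sqrt (2 * C), by positivity, fun X Z S hsol hX hZ t ht => ?_⟩
    have h1 := hC X Z S hsol t ht
    have hs : Real.sqrt (2 * C) ^ 2 = 2 * C := Real.sq_sqrt (by positivity)
    have h2 : ‖X 0 - p.Xe‖ ^ 2 < ε ^ 2 / (2 * C) := by
      rw [← hs, ← div_pow]
      gcongr
    have h3 : ‖Z 0‖ ^ 2 < ε ^ 2 / (2 * C) := by
      rw [← hs, ← div_pow]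
      gcongr
    have h4 : C * (‖X 0 - p.Xe‖ ^ 2 + ‖Z 0‖ ^ 2) < ε ^ 2 := by
      calc C * (‖X 0 - p.Xe‖ ^ 2 + ‖Z 0‖ ^ 2) < C * (ε ^ 2 / (2 * C) + ε ^ 2 / (2 * C)) := by
            gcongr
        _ = ε ^ 2 := by field_simp; ring
    constructor
    · refine lt_of_pow_lt_pow_left₀ 2 hε.le ?_
      nlinarith [sq_nonneg ‖Z t‖]
    · refine lt_of_pow_lt_pow_left₀ 2 hε.le ?_
      nlinarith [sq_nonneg ‖X t - p.Xe‖]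
  attractive X Z S hsol := p.tendsto_of_sol hsol
  bounded X Z S hsol := by
    obtain ⟨C, hC0, hC⟩ := p.exists_norm_sq_le
    refine ⟨Real.sqrt (C * (‖X 0 - p.Xe‖ ^ 2 + ‖Z 0‖ ^ 2)), fun t ht => ?_⟩
    refine Real.le_sqrt_of_sq_le ?_
    nlinarith [hC X Z S hsol t ht, sq_nonneg ‖X t - p.Xe‖]

end Plant

/-! ### Periodic functions -/

section Periodic

variable {T : ℝ}

theorem intervalIntegrable_of_periodic (hT : 0 < T) {G : Type*} [NormedAddCommGroup G] {f : ℝ → G}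
    (hf : Function.Periodic f T) (h : Integrable f (win T 0)) (s t : ℝ) :
    IntervalIntegrable f volume s t :=
  hf.intervalIntegrable (t := 0 - T) hT.ne'
    (by rw [sub_add_cancel]; exact (intervalIntegrable_win hT).2 h) s t

theorem integrable_Ioc_of_periodic (hT : 0 < T) {G : Type*} [NormedAddCommGroup G] {f : ℝ → G}
    (hf : Function.Periodic f T) (h : Integrable f (volume.restrict (Ioc 0 T))) (s t : ℝ) :
    Integrable f (volume.restrict (Ioc s t)) :=
  (hf.intervalIntegrable (t := 0) hT.ne' (by
    rw [zero_add]; exact (intervalIntegrable_iff_integrableOn_Ioc_of_le hT.le).2 h) s t).1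

theorem memLp_Ioc_of_periodic (hT : 0 < T) {G : Type*} [NormedAddCommGroup G] {f : ℝ → G}
    (hf : Function.Periodic f T) (h : MemLp f 2 (volume.restrict (Ioc 0 T))) (s t : ℝ) :
    MemLp f 2 (volume.restrict (Ioc s t)) := by
  have h1 := integrable_Ioc_of_periodic hT hf (h.integrable (by norm_num)) s t
  refine (memLp_two_iff_integrable_sq_norm h1.1).2 ?_
  exact integrable_Ioc_of_periodic hT (f := fun τ => ‖f τ‖ ^ 2) (fun τ => by simp only [hf τ])
    (integrable_norm_sq h) s t

/-- The set where the two functions differ is invariant under translation by multiples of T and null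
on a fundamental domain. -/
theorem ae_eq_of_periodic (hT : 0 < T) {G : Type*} {f g : ℝ → G} (hf : Function.Periodic f T)
    (hg : Function.Periodic g T) (h : f =ᵐ[win T 0] g) : f =ᵐ[volume] g := by
  have hd := isAddFundamentalDomain_Ioc hT (0 - T)
  rw [sub_add_cancel] at hd
  have hper : ∀ c : AddSubgroup.zmultiples T, ∀ τ,
      f ((c : ℝ) + τ) = f τ ∧ g ((c : ℝ) + τ) = g τ := by
    rintro ⟨c, hc⟩ τ
    obtain ⟨k, rfl⟩ := AddSubgroup.mem_zmultiples_iff.1 hc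
    simp only [add_comm _ τ]
    exact ⟨hf.zsmul k τ, hg.zsmul k τ⟩
  refine hd.measure_zero_of_invariant {τ | f τ = g τ}ᶜ (fun c => ?_) ?_
  · ext τ
    have h1 := hper (-c) τ
    rw [mem_vadd_set_iff_neg_vadd_mem]
    simp only [mem_compl_iff, mem_ofPred_eq]
    rw [AddSubgroup.vadd_def, vadd_eq_add, h1.1, h1.2]
  · have h2 : (volume.restrict (Ioc (0 - T) 0)) {τ | f τ = g τ}ᶜ = 0 := h
    rwa [Measure.restrict_apply₀' measurableSet_Ioc.nullMeasurableSet] at h2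

theorem eq_of_periodic_of_continuous (hT : 0 < T) {G : Type*} [TopologicalSpace G] [T2Space G]
    {f g : ℝ → G} (hf : Function.Periodic f T) (hg : Function.Periodic g T) (hfc : Continuous f)
    (hgc : Continuous g) (h : f =ᵐ[win T 0] g) : f = g :=
  Continuous.ae_eq_iff_eq volume hfc hgc |>.1 (ae_eq_of_periodic hT hf hg h)

/-- A periodic signal whose Fourier coefficients are those of a primitive of a periodic function is
such a primitive. -/
theorem exists_periodic_primitive (hT : 0 < T) {f h : ℝ → ℂ} (hf : Function.Periodic f T)
    (hh : Function.Periodic h T) (hfm : MemLp f 2 (win T 0)) (hhi : Integrable h (win T 0))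
    (hk : ∀ k, jw T k * fc T f 0 k = fc T h 0 k) :
    ∃ F : ℝ → ℂ, Continuous F ∧ Function.Periodic F T ∧ F =ᵐ[volume] f ∧
      ∀ s t, F t = F s + ∫ τ in s..t, h τ := by
  have hi := intervalIntegrable_of_periodic hT hh hhi
  obtain ⟨v, hv⟩ := ae_eq_primitive_of_fc hT hfm hhi 0 fun k => by rw [mul_zero, add_zero]; exact hk k
  -- The equation for k = 0 says that h has mean zero, which makes its primitive periodic.
  have h0 : ∫ τ in (0 - T)..0, h τ = 0 := by
    have h1 := hk 0
    rw [fc, fc] at h1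
    simp only [expo_zero, one_mul] at h1
    have h2 : ((1 / T : ℝ) : ℂ) ≠ 0 := by exact_mod_cast (one_div_pos.2 hT).ne'
    refine (mul_eq_zero.1 (h1.symm.trans ?_)).resolve_left h2
    simp [jw]
  have hP : ∀ s t, v + ∫ τ in (0 - T)..t, h τ = (v + ∫ τ in (0 - T)..s, h τ) + ∫ τ in s..t, h τ := by
    intro s t
    rw [add_assoc, intervalIntegral.integral_add_adjacent_intervals (hi _ _) (hi _ _)]
  have hFper : Function.Periodic (fun t => v + ∫ τ in (0 - T)..t, h τ) T := by
    intro t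
    have h1 := hh.intervalIntegral_add_eq t (0 - T)
    rw [sub_add_cancel, h0] at h1
    simp only
    rw [hP t (t + T), h1, add_zero]
  exact ⟨fun t => v + ∫ τ in (0 - T)..t, h τ,
    continuous_const.add (intervalIntegral.continuous_primitive hi _), hFper,
    ae_eq_of_periodic hT hFper hf hv.symm, hP⟩

end Periodic

/-! ### Periodic matrix functions and positivity of the symbol -/

section PeriodicMatrices

variable {T : ℝ} {a b c : ℕ}

theorem integral_sum_smul {G : Type*} [NormedAddCommGroup G] [NormedSpace ℂ G] [CompleteSpace G]
    {A : ℝ → Matrix (Fin a) (Fin b) ℂ} {s t : ℝ}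
    (hA : ∀ i j, IntervalIntegrable (fun τ => A τ i j) volume s t) (B : Fin a → Fin b → G) :
    ∫ τ in s..t, ∑ i, ∑ j, A τ i j • B i j = ∑ i, ∑ j, (∫ τ in s..t, A τ i j) • B i j := by
  have hB : ∀ i j, IntervalIntegrable (fun τ => A τ i j • B i j) volume s t := fun i j =>
    ⟨(hA i j).1.smul_const _, (hA i j).2.smul_const _⟩
  have hB' : ∀ i, IntervalIntegrable (fun τ => ∑ j, A τ i j • B i j) volume s t := fun i =>
    ⟨integrable_finsetSum _ fun j _ => (hB i j).1, integrable_finsetSum _ fun j _ => (hB i j).2⟩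
  rw [intervalIntegral.integral_finsetSum fun i _ => hB' i]
  refine Finset.sum_congr rfl fun i _ => ?_
  rw [intervalIntegral.integral_finsetSum fun j _ => hB i j]
  exact Finset.sum_congr rfl fun j _ => intervalIntegral.integral_smul_const _ _

theorem integral_mop {A : ℝ → Matrix (Fin a) (Fin b) ℂ} {s t : ℝ}
    (hA : ∀ i j, IntervalIntegrable (fun τ => A τ i j) volume s t) :
    ∫ τ in s..t, mop (A τ) = mop (Matrix.of fun i j => ∫ τ in s..t, A τ i j) := by
  have h := integral_sum_smul hA fun i j => mop (Matrix.single i j (1 : ℂ))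
  have e : (fun τ => mop (A τ)) = fun τ => ∑ i, ∑ j, A τ i j • mop (Matrix.single i j (1 : ℂ)) :=
    funext fun τ => mop_eq_sum (A τ)
  rw [e, h, mop_eq_sum (Matrix.of fun i j => ∫ τ in s..t, A τ i j)]
  rfl

theorem continuous_mop {A : ℝ → Matrix (Fin a) (Fin b) ℂ}
    (hA : ∀ i j, Continuous fun τ => A τ i j) : Continuous fun τ => mop (A τ) := by
  simp only [fun τ => mop_eq_sum (A τ)]
  exact continuous_finsetSum _ fun i _ => continuous_finsetSum _ fun j _ =>
    (hA i j).smul continuous_const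

theorem ae_eq_of_toepAt_eq {t : ℝ} (hT : 0 < T) {A B : ℝ → Matrix (Fin a) (Fin b) ℂ}
    (hA : ∀ i j, Integrable (fun τ => A τ i j) (win T t))
    (hB : ∀ i j, Integrable (fun τ => B τ i j) (win T t)) (h : toepAt T A t = toepAt T B t) :
    A =ᵐ[win T t] B := by
  have : ∀ i j, ∀ᵐ τ ∂(win T t), A τ i j = B τ i j := fun i j =>
    ae_eq_of_integrable_of_fc_eq hT (hA i j) (hB i j) fun k => by
      have := congrFun (congrFun (congrFun (congrFun h k) 0) i) j
      simpa only [toepAt, sub_zero, phasorMat_apply] using this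
  filter_upwards [ae_all_iff.2 fun i => ae_all_iff.2 (this i)] with τ hτ
  ext i j
  exact hτ i j

theorem exists_periodic_primitive_mat (hT : 0 < T) {A H : ℝ → Matrix (Fin a) (Fin b) ℂ}
    (hA : Function.Periodic A T) (hH : Function.Periodic H T)
    (hAm : ∀ i j, MemLp (fun τ => A τ i j) 2 (win T 0))
    (hHi : ∀ i j, Integrable (fun τ => H τ i j) (win T 0))
    (hk : ∀ k, jw T k • phasorMat T A 0 k = phasorMat T H 0 k) :
    ∃ F : ℝ → Matrix (Fin a) (Fin b) ℂ, (∀ i j, Continuous fun τ => F τ i j) ∧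
      Function.Periodic F T ∧ F =ᵐ[volume] A ∧
      ∀ s t, mop (F t) = mop (F s) + ∫ τ in s..t, mop (H τ) := by
  have hHp : ∀ i j, Function.Periodic (fun τ => H τ i j) T := fun i j τ => by simp only [hH τ]
  choose F hF1 hF2 hF3 hF4 using fun i j => exists_periodic_primitive hT
    (f := fun τ => A τ i j) (fun τ => by simp only [hA τ]) (hHp i j) (hAm i j) (hHi i j)
    (fun k => congrFun (congrFun (hk k) i) j)
  refine ⟨fun τ => Matrix.of fun i j => F i j τ, hF1, fun τ => ?_, ?_, fun s t => ?_⟩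
  · ext i j
    exact hF2 i j τ
  · filter_upwards [ae_all_iff.2 fun i => ae_all_iff.2 (hF3 i)] with τ hτ
    ext i j
    exact hτ i j
  · rw [integral_mop fun i j => intervalIntegrable_of_periodic hT (hHp i j) (hHi i j) s t, ← mop_add]
    congr 1
    ext i j
    exact hF4 i j s t

theorem toepAt_add_matN_mul {t : ℝ} (hT : 0 < T) {A : ℝ → Matrix (Fin a) (Fin a) ℂ}
    {B : ℝ → Matrix (Fin a) (Fin b) ℂ} (hA : ∀ i j, MemLp (fun τ => A τ i j) 2 (win T t))
    (hB : ∀ i j, MemLp (fun τ => B τ i j) 2 (win T t)) (k l : ℤ) :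
    (toepAt T A t + matN T a).mul (toepAt T B t) k l =
      phasorMat T (fun τ => A τ * B τ) t (k - l) + jw T k • phasorMat T B t (k - l) := by
  refine Eq.trans ?_ ((hasSum_toepAt_mul hT hA hB k l).add
    (hasSum_matN_mul (T := T) (toepAt T B t) k l)).tsum_eq
  refine tsum_congr fun m => ?_
  rw [Pi.add_apply, Pi.add_apply, Matrix.add_mul]

theorem integrable_mul_entry {μ : Measure ℝ} {A : ℝ → Matrix (Fin a) (Fin b) ℂ}
    {B : ℝ → Matrix (Fin b) (Fin c) ℂ} (hA : ∀ i j, MemLp (fun τ => A τ i j) 2 μ)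
    (hB : ∀ i j, MemLp (fun τ => B τ i j) 2 μ) (i : Fin a) (j : Fin c) :
    Integrable (fun τ => (A τ * B τ) i j) μ := by
  simp only [Matrix.mul_apply]
  exact integrable_finsetSum _ fun p _ => (hA i p).integrable_mul (hB p j)

theorem phasorMat_add {t : ℝ} (hT : 0 < T) {A B : ℝ → Matrix (Fin a) (Fin b) ℂ}
    (hA : ∀ i j, Integrable (fun τ => A τ i j) (win T t))
    (hB : ∀ i j, Integrable (fun τ => B τ i j) (win T t)) (k : ℤ) :
    phasorMat T (fun τ => A τ + B τ) t k = phasorMat T A t k + phasorMat T B t k := by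
  ext i j
  exact fc_add hT (hA i j) (hB i j) k

theorem phasorMat_sub {t : ℝ} (hT : 0 < T) {A B : ℝ → Matrix (Fin a) (Fin b) ℂ}
    (hA : ∀ i j, Integrable (fun τ => A τ i j) (win T t))
    (hB : ∀ i j, Integrable (fun τ => B τ i j) (win T t)) (k : ℤ) :
    phasorMat T (fun τ => A τ - B τ) t k = phasorMat T A t k - phasorMat T B t k := by
  ext i j
  exact fc_sub hT (hA i j) (hB i j) k

theorem phasorMat_neg {t : ℝ} (A : ℝ → Matrix (Fin a) (Fin b) ℂ) (k : ℤ) :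
    phasorMat T (fun τ => -A τ) t k = -phasorMat T A t k := by
  ext i j
  have := fc_const_mul (T := T) (t := t) (-1) (fun τ => A τ i j) k
  simp only [neg_one_mul] at this
  exact this

theorem hasSum_inner_phasor {t : ℝ} (hT : 0 < T) {x y : ℝ → EuclideanSpace ℂ (Fin a)}
    (hx : MemLp x 2 (win T t)) (hy : MemLp y 2 (win T t)) :
    HasSum (fun k => inner ℂ (phasor T x t k) (phasor T y t k))
      (((1 / T : ℝ) : ℂ) * ∫ τ in (t - T)..t, inner ℂ (x τ) (y τ)) := by
  have h1 := hasSum_sum fun i (_ : i ∈ Finset.univ) =>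
    hasSum_conj_fc_mul_fc hT (memLp_coord.1 hx i) (memLp_coord.1 hy i)
  have e1 : ∀ v w : EuclideanSpace ℂ (Fin a), inner ℂ v w = ∑ i, (starRingEnd ℂ) (v i) * w i :=
    fun v w => by simp [PiLp.inner_apply, mul_comm]
  simp only [e1, phasor_apply hT (integrable_of_memLp_win hx),
    phasor_apply hT (integrable_of_memLp_win hy)]
  convert h1 using 1
  rw [← Finset.mul_sum, ← intervalIntegral.integral_finsetSum]
  intro i _
  exact (intervalIntegrable_win hT).2 ((memLp_coord.1 hx i).star.integrable_mul (memLp_coord.1 hy i))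

/-- A positive semidefinite block Toeplitz matrix has a positive semidefinite symbol. -/
theorem re_inner_nonneg_of_isPosDef {n : ℕ} (hT : 0 < T) {P : ℝ → Matrix (Fin n) (Fin n) ℂ}
    (hPc : ∀ i j, Continuous fun τ => P τ i j) (hPp : Function.Periodic P T)
    (hP : (toeplitz T P).IsPosDef) (t : ℝ) (v : EuclideanSpace ℂ (Fin n)) :
    0 ≤ (inner ℂ v (mop (P t) v)).re := by
  have hc : Continuous fun τ => mop (P τ) v := (continuous_mop hPc).clm_apply continuous_const
  have hfc : Continuous fun τ => (inner ℂ v (mop (P τ) v)).re :=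
    Complex.continuous_re.comp (continuous_const.inner hc)
  have hfp : Function.Periodic (fun τ => (inner ℂ v (mop (P τ) v)).re) T := fun τ => by
    simp only [hPp τ]
  have hPm : ∀ i j, MemLp (fun τ => P τ i j) 2 (win T 0) := fun i j =>
    memLp_win_of_continuous (hPc i j) 2 0
  have hae : 0 ≤ᵐ[win T 0] fun τ => (inner ℂ v (mop (P τ) v)).re := by
    -- Positivity is tested on the phasors of the indicator of s times v: by Parseval the quadratic
    -- form equals 1/T times the integral of ⟨v, P v⟩ over s.
    refine ae_nonneg_of_forall_setIntegral_nonneg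
      (integrable_of_memLp_win (memLp_win_of_continuous hfc 2 0)) fun s hs _ => ?_
    have hx : MemLp (s.indicator fun _ => v) 2 (win T 0) := (memLp_const v).indicator hs
    have hy : MemLp (s.indicator fun τ => mop (P τ) v) 2 (win T 0) :=
      (memLp_win_of_continuous hc 2 0).indicator hs
    have e1 : (fun τ => mop (P τ) (s.indicator (fun _ => v) τ)) =
        s.indicator fun τ => mop (P τ) v := by
      funext τ
      by_cases hτ : τ ∈ s <;> simp [hτ]
    have hact := toepAt_act hT hPm hx
    rw [e1] at hact
    have hsum := hasSum_inner_phasor hT hx hy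
    rw [← hact, ← toeplitz_eq_toepAt hT hPp] at hsum
    have hpos : 0 ≤ (∑' k, inner ℂ (phasor T (s.indicator fun _ => v) 0 k)
        ((toeplitz T P).act (phasor T (s.indicator fun _ => v) 0) k)).re := by
      let X : Ell2 n := ⟨_, memℓp_phasor hT hx⟩
      rcases eq_or_ne X 0 with h | h
      · have h0 : ∀ k, phasor T (s.indicator fun _ => v) 0 k = 0 := fun k => by
          change X k = 0
          rw [h]; rfl
        simp only [h0, inner_zero_left, tsum_zero, Complex.zero_re, le_refl]
      · exact (hP.2 X h).le
    rw [hsum.tsum_eq, Complex.re_ofReal_mul, integral_win hT] at hpos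
    have h3 := nonneg_of_mul_nonneg_right hpos (one_div_pos.2 hT)
    have e2 : (fun τ => inner ℂ (s.indicator (fun _ => v) τ) (s.indicator (fun τ => mop (P τ) v) τ)) =
        s.indicator fun τ => inner ℂ v (mop (P τ) v) := by
      funext τ
      by_cases hτ : τ ∈ s <;> simp [hτ]
    rw [e2, integral_indicator hs] at h3
    have hii : Integrable (fun τ => inner ℂ v (mop (P τ) v)) ((win T 0).restrict s) :=
      (integrable_of_memLp_win (memLp_win_of_continuous (continuous_const.inner hc) 2 0)).restrict
    have h4 := Complex.reCLM.integral_comp_comm hii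
    simp only [Complex.reCLM_apply] at h4
    rw [h4]
    exact h3
  -- The almost everywhere inequality becomes an equality between the continuous periodic functions
  -- f and max(f, 0), which then holds at every time.
  have hmax : (fun τ => max (inner ℂ v (mop (P τ) v)).re 0) = fun τ => (inner ℂ v (mop (P τ) v)).re :=
    eq_of_periodic_of_continuous hT (fun τ => by simp only [hPp τ]) hfp (hfc.max continuous_const)
      hfc (hae.mono fun τ hτ => max_eq_left hτ)
  rw [← congrFun hmax t]
  exact le_max_right _ _

end PeriodicMatrices

/-! ### The harmonic equations in the time domain -/

section Equations

variable {T : ℝ} {n m q : ℕ}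

theorem HMat.adj_sub {a b : ℕ} (A B : HMat a b) : (A - B).adj = A.adj - B.adj := by
  funext k l
  exact Matrix.conjTranspose_sub _ _

/-- Taking adjoints turns -𝒩 into +𝒩, so the harmonic equation says jωk P_k is the k-th coefficient
of -(A*P + PA + Q). Hence P agrees almost everywhere with a continuous periodic primitive of that
function. -/
theorem exists_lyapunov_primitive (hT : 0 < T) {A P Q : ℝ → Matrix (Fin n) (Fin n) ℂ}
    (hA : Function.Periodic A T) (hAm : ∀ i j, MemLp (fun τ => A τ i j) 2 (win T 0))
    (hP : Function.Periodic P T) (hPm : ∀ i j, MemLp (fun τ => P τ i j) 2 (win T 0))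
    (hQ : Function.Periodic Q T) (hQm : ∀ i j, MemLp (fun τ => Q τ i j) 2 (win T 0))
    (h : (toepAt T A 0 - matN T n).adj.mul (toepAt T P 0) +
      (toepAt T P 0).mul (toepAt T A 0 - matN T n) + toepAt T Q 0 = 0) :
    ∃ F : ℝ → Matrix (Fin n) (Fin n) ℂ, (∀ i j, Continuous fun τ => F τ i j) ∧
      Function.Periodic F T ∧ F =ᵐ[volume] P ∧ ∀ s t, mop (F t) = mop (F s) + ∫ τ in s..t,
        -(ContinuousLinearMap.adjoint (mop (A τ)) ∘L mop (F τ) + mop (F τ) ∘L mop (A τ) +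
          mop (Q τ)) := by
  have hAHm : ∀ i j, MemLp (fun τ => (A τ)ᴴ i j) 2 (win T 0) := Plant.memLp_conjTranspose hAm
  have h1 := integrable_mul_entry hAHm hPm
  have h2 := integrable_mul_entry hPm hAm
  have h3 := fun i j => integrable_of_memLp_win (hQm i j)
  obtain ⟨F, hF1, hF2, hF3, hF4⟩ := exists_periodic_primitive_mat hT
    (H := fun τ => -((A τ)ᴴ * P τ + P τ * A τ + Q τ)) hP
    (fun τ => by simp only [hA τ, hP τ, hQ τ]) hPm
    (fun i j => (((h1 i j).add (h2 i j)).add (h3 i j)).neg) fun k => by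
      -- Column 0 suffices: there the right factor 𝒩 contributes jω0 = 0, leaving only jωk from the
      -- left one.
      have hk := congrFun (congrFun h k) 0
      rw [HMat.adj_sub, toepAt_adj, matN_adj, sub_neg_eq_add, Pi.add_apply, Pi.add_apply,
        Pi.add_apply, Pi.add_apply, toepAt_add_matN_mul hT hAHm hPm,
        toepAt_mul_sub_matN hT hPm hAm, toepAt, sub_zero] at hk
      rw [phasorMat_neg, phasorMat_add hT (A := fun τ => (A τ)ᴴ * P τ + P τ * A τ)
        (fun i j => (h1 i j).add (h2 i j)) h3, phasorMat_add hT h1 h2]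
      have h0 : jw T 0 = 0 := by simp [jw]
      rw [h0, zero_smul, sub_zero] at hk
      refine eq_neg_of_add_eq_zero_left (Eq.trans ?_ hk)
      abel
  refine ⟨F, hF1, hF2, hF3, fun s t => ?_⟩
  rw [hF4 s t]
  congr 1
  refine intervalIntegral.integral_congr_ae ?_
  filter_upwards [hF3] with τ hτ _
  rw [hτ, mop_neg, mop_add, mop_add, mop_mul, mop_mul, adjoint_mop]

/-- As for the Lyapunov equation: column 0 reads jωk M_k = (OM - MA + C)_k, the Fourier form of M' =
OM - MA + C. -/
theorem exists_sylvester_primitive (hT : 0 < T) {A : ℝ → Matrix (Fin n) (Fin n) ℂ}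
    {O : ℝ → Matrix (Fin q) (Fin q) ℂ} {M C : ℝ → Matrix (Fin q) (Fin n) ℂ}
    (hA : Function.Periodic A T) (hAm : ∀ i j, MemLp (fun τ => A τ i j) 2 (win T 0))
    (hO : Function.Periodic O T) (hOm : ∀ i j, MemLp (fun τ => O τ i j) 2 (win T 0))
    (hM : Function.Periodic M T) (hMm : ∀ i j, MemLp (fun τ => M τ i j) 2 (win T 0))
    (hC : Function.Periodic C T) (hCm : ∀ i j, MemLp (fun τ => C τ i j) 2 (win T 0))
    (h : (toepAt T O 0 - matN T q).mul (toepAt T M 0) -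
      (toepAt T M 0).mul (toepAt T A 0 - matN T n) + toepAt T C 0 = 0) :
    ∃ F : ℝ → Matrix (Fin q) (Fin n) ℂ, (∀ i j, Continuous fun τ => F τ i j) ∧
      Function.Periodic F T ∧ F =ᵐ[volume] M ∧ ∀ s t, mop (F t) = mop (F s) + ∫ τ in s..t,
        (mop (O τ) ∘L mop (F τ) - mop (F τ) ∘L mop (A τ) + mop (C τ)) := by
  have h1 := integrable_mul_entry hOm hMm
  have h2 := integrable_mul_entry hMm hAm
  have h3 := fun i j => integrable_of_memLp_win (hCm i j)
  obtain ⟨F, hF1, hF2, hF3, hF4⟩ := exists_periodic_primitive_mat hT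
    (H := fun τ => O τ * M τ - M τ * A τ + C τ) hM
    (fun τ => by simp only [hA τ, hO τ, hM τ, hC τ]) hMm
    (fun i j => ((h1 i j).sub (h2 i j)).add (h3 i j)) fun k => by
      have hk := congrFun (congrFun h k) 0
      rw [Pi.add_apply, Pi.add_apply, Pi.sub_apply, Pi.sub_apply, toepAt_sub_matN_mul hT hOm hMm,
        toepAt_mul_sub_matN hT hMm hAm, toepAt, sub_zero] at hk
      rw [phasorMat_add hT (A := fun τ => O τ * M τ - M τ * A τ)
        (fun i j => (h1 i j).sub (h2 i j)) h3, phasorMat_sub hT h1 h2]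
      have h0 : jw T 0 = 0 := by simp [jw]
      rw [h0, zero_smul, sub_zero] at hk
      rw [eq_comm, ← sub_eq_zero]
      refine Eq.trans ?_ hk
      abel
  refine ⟨F, hF1, hF2, hF3, fun s t => ?_⟩
  rw [hF4 s t]
  congr 1
  refine intervalIntegral.integral_congr_ae ?_
  filter_upwards [hF3] with τ hτ _
  rw [hτ, mop_add, mop_sub, mop_mul, mop_mul]

theorem phasorMat_colMat {t : ℝ} (hT : 0 < T) {x : ℝ → EuclideanSpace ℂ (Fin n)}
    (hx : Integrable x (win T t)) (k : ℤ) :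
    phasorMat T (fun τ => colMat (x τ)) t k = colMat (phasor T x t k) := by
  ext i j
  exact (phasor_apply hT hx k i).symm

/-- The equilibrium equation says jωk Xe_k is the k-th phasor of A x + B w, so Xe comes from a
continuous periodic signal. Vectors are treated as one-column matrices to reuse the matrix
statement. -/
theorem exists_equilibrium_signal (hT : 0 < T) {A : ℝ → Matrix (Fin n) (Fin n) ℂ}
    {B : ℝ → Matrix (Fin n) (Fin m) ℂ} {w : ℝ → EuclideanSpace ℂ (Fin m)} {Xe : Ell2 n}
    (hA : Function.Periodic A T) (hAm : ∀ i j, MemLp (fun τ => A τ i j) 2 (win T 0))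
    (hB : Function.Periodic B T) (hBm : ∀ i j, MemLp (fun τ => B τ i j) 2 (win T 0))
    (hw : Function.Periodic w T) (hwm : MemLp w 2 (win T 0))
    (h : (toepAt T A 0 - matN T n).act Xe + (toepAt T B 0).act (phasor T w 0) = 0) :
    ∃ xe : ℝ → EuclideanSpace ℂ (Fin n), Continuous xe ∧ Function.Periodic xe T ∧
      ∀ t k, phasor T xe t k = Xe k := by
  obtain ⟨x, hx1, hx2, hx3⟩ := exists_periodic_signal hT Xe
  have h1 := integrable_mop hAm (hx2 0)
  have h2 := integrable_mop hBm hwm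
  have hXe : (Xe : ℤ → EuclideanSpace ℂ (Fin n)) = phasor T x 0 := funext fun k => (hx3 0 k).symm
  obtain ⟨F, hF1, hF2, hF3, -⟩ := exists_periodic_primitive_mat hT
    (A := fun τ => colMat (x τ)) (H := fun τ => colMat (mop (A τ) (x τ) + mop (B τ) (w τ)))
    (fun τ => by simp only [hx1 τ]) (fun τ => by simp only [hA τ, hB τ, hw τ, hx1 τ])
    (Plant.memLp_colMat (hx2 0)) (fun i _ => integrable_coord.1 (h1.add h2) i) fun k => by
      have hk := congrFun h k
      rw [hXe, Pi.add_apply, toepAt_sub_matN_act hT hAm (hx2 0), toepAt_act hT hBm hwm] at hk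
      rw [phasorMat_colMat hT (integrable_of_memLp_win (hx2 0)),
        phasorMat_colMat hT (x := fun τ => mop (A τ) (x τ) + mop (B τ) (w τ)) (h1.add h2),
        phasor_add hT h1 h2]
      have hk' : phasor T (fun τ => mop (A τ) (x τ)) 0 k + phasor T (fun τ => mop (B τ) (w τ)) 0 k =
          jw T k • phasor T x 0 k := by
        rw [← sub_eq_zero, ← hk.trans (Pi.zero_apply k)]
        abel
      rw [hk']
      rfl
  refine ⟨fun τ => WithLp.toLp 2 fun i => F τ i 0, ?_, fun τ => by simp only [hF2 τ], fun t k => ?_⟩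
  · exact (PiLp.continuous_toLp 2 _).comp (continuous_pi fun i => hF1 i 0)
  · rw [← hx3 t k]
    refine phasor_congr hT ((ae_restrict_of_ae hF3).mono fun τ hτ => ?_) k
    ext i
    exact congrFun (congrFun hτ i) 0

theorem re_inner_mop_eq_zero {A : Matrix (Fin q) (Fin q) ℂ} (hA : Aᴴ = -A)
    (v : EuclideanSpace ℂ (Fin q)) : (inner ℂ v (mop A v)).re = 0 := by
  have h1 : inner ℂ v (mop A v) = -inner ℂ (mop A v) v := by
    rw [← ContinuousLinearMap.adjoint_inner_left, adjoint_mop, hA, mop_neg, _root_.neg_apply,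
      inner_neg_left]
  have h2 := congrArg Complex.re h1
  rw [Complex.neg_re, ← inner_conj_symm (𝕜 := ℂ) (mop A v) v, Complex.conj_re] at h2
  linarith

theorem re_inner_mop_pos {A : Matrix (Fin n) (Fin n) ℂ} (hA : A.PosDef)
    {v : EuclideanSpace ℂ (Fin n)} (hv : v ≠ 0) : 0 < (inner ℂ v (mop A v)).re := by
  have h1 := hA.re_dotProduct_pos (x := v.ofLp) (by simpa using hv)
  have h2 : inner ℂ v (mop A v) = star v.ofLp ⬝ᵥ A.mulVec v.ofLp := by
    simp only [PiLp.inner_apply, mop_apply, dotProduct, Matrix.mulVec, Pi.star_apply,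
      RCLike.inner_apply, RCLike.star_def, mul_comm]
  rw [h2]
  exact h1

theorem ae_conjTranspose_eq_neg (hT : 0 < T) {O : ℝ → Matrix (Fin q) (Fin q) ℂ}
    (hO : Function.Periodic O T) (hOm : ∀ i j, MemLp (fun τ => O τ i j) 2 (win T 0))
    (h : (toeplitz T O).adj = -toeplitz T O) : ∀ᵐ τ, (O τ)ᴴ = -O τ := by
  refine ae_eq_of_periodic hT (f := fun τ => (O τ)ᴴ) (g := fun τ => -O τ)
    (fun τ => by simp only [hO τ]) (fun τ => by simp only [hO τ]) ?_
  refine ae_eq_of_toepAt_eq hT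
    (fun i j => integrable_of_memLp_win (Plant.memLp_conjTranspose hOm i j))
    (fun i j => (integrable_of_memLp_win (hOm i j)).neg) ?_
  rw [← toepAt_adj, ← toeplitz_eq_toepAt hT hO, h, toeplitz_eq_toepAt hT hO 0]
  funext k l
  exact (phasorMat_neg O (k - l)).symm

theorem inner_mop_symm (hT : 0 < T) {P : ℝ → Matrix (Fin n) (Fin n) ℂ}
    (hP : Function.Periodic P T) (hPc : ∀ i j, Continuous fun τ => P τ i j)
    (h : (toeplitz T P).adj = toeplitz T P) (t : ℝ) (v w : EuclideanSpace ℂ (Fin n)) :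
    inner ℂ (mop (P t) v) w = inner ℂ v (mop (P t) w) := by
  have hPm : ∀ i j, MemLp (fun τ => P τ i j) 2 (win T 0) := fun i j =>
    memLp_win_of_continuous (hPc i j) 2 0
  have h1 := ae_eq_of_toepAt_eq hT
    (fun i j => integrable_of_memLp_win (Plant.memLp_conjTranspose hPm i j))
    (fun i j => integrable_of_memLp_win (hPm i j))
    (by rw [← toepAt_adj, ← toeplitz_eq_toepAt hT hP, h])
  have h2 : (fun τ => mop (P τ)ᴴ) = fun τ => mop (P τ) :=
    eq_of_periodic_of_continuous hT (fun τ => by simp only [hP τ]) (fun τ => by simp only [hP τ])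
      (continuous_mop fun i j => (hPc j i).star) (continuous_mop hPc)
      (h1.mono fun τ hτ => by simp only [hτ])
  rw [← congrFun h2 t, ← adjoint_mop, ContinuousLinearMap.adjoint_inner_left, adjoint_mop,
    congrFun h2 t]

theorem locallyIntegrable_mop {a b : ℕ} {A : ℝ → Matrix (Fin a) (Fin b) ℂ}
    (hA : ∀ s t i j, MemLp (fun τ => A τ i j) 2 (volume.restrict (Ioc s t))) :
    LocallyIntegrable (fun τ => mop (A τ)) volume :=
  locallyIntegrable_of_Ioc fun s t => (memLp_mop (hA s t)).integrable (by norm_num)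

theorem PeriodicLp.memLp_Ioc {a b : ℕ} (hT : 0 < T) {A : ℝ → Matrix (Fin a) (Fin b) ℂ}
    {p : ℝ≥0∞} (hp : 2 ≤ p) (hA : PeriodicLp T p A) (s t : ℝ) (i : Fin a) (j : Fin b) :
    MemLp (fun τ => A τ i j) 2 (volume.restrict (Ioc s t)) :=
  memLp_Ioc_of_periodic hT (fun τ => by simp only [hA.1 τ]) ((hA.2 i j).mono_exponent hp) s t

theorem PeriodicLp.mul {a b c : ℕ} {A : ℝ → Matrix (Fin a) (Fin b) ℂ}
    {B : ℝ → Matrix (Fin b) (Fin c) ℂ} (hA : PeriodicLp T ⊤ A) (hB : PeriodicLp T ⊤ B) :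
    PeriodicLp T ⊤ fun τ => A τ * B τ := by
  refine ⟨fun τ => by simp only [hA.1 τ, hB.1 τ], fun i j => ?_⟩
  simp only [Matrix.mul_apply]
  exact memLp_finsetSum _ fun p _ => (hB.2 p j).mul (hA.2 i p)

theorem memLp_affine {a b : ℕ} (Dind Ddep : Matrix (Fin a) (Fin b) ℂ)
    {s : ℝ → EuclideanSpace ℂ (Fin 1)} (hs : ∀ r t, MemLp s 2 (volume.restrict (Ioc r t)))
    (r t : ℝ) (i : Fin a) (j : Fin b) :
    MemLp (fun τ => (Dind + s τ 0 • Ddep) i j) 2 (volume.restrict (Ioc r t)) :=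
  (memLp_const (Dind i j)).add ((memLp_coord.1 (hs r t) 0).mul_const (Ddep i j))

end Equations

end Harmonic

theorem mainTheorem12 {n m q r : ℕ} (T : ℝ) (hT : 0 < T) (η : ℝ) (hη : 0 < η)
    -- the bilinear affine system, its `T`-periodic input, and an equilibrium
    (Aind Adep : Matrix (Fin n) (Fin n) ℂ) (Bind Bdep : Matrix (Fin n) (Fin m) ℂ)
    (w : ℝ → EuclideanSpace ℂ (Fin m)) (hw : Function.Periodic w T)
    (hw2 : MemLp w 2 (volume.restrict (Ioc 0 T)))
    (Xe : Ell2 n) (Se : Ell2 1)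
    (he : IsEquilibrium T Aind Adep Bind Bdep Xe Se (phasor T w 0))
    -- the additional dynamics
    (O : ℝ → Matrix (Fin q) (Fin q) ℂ) (hO : PeriodicLp T 2 O)
    (hOskew : (toeplitz T O).adj = -toeplitz T O)
    (L : ℝ → Matrix (Fin q) (Fin r) ℂ) (hL : PeriodicLp T ⊤ L)
    (C : ℝ → Matrix (Fin r) (Fin n) ℂ) (hC : PeriodicLp T ⊤ C)
    -- the harmonic Lyapunov equation
    (Q : ℝ → Matrix (Fin n) (Fin n) ℂ) (hQ : PeriodicLp T ⊤ Q)
    (hQpos : ∀ᵐ t, (Q t).PosDef)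
    (P : ℝ → Matrix (Fin n) (Fin n) ℂ) (hP : PeriodicLp T 2 P)
    (hPpos : (toeplitz T P).IsPosDef)
    (hLyap : (affineMat Aind Adep Se - matN T n).adj.mul (toeplitz T P)
      + (toeplitz T P).mul (affineMat Aind Adep Se - matN T n)
      + toeplitz T Q = 0)
    -- the harmonic Sylvester equation
    (M : ℝ → Matrix (Fin q) (Fin n) ℂ) (hM : PeriodicLp T 2 M)
    (hSylv : (toeplitz T O - matN T q).mul (toeplitz T M)
      - (toeplitz T M).mul (affineMat Aind Adep Se - matN T n)
      + (toeplitz T L).mul (toeplitz T C) = 0) :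
    GloballyAsymptoticallyStable T Xe
      (fun (I : Set ℝ) (X : ℝ → Ell2 n) (Z : ℝ → Ell2 q)
          (S : ℝ → Ell2 1) =>
        IsAugmentedSolution T (affineMat Aind Adep Se) (toeplitz T O)
            ((toeplitz T L).mul (toeplitz T C))
            (matG Adep Bdep (phasor T w 0)) Xe Se I X Z S ∧
          IsForwardingFeedback η (toeplitz T P) (toeplitz T M)
            (matG Adep Bdep (phasor T w 0)) Xe Se I X Z S) := by
  -- Realizing Se by an L² periodic signal makes 𝒜(Se) the Toeplitz matrix of A = Aind + se Adep,
  -- which is in general only L².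
  obtain ⟨se, hse1, hse2, hse3⟩ := exists_periodic_signal hT Se
  have hseI : ∀ r t, MemLp se 2 (volume.restrict (Ioc r t)) :=
    memLp_Ioc_of_periodic hT hse1 (by simpa only [win, sub_self] using hse2 T)
  have hseW := fun t => integrable_of_memLp_win (hse2 t)
  have hwI := memLp_Ioc_of_periodic hT hw hw2
  set A : ℝ → Matrix (Fin n) (Fin n) ℂ := fun τ => Aind + se τ 0 • Adep with hAdef
  have hA : Function.Periodic A T := fun τ => by simp only [hAdef, hse1 τ]
  have hAm := memLp_affine Aind Adep hseI
  have hAeq : affineMat Aind Adep Se = toepAt T A 0 :=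
    affineMat_eq_toepAt hT _ _ (hseW 0) (hse3 0)
  have hOm := hO.memLp_Ioc hT le_rfl
  have hLm := hL.memLp_Ioc hT le_top
  have hCm := hC.memLp_Ioc hT le_top
  have hQm := hQ.memLp_Ioc hT le_top
  have hLC := hL.mul hC
  have hLCm := hLC.memLp_Ioc hT le_top
  have hLCeq : (toeplitz T L).mul (toeplitz T C) = toeplitz T fun τ => L τ * C τ := by
    rw [toeplitz_eq_toepAt hT hL.1 0, toeplitz_eq_toepAt hT hC.1 0,
      toepAt_mul hT (hLm _ _) (hCm _ _), toeplitz_eq_toepAt hT hLC.1 0]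
  obtain ⟨P', hPc, hPp, hPae, hPint⟩ := exists_lyapunov_primitive hT hA (hAm _ _) hP.1
    (hP.memLp_Ioc hT le_rfl _ _) hQ.1 (hQm _ _) (by
      rw [← hAeq, ← toeplitz_eq_toepAt hT hP.1, ← toeplitz_eq_toepAt hT hQ.1]
      exact hLyap)
  obtain ⟨M', hMc, hMp, hMae, hMint⟩ := exists_sylvester_primitive hT hA (hAm _ _) hO.1 (hOm _ _)
    hM.1 (hM.memLp_Ioc hT le_rfl _ _) hLC.1 (hLCm _ _) (by
      rw [← hAeq, ← toeplitz_eq_toepAt hT hM.1, ← toeplitz_eq_toepAt hT hO.1,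
        ← toeplitz_eq_toepAt hT hLC.1, ← hLCeq]
      exact hSylv)
  obtain ⟨xe, hxc, hxp, hxe⟩ := exists_equilibrium_signal hT (Xe := Xe)
    (B := fun τ => Bind + se τ 0 • Bdep) hA (hAm _ _) (fun τ => by simp only [hse1 τ])
    (memLp_affine Bind Bdep hseI _ _) hw (hwI _ _) (by
      rw [← hAeq, ← affineMat_eq_toepAt hT _ _ (hseW 0) (hse3 0)]
      exact he)
  -- The feedback sees P and M only through their Fourier coefficients, so they may be replaced by
  -- the continuous representatives.
  have hPeq : toeplitz T P = toeplitz T P' := by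
    rw [toeplitz_eq_toepAt hT hP.1 0, toeplitz_eq_toepAt hT hPp 0]
    exact toepAt_congr hT (ae_restrict_of_ae hPae.symm)
  have hMeq : toeplitz T M = toeplitz T M' := by
    rw [toeplitz_eq_toepAt hT hM.1 0, toeplitz_eq_toepAt hT hMp 0]
    exact toepAt_congr hT (ae_restrict_of_ae hMae.symm)
  rw [hPeq] at hPpos
  let p : Plant n m q :=
    { T := T, T_pos := hT, η := η, η_pos := hη
      a := fun τ => mop (A τ), o := fun τ => mop (O τ), c := fun τ => mop (L τ * C τ)
      D := mop Adep, g₀ := fun τ => mop Adep (xe τ) + mop Bdep (w τ)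
      P := fun τ => mop (P' τ), M := fun τ => mop (M' τ), Q := fun τ => mop (Q τ)
      a_int := locallyIntegrable_mop hAm
      o_int := locallyIntegrable_mop hOm
      c_int := locallyIntegrable_mop hLCm
      Q_int := locallyIntegrable_mop hQm
      g₀_mem := fun s t => ((mop Adep).comp_memLp' (memLp_Ioc_of_periodic hT hxp
        (by simpa only [win, sub_self] using memLp_win_of_continuous (T := T) hxc 2 T) s t)).add
        ((mop Bdep).comp_memLp' (hwI s t))
      P_per := fun τ => by simp only [hPp τ]
      M_per := fun τ => by simp only [hMp τ]
      Q_per := fun τ => by simp only [hQ.1 τ]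
      P_cont := continuous_mop hPc
      M_cont := continuous_mop hMc
      P_eq := hPint
      M_eq := hMint
      P_symm := inner_mop_symm hT hPp hPc hPpos.1
      P_nonneg := re_inner_nonneg_of_isPosDef hT hPc hPp hPpos
      o_skew := (ae_conjTranspose_eq_neg hT hO.1 (hOm _ _) hOskew).mono fun τ hτ =>
        re_inner_mop_eq_zero hτ
      Q_pos := hQpos.mono fun τ hτ v hv => re_inner_mop_pos hτ hv
      Adep := Adep, Bdep := Bdep, w := w, xe := xe, Xe := Xe, Se := Se
      aMat := A, oMat := O, cMat := fun τ => L τ * C τ, PMat := P', MMat := M'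
      aMat_per := hA, oMat_per := hO.1, cMat_per := hLC.1, PMat_per := hPp, MMat_per := hMp
      w_per := hw
      aMat_mem := fun t => hAm _ _
      oMat_mem := fun t => hOm _ _
      cMat_mem := fun t => hLCm _ _
      PMat_mem := fun t i j => memLp_win_of_continuous (hPc i j) 2 t
      MMat_mem := fun t i j => memLp_win_of_continuous (hMc i j) 2 t
      w_mem := fun t => hwI _ _
      xe_cont := hxc
      xe_phasor := hxe
      a_eq := fun _ => rfl, o_eq := fun _ => rfl, c_eq := fun _ => rfl
      P_eq_mop := fun _ => rfl, M_eq_mop := fun _ => rfl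
      D_eq := rfl, g₀_eq := fun _ => rfl }
  rw [hAeq, ← toeplitz_eq_toepAt hT hA 0, hLCeq, hPeq, hMeq]
  exact p.globallyAsymptoticallyStable
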